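/- Let $C\subseteq[0,1]$ be the middle-thirds Cantor set. For a finite $0$-$1$ sequence $\sigma$ of length $n$ put $0(\sigma)=\sum_{k<n}2\sigma(k)/3^{k+1}$, $1(\sigma)=0(\sigma)+3^{-n}$ (the endpoints of $C$) and $B(\sigma)=C\cap[0(\sigma),1(\sigma)]$. Let $\nabla(c,y)=\bigl(\tfrac{y(2c-1)+1}{2},y\bigr)$ for $(c,y)\in C\times[0,1]$, let $F=\nabla[C\times[0,1]]\subseteq\mathbb R^2$ be the Cantor fan, and for $A\subseteq C\times(0,1]$ put $\dot\nabla A=\nabla[A]\cup\{(\tfrac12,0)\}$. Let $\Xi(c,r)=\bigl(c,\tfrac1\pi\arctan r+\tfrac12\bigr)$, a homeomorphism of $C\times\mathbb R$ onto $C\times(0,1)$. A *continuum* is a connected compact metrizable space with more than one point; it is *Suslinian* if it has no uncountable family of pairwise disjoint subcontinua. A set is *punctiform* if it contains no continuum. A *null-sequence* is a sequence of planar sets whose Euclidean diameters tend to $0$. A *Hawaiian earring* is a union of a null-sequence of simple closed curves in $\mathbb R^2$ any two of which meet in exactly one point, the same for all pairs. A space is *zero-dimensional* if it has a basis of clopen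 sets. There exist sequences $(d_n)_{n<\omega}$ of pairwise distinct non-endpoints of $C$ whose range is dense in $C$. For every such sequence let $f:C\to[0,1]$, $f(c)=\sum_{d_n<c}2^{-n-1}$ (the Dębski function), $r_n=f(d_n)$, $s_n=r_n+2^{-n-1}$, and $$D=\{(c,f(c)):c\in C\}\cup\bigcup_n\{d_n\}\times[r_n,s_n],\quad E=\{(c,f(c)):c\in C\}\cup\{(d_n,s_n):n<\omega\},\quad M=\{(d_n,\tfrac{r_n+s_n}{2}):n<\omega\}.$$ Then $E$ is compact and is the closure of the graph of $f$. For a rectangle $R=B(\sigma)\times[a,b]$, with $\sigma$ of length $n$ and $a<b$, let $T_R(c,r)=(0(\sigma)+c/3^n,\;a+r(b-a))$. Consider families $\mathcal R=\bigcup_n\mathcal R_n$ of rectangles built as follows. $\mathcal R_0=\{C\times[0,1]\}$. For $n\ge1$, $\mathcal R_n$ is a finite set of rectangles $B(\sigma)\times[a,b]$ with $\sigma\in 2^n$ and $0<b-a\le\frac1{n+1}$, such that for each $\sigma\in2^n$ the intervals $[a,b]$ belonging to $\sigma$ do not overlap and have union $$[-n,n+1]\setminus\bigcup\{(x,y):\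 (0(\sigma),x),(1(\sigma),y)\in T_R[D]\text{ for some }R\in\mathcal R_k,\ k<n\}.$$ Such families exist. For every such family $\mathcal R$ let $Y=(C\times\mathbb R)\setminus\bigcup_{R\in\mathcal R}T_R[D\setminus M]$ and $X=\Xi[Y]$. The family $\mathcal R$ is countably infinite; let $R_0,R_1,\dots$ be any enumeration of it without repetitions, and put $\varphi_n=\nabla\circ\Xi\circ T_{R_n}$, $D_n=\varphi_n[D]$, $E_n=\varphi_n[E]$. Then: 1. $(D_n)$ is a null-sequence of pairwise disjoint subsets of $\nabla[C\times(0,1)]$, each $\varphi_n$ embeds $D$, the space $\nabla[C\times(0,1)]\setminus\bigcup_nD_n$ is zero-dimensional, and $\dot\nabla X\cap\bigcup_nD_n=\bigcup_n\varphi_n[M]$. 2. $(E_n)$ is a null-sequence of compact sets, disjoint from $\dot\nabla X$. The partition of $F$ into the sets $E_n$ and the singletons $\{x\}$, $x\in F\setminus\bigcup_nE_n$, is an upper semi-continuous decomposition of $F$ into compact sets. Let $\mathcal F$ be its quotient space, $q:F\to\mathcal F$ the quotient map, $e_n$ the point $q[E_n]$, and $\mathcal D_n=q[D_n]$. 3.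 $\mathcal F$ is a Suslinian continuum, $\dot\nabla X\subseteq F$, and $q$ restricts to a homeomorphic embedding of $\dot\nabla X$ into $\mathcal F$. 4. Each $\mathcal D_n$ is homeomorphic to a Hawaiian earring, and every subcontinuum of $\mathcal F\setminus\{e_n:n<\omega\}$ is an arc contained in some $\mathcal D_m$. 5. $\mathcal F$ is the union of a punctiform set and a countable set. -/

import Mathlib

open Set Filter Topology

noncomputable section

namespace Debski

/-! ## General topological notions -/

/-- A continuum: a connected compact metrizable space with more than one point.
A subcontinuum of `X` is a set `S : Set X` such that `IsContinuum S` holds. -/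
structure IsContinuum (X : Type*) [TopologicalSpace X] : Prop where
  compact : CompactSpace X
  connected : ConnectedSpace X
  metrizable : TopologicalSpace.MetrizableSpace X
  nontrivial : Nontrivial X

/-- A continuum is Suslinian if it has no uncountable collection of pairwise disjoint
subcontinua. -/
def IsSuslinianContinuum (X : Type*) [TopologicalSpace X] : Prop :=
  IsContinuum X ∧
    ∀ 𝒮 : Set (Set X), (∀ S ∈ 𝒮, IsContinuum S) → 𝒮.PairwiseDisjoint id → 𝒮.Countable

/-- A set is punctiform if it contains no continuum. -/
def IsPunctiform {X : Type*} [TopologicalSpace X] (P : Set X) : Prop :=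
  ∀ K : Set X, K ⊆ P → ¬ IsContinuum K

/-- A space is zero-dimensional if it has a basis of clopen sets. -/
def IsZeroDimensional (X : Type*) [TopologicalSpace X] : Prop :=
  TopologicalSpace.IsTopologicalBasis {U : Set X | IsClopen U}

/-- A space is an arc if it is homeomorphic to `[0, 1]`. -/
def IsArc (X : Type*) [TopologicalSpace X] : Prop :=
  Nonempty (X ≃ₜ unitInterval)

/-- An upper semi-continuous decomposition: a partition into compact sets such that every
open set `U` around a member `A` contains all members that meet some smaller open set
around `A`. -/
structure IsUSCDecomposition {X : Type*} [TopologicalSpace X] (𝒢 : Set (Set X)) : Prop where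
  partition : Setoid.IsPartition 𝒢
  compact : ∀ A ∈ 𝒢, IsCompact A
  usc : ∀ A ∈ 𝒢, ∀ U : Set X, IsOpen U → A ⊆ U →
    ∃ V : Set X, IsOpen V ∧ A ⊆ V ∧ ∀ B ∈ 𝒢, (B ∩ V).Nonempty → B ⊆ U

/-- The quotient space of `X` obtained by identifying all points of `A n`, for every `n`
(with the quotient topology). -/
abbrev Shrink {X : Type*} [TopologicalSpace X] (A : ℕ → Set X) : Type _ :=
  Quot fun x y : X => ∃ n, x ∈ A n ∧ y ∈ A n

/-- The Euclidean plane. -/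
abbrev Plane : Type := EuclideanSpace ℝ (Fin 2)

/-- The Euclidean diameters tend to `0`. -/
def IsNullSequence (A : ℕ → Set Plane) : Prop :=
  Tendsto (fun n => Metric.diam (A n)) atTop (𝓝 0)

/-- A Hawaiian earring in the plane: the union of a null-sequence of simple closed curves
any two of which meet exactly in one and the same point `p`. -/
def IsHawaiianEarring (H : Set Plane) : Prop :=
  ∃ (J : ℕ → Set Plane) (p : Plane), (∀ n, Nonempty (Circle ≃ₜ J n)) ∧ IsNullSequence J ∧
    H = ⋃ n, J n ∧ ∀ m n, m ≠ n → J m ∩ J n = {p}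

/-! ## The Cantor set and the Cantor fan -/

/-- The left endpoint `0(σ)` of the clopen piece of the Cantor set with address `σ`. -/
def leftEnd (σ : List Bool) : ℝ :=
  ∑ k : Fin σ.length, 2 * (if σ.get k then (1 : ℝ) else 0) / 3 ^ ((k : ℕ) + 1)

/-- The right endpoint `1(σ)`. -/
def rightEnd (σ : List Bool) : ℝ := leftEnd σ + 1 / 3 ^ σ.length

/-- The map `∇` shrinking the bottom of `C × [0, 1]` to a point. -/
def nabla (p : ℝ × ℝ) : Plane := !₂[(p.2 * (2 * p.1 - 1) + 1) / 2, p.2]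

/-- The vertex `⟨1/2, 0⟩` of the Cantor fan. -/
def vertex : Plane := !₂[1 / 2, 0]

/-- The image under `∇` with the vertex added. -/
def dotNabla (A : Set (ℝ × ℝ)) : Set Plane := nabla '' A ∪ {vertex}

/-- The Cantor fan `∇(C × [0, 1])`. -/
def cantorFan : Set Plane := nabla '' (cantorSet ×ˢ Icc 0 1)

/-- The homeomorphism `Ξ` from `C × ℝ` to `C × (0, 1)`. -/
def squeeze (p : ℝ × ℝ) : ℝ × ℝ := (p.1, 1 / Real.pi * Real.arctan p.2 + 1 / 2)

/-! ## The Dębski function -/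

/-- `d` enumerates, without repetitions, a dense set of non-endpoints of the Cantor set. -/
structure IsDenseNonEndpoints (d : ℕ → ℝ) : Prop where
  injective : Function.Injective d
  mem : ∀ n, d n ∈ cantorSet
  dense : cantorSet ⊆ closure (range d)
  ne_leftEnd : ∀ n σ, d n ≠ leftEnd σ
  ne_rightEnd : ∀ n σ, d n ≠ rightEnd σ

/-- The Dębski function: the sum of `2 ^ (-n-1)` over all `n` with `d n < c`. -/
def debskiFun (d : ℕ → ℝ) (c : ℝ) : ℝ :=
  ∑' n : ℕ, if d n < c then (1 / 2 : ℝ) ^ (n + 1) else 0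

/-- The graph of the Dębski function over the Cantor set. -/
def graphSet (d : ℕ → ℝ) : Set (ℝ × ℝ) := {p | p.1 ∈ cantorSet ∧ p.2 = debskiFun d p.1}

/-- `D`: the graph together with the vertical arcs that fill its jumps. -/
def setD (d : ℕ → ℝ) : Set (ℝ × ℝ) :=
  graphSet d ∪
    ⋃ n : ℕ, {d n} ×ˢ Icc (debskiFun d (d n)) (debskiFun d (d n) + (1 / 2 : ℝ) ^ (n + 1))

/-- `E`: the graph together with the upper end points of its jumps. -/
def setE (d : ℕ → ℝ) : Set (ℝ × ℝ) :=
  graphSet d ∪ range fun n : ℕ => (d n, debskiFun d (d n) + (1 / 2 : ℝ) ^ (n + 1))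

/-- `M`: the midpoints of the vertical arcs in `D`. -/
def setM (d : ℕ → ℝ) : Set (ℝ × ℝ) :=
  range fun n : ℕ => (d n, debskiFun d (d n) + (1 / 2 : ℝ) ^ (n + 2))

/-! ## The tilings -/

/-- The rectangle `B(word) × [lo, hi]` in `C × ℝ`, given by its data. -/
@[ext]
structure Rect where
  word : List Bool
  lo : ℝ
  hi : ℝ

/-- The affine map from `C × [0, 1]` onto the rectangle `R`. -/
def Rect.map (R : Rect) (p : ℝ × ℝ) : ℝ × ℝ :=
  (leftEnd R.word + p.1 / 3 ^ R.word.length, R.lo + p.2 * (R.hi - R.lo))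

/-- `gaps d 𝓡 σ` is the union of the open intervals `(x, y)`, where `x` and `y` are the heights
over `0(σ)` and `1(σ)` of the copy of `D` in a rectangle of `𝓡` of level less than that
of `σ`. -/
def gaps (d : ℕ → ℝ) (𝓡 : Set Rect) (σ : List Bool) : Set ℝ :=
  {t | ∃ R ∈ 𝓡, R.word.length < σ.length ∧
    ∃ x y, (leftEnd σ, x) ∈ R.map '' setD d ∧ (rightEnd σ, y) ∈ R.map '' setD d ∧
      t ∈ Ioo x y}

/-- `𝓡` is the union of the families `𝓡_n` of the recursive construction, where
`𝓡_n = {R ∈ 𝓡 | R.word.length = n}`. The family `𝓡_0` consists of `C × [0, 1]` only. For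
`n ≥ 1` the family `𝓡_n` is finite, its members have height at most `1 / (n + 1)`, and for every
`σ` of length `n` the members over `B(σ)` tile the strips that remain of `B(σ) × [-n, n + 1]`
when the open intervals spanned by the earlier copies of `D` are removed. -/
structure IsTiling (d : ℕ → ℝ) (𝓡 : Set Rect) : Prop where
  zero : {R ∈ 𝓡 | R.word.length = 0} = {⟨[], 0, 1⟩}
  finite : ∀ n : ℕ, {R ∈ 𝓡 | R.word.length = n}.Finite
  lo_lt_hi : ∀ R ∈ 𝓡, R.lo < R.hi
  height_le : ∀ R ∈ 𝓡, R.hi - R.lo ≤ 1 / ((R.word.length : ℝ) + 1)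
  nonoverlapping : ∀ R ∈ 𝓡, ∀ S ∈ 𝓡, R.word = S.word → R ≠ S →
    Disjoint (Ioo R.lo R.hi) (Ioo S.lo S.hi)
  tile : ∀ σ : List Bool, σ ≠ [] →
    (⋃ R ∈ {R ∈ 𝓡 | R.word = σ}, Icc R.lo R.hi) =
      Icc (-(σ.length : ℝ)) ((σ.length : ℝ) + 1) \ gaps d 𝓡 σ

/-! ## The set `X` and the copies of `D` and `E` in the Cantor fan -/

/-- `Y`: the complement in `C × ℝ` of all copies of `D \ M`. -/
def setY (d : ℕ → ℝ) (𝓡 : Set Rect) : Set (ℝ × ℝ) :=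
  (cantorSet ×ˢ univ) \ ⋃ R ∈ 𝓡, R.map '' (setD d \ setM d)

/-- `X = Ξ[Y]`. -/
def setX (d : ℕ → ℝ) (𝓡 : Set Rect) : Set (ℝ × ℝ) := squeeze '' setY d 𝓡

/-- The natural map from `C × [0, 1]` onto the part of the Cantor fan that corresponds to the
rectangle `R`. -/
def Rect.toFan (R : Rect) (p : ℝ × ℝ) : Plane := nabla (squeeze (R.map p))

/-- The copy `D_n` of `D` in the Cantor fan. -/
def copyD (d : ℕ → ℝ) (R : ℕ → Rect) (n : ℕ) : Set Plane := (R n).toFan '' setD d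

/-- The natural copy `E_n` of `E` in `D_n`. -/
def copyE (d : ℕ → ℝ) (R : ℕ → Rect) (n : ℕ) : Set Plane := (R n).toFan '' setE d

/-- `E_n` as a subset of the space `cantorFan`. -/
def fanE (d : ℕ → ℝ) (R : ℕ → Rect) (n : ℕ) : Set cantorFan := Subtype.val ⁻¹' copyE d R n

/-- The decomposition of the Cantor fan into the sets `E_n` and the remaining singletons. -/
def decomposition (d : ℕ → ℝ) (R : ℕ → Rect) : Set (Set cantorFan) :=
  range (fanE d R) ∪ {A | ∃ x, x ∉ ⋃ n, fanE d R n ∧ A = {x}}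

/-- The space `𝓕`: the Cantor fan with every `E_n` shrunk to a point. -/
abbrev FSpace (d : ℕ → ℝ) (R : ℕ → Rect) : Type := Shrink (fanE d R)

/-- The quotient map from the Cantor fan to `𝓕`. -/
def proj (d : ℕ → ℝ) (R : ℕ → Rect) (x : cantorFan) : FSpace d R := Quot.mk _ x

/-- The image `𝓓_n` of `D_n` in `𝓕`. -/
def quotD (d : ℕ → ℝ) (R : ℕ → Rect) (n : ℕ) : Set (FSpace d R) :=
  proj d R '' (Subtype.val ⁻¹' copyD d R n)

end Debski

end

open Debski

namespace Debski

/-! ## Self-similarity of the Cantor set -/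

/-! Write `f` for the Dębski function and `F` for its right-continuous version `debskiUpper`. The
two differ exactly at the points `d n`, and `D` is the region `f ≤ t ≤ F` over the Cantor set
(`mem_setD`). The open jump intervals are pairwise disjoint, so a height inside a jump already
determines the vertical arc it belongs to (`eq_of_height_mem_Ioo`). Hence `E` is `D` with an open
set of heights removed, and collapsing `E` turns the arcs of `D` into circles that meet in one
point. Winding the `k`-th arc around a circle of radius `2⁻ᵏ` identifies the quotient with a
Hawaiian earring (`earringMap_eq_iff`).

The tiling supplies two properties of the copies of `D` over a fixed point `c`. Separation
(`IsPacking.upp_lt_low`): two copies occupy disjoint height intervals. Density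
(`IsTiling.exists_near`, `exists_above`, `exists_below`): a height on no copy is approached from
both sides by copies over the same `c`. Density makes the complement of the copies zero-dimensional,
since small boxes bounded above and below by copies are clopen there. It also shows that a vertical
segment either lies in an open arc of a copy or meets a copy of `E` (`IsTiling.exists_arc_or`).

A null-sequence of disjoint compact sets can be shrunk to points without losing compactness or
metrizability, and the quotient map is an embedding on any set that misses them (`IsShrinkable`). A
subcontinuum of `𝓕` that avoids all `e_n` therefore pulls back to a continuum in the fan that misses
all `E_n`. It cannot contain the vertex (`subset_vertex`), so it projects into the totally
disconnected Cantor set, is a vertical segment, and lies in an arc of some copy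
(`exists_eq_segment`). Consequently the points `e_n`, together with the points of rational height
(before squeezing) over the jumps, form a countable set that meets every subcontinuum. Its
complement is punctiform, and disjoint subcontinua can only be countably many. -/

lemma leftEnd_nil : leftEnd [] = 0 := by simp [leftEnd]

lemma leftEnd_cons (b : Bool) (σ : List Bool) :
    leftEnd (b :: σ) = (2 * (if b then (1 : ℝ) else 0) + leftEnd σ) / 3 := by
  simp only [leftEnd, List.length_cons]
  rw [Fin.sum_univ_succ, add_div, Finset.sum_div]
  congr 1
  · cases b <;> simp
  · refine Finset.sum_congr rfl fun k _ => ?_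
    simp [pow_succ, div_div]

/-- The similarity that maps the Cantor set onto its piece with address `σ`. -/
noncomputable def similarity (σ : List Bool) (x : ℝ) : ℝ := leftEnd σ + x / 3 ^ σ.length

/-- The clopen piece of the Cantor set with address `σ`. -/
def piece (σ : List Bool) : Set ℝ := similarity σ '' cantorSet

lemma similarity_nil (x : ℝ) : similarity [] x = x := by simp [similarity, leftEnd_nil]

lemma similarity_cons (b : Bool) (σ : List Bool) (x : ℝ) :
    similarity (b :: σ) x = (2 * (if b then (1 : ℝ) else 0) + similarity σ x) / 3 := by
  simp only [similarity, leftEnd_cons, List.length_cons, pow_succ]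
  field_simp
  ring

lemma similarity_append (σ τ : List Bool) (x : ℝ) :
    similarity (σ ++ τ) x = similarity σ (similarity τ x) := by
  induction σ with
  | nil => simp [similarity_nil]
  | cons b σ ih => simp only [List.cons_append, similarity_cons, ih]

lemma similarity_zero (σ : List Bool) : similarity σ 0 = leftEnd σ := by simp [similarity]

lemma similarity_one (σ : List Bool) : similarity σ 1 = rightEnd σ := rfl

lemma similarity_strictMono (σ : List Bool) : StrictMono (similarity σ) := by
  intro x y h
  unfold similarity
  gcongr

lemma one_mem_cantorSet : (1 : ℝ) ∈ cantorSet := by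
  simp only [cantorSet, mem_iInter]
  intro n
  induction n with
  | zero => simp
  | succ n ih =>
    rw [preCantorSet_succ]
    exact Or.inr ⟨1, ih, by norm_num⟩

lemma similarity_mem_cantorSet (σ : List Bool) {x : ℝ} (hx : x ∈ cantorSet) :
    similarity σ x ∈ cantorSet := by
  induction σ with
  | nil => rwa [similarity_nil]
  | cons b σ ih =>
    rw [similarity_cons, cantorSet_eq_union_halves]
    cases b
    · exact Or.inl ⟨_, ih, by simp⟩
    · exact Or.inr ⟨_, ih, by simp⟩

lemma piece_subset_cantorSet (σ : List Bool) : piece σ ⊆ cantorSet := by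
  rintro _ ⟨x, hx, rfl⟩
  exact similarity_mem_cantorSet σ hx

lemma leftEnd_mem_piece (σ : List Bool) : leftEnd σ ∈ piece σ :=
  ⟨0, zero_mem_cantorSet, similarity_zero σ⟩

lemma rightEnd_mem_piece (σ : List Bool) : rightEnd σ ∈ piece σ :=
  ⟨1, one_mem_cantorSet, similarity_one σ⟩

lemma leftEnd_le_of_mem_piece {σ : List Bool} {c : ℝ} (hc : c ∈ piece σ) : leftEnd σ ≤ c := by
  obtain ⟨x, hx, rfl⟩ := hc
  rw [← similarity_zero]
  exact (similarity_strictMono σ).monotone (cantorSet_subset_unitInterval hx).1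

lemma le_rightEnd_of_mem_piece {σ : List Bool} {c : ℝ} (hc : c ∈ piece σ) : c ≤ rightEnd σ := by
  obtain ⟨x, hx, rfl⟩ := hc
  rw [← similarity_one]
  exact (similarity_strictMono σ).monotone (cantorSet_subset_unitInterval hx).2

lemma leftEnd_lt_rightEnd (σ : List Bool) : leftEnd σ < rightEnd σ := by
  unfold rightEnd
  have : (0 : ℝ) < 1 / 3 ^ σ.length := by positivity
  linarith

lemma leftEnd_nonneg (σ : List Bool) : 0 ≤ leftEnd σ :=
  (cantorSet_subset_unitInterval (piece_subset_cantorSet σ (leftEnd_mem_piece σ))).1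

lemma rightEnd_le_one (σ : List Bool) : rightEnd σ ≤ 1 :=
  (cantorSet_subset_unitInterval (piece_subset_cantorSet σ (rightEnd_mem_piece σ))).2

lemma piece_nil : piece [] = cantorSet := by
  have : similarity [] = id := funext similarity_nil
  simp [piece, this]

lemma exists_mem_piece (n : ℕ) {c : ℝ} (hc : c ∈ cantorSet) :
    ∃ σ : List Bool, σ.length = n ∧ c ∈ piece σ := by
  induction n generalizing c with
  | zero => exact ⟨[], rfl, by rwa [piece_nil]⟩
  | succ n ih =>
    rw [cantorSet_eq_union_halves] at hc
    rcases hc with ⟨x, hx, rfl⟩ | ⟨x, hx, rfl⟩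
    · obtain ⟨σ, hσ, y, hy, rfl⟩ := ih hx
      exact ⟨false :: σ, by simp [hσ], y, hy, by simp [similarity_cons]⟩
    · obtain ⟨σ, hσ, y, hy, rfl⟩ := ih hx
      exact ⟨true :: σ, by simp [hσ], y, hy, by simp [similarity_cons]⟩

lemma rightEnd_cons (b : Bool) (σ : List Bool) :
    rightEnd (b :: σ) = (2 * (if b then (1 : ℝ) else 0) + rightEnd σ) / 3 :=
  similarity_cons b σ 1

/-- The first letter in which the addresses differ puts the pieces on opposite sides of a removed
middle third, whose length is at least `3⁻ⁿ` for addresses of length `n`. This gap is what makes the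
pieces open in the Cantor set. -/
lemma rightEnd_add_le_leftEnd {σ τ : List Bool} (h : σ.length = τ.length) (hne : σ ≠ τ) :
    rightEnd σ + 1 / 3 ^ σ.length ≤ leftEnd τ ∨ rightEnd τ + 1 / 3 ^ σ.length ≤ leftEnd σ := by
  induction σ generalizing τ with
  | nil =>
    cases τ with
    | nil => exact absurd rfl hne
    | cons => simp at h
  | cons b σ ih =>
    cases τ with
    | nil => simp at h
    | cons b' τ =>
      have hl : σ.length = τ.length := by simpa using h
      rw [rightEnd_cons, rightEnd_cons, leftEnd_cons, leftEnd_cons, List.length_cons, pow_succ]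
      have h1 : (1 : ℝ) / 3 ^ σ.length ≤ 1 := by
        rw [div_le_one (by positivity)]
        exact one_le_pow₀ (by norm_num)
      have h2 : (1 : ℝ) / (3 ^ σ.length * 3) = 1 / 3 ^ σ.length / 3 := by rw [div_div]
      rw [h2]
      have hσ0 := leftEnd_nonneg σ
      have hτ0 := leftEnd_nonneg τ
      have hσ1 := rightEnd_le_one σ
      have hτ1 := rightEnd_le_one τ
      by_cases hb : b = b'
      · subst hb
        have hne' : σ ≠ τ := fun e => hne (by rw [e])
        rcases ih hl hne' with h | h
        · left; linarith
        · right; linarith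
      · cases b <;> cases b' <;> simp at hb ⊢ <;> rw [← one_div]
        · left; linarith
        · right; linarith

lemma mem_piece_unique {σ τ : List Bool} (h : σ.length = τ.length) {c : ℝ} (hσ : c ∈ piece σ)
    (hτ : c ∈ piece τ) : σ = τ := by
  by_contra hne
  have : (0 : ℝ) < 1 / 3 ^ σ.length := by positivity
  have h1 := leftEnd_le_of_mem_piece hσ
  have h2 := leftEnd_le_of_mem_piece hτ
  have h3 := le_rightEnd_of_mem_piece hσ
  have h4 := le_rightEnd_of_mem_piece hτ
  rcases rightEnd_add_le_leftEnd h hne with h | h <;> linarith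

/-- Widening a piece by the length of the gap reaches no other piece of the same level. Pieces are
thus traces of open intervals as well as of closed ones. -/
lemma mem_piece_of_mem_Ioo {σ : List Bool} {c : ℝ} (hc : c ∈ cantorSet)
    (h : c ∈ Ioo (leftEnd σ - 1 / 3 ^ σ.length) (rightEnd σ + 1 / 3 ^ σ.length)) :
    c ∈ piece σ := by
  obtain ⟨τ, hl, hτ⟩ := exists_mem_piece σ.length hc
  by_cases e : τ = σ
  · rwa [← e]
  exfalso
  have h2 := leftEnd_le_of_mem_piece hτ
  have h4 := le_rightEnd_of_mem_piece hτ
  obtain ⟨h5, h6⟩ := h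
  rcases rightEnd_add_le_leftEnd hl e with h | h <;> rw [hl] at h <;> linarith

lemma mem_Ioo_of_mem_piece {σ : List Bool} {c : ℝ} (hc : c ∈ piece σ) :
    c ∈ Ioo (leftEnd σ - 1 / 3 ^ σ.length) (rightEnd σ + 1 / 3 ^ σ.length) := by
  have : (0 : ℝ) < 1 / 3 ^ σ.length := by positivity
  constructor
  · linarith [leftEnd_le_of_mem_piece hc]
  · linarith [le_rightEnd_of_mem_piece hc]

lemma mem_piece_of_mem_Icc {σ : List Bool} {c : ℝ} (hc : c ∈ cantorSet)
    (h : c ∈ Icc (leftEnd σ) (rightEnd σ)) : c ∈ piece σ := by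
  have : (0 : ℝ) < 1 / 3 ^ σ.length := by positivity
  exact mem_piece_of_mem_Ioo hc ⟨by linarith [h.1], by linarith [h.2]⟩

lemma isClosed_piece (σ : List Bool) : IsClosed (piece σ) := by
  have : piece σ = cantorSet ∩ Icc (leftEnd σ) (rightEnd σ) :=
    Subset.antisymm (fun c hc => ⟨piece_subset_cantorSet σ hc, leftEnd_le_of_mem_piece hc,
      le_rightEnd_of_mem_piece hc⟩) fun c hc => mem_piece_of_mem_Icc hc.1 hc.2
  rw [this]
  exact isClosed_cantorSet.inter isClosed_Icc

lemma piece_append_subset (σ τ : List Bool) : piece (σ ++ τ) ⊆ piece σ := by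
  rintro _ ⟨x, hx, rfl⟩
  rw [similarity_append]
  exact ⟨_, similarity_mem_cantorSet τ hx, rfl⟩

/-- The truncation of `τ` to the length of `σ` addresses a piece around `c` of the same level as
`σ`, and such an address is unique. Pieces are therefore nested or disjoint. -/
lemma exists_eq_append_of_mem_piece {σ τ : List Bool} {c : ℝ} (hσ : c ∈ piece σ) (hτ : c ∈ piece τ)
    (h : σ.length ≤ τ.length) : ∃ ρ, τ = σ ++ ρ := by
  refine ⟨τ.drop σ.length, ?_⟩
  have h1 : c ∈ piece (τ.take σ.length) := by
    apply piece_append_subset _ (τ.drop σ.length)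
    rwa [List.take_append_drop]
  have h2 : σ = τ.take σ.length := mem_piece_unique (by simp [h]) hσ h1
  conv_lhs => rw [← List.take_append_drop σ.length τ]
  rw [← h2]

lemma piece_subset_Ioo {σ : List Bool} {c ε : ℝ} (hc : c ∈ piece σ) (h : 1 / 3 ^ σ.length < ε) :
    piece σ ⊆ Ioo (c - ε) (c + ε) := by
  intro x hx
  have h1 := leftEnd_le_of_mem_piece hc
  have h2 := leftEnd_le_of_mem_piece hx
  have h3 := le_rightEnd_of_mem_piece hc
  have h4 := le_rightEnd_of_mem_piece hx
  unfold rightEnd at h3 h4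
  constructor <;> linarith

lemma exists_piece_subset_Ioo {c ε : ℝ} (hε : 0 < ε) :
    ∃ N, ∀ σ : List Bool, N ≤ σ.length → c ∈ piece σ → piece σ ⊆ Ioo (c - ε) (c + ε) := by
  obtain ⟨N, hN⟩ := exists_pow_lt_of_lt_one hε (by norm_num : (1 / 3 : ℝ) < 1)
  refine ⟨N, fun σ hσ hcσ => piece_subset_Ioo hcσ (lt_of_le_of_lt ?_ hN)⟩
  rw [← one_div_pow]
  exact pow_le_pow_of_le_one (by norm_num) (by norm_num) hσ

lemma not_countable_cantorSet : ¬ cantorSet.Countable := by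
  intro h
  have h1 : Countable cantorSet := h.to_subtype
  have h2 : Countable (ℕ → Bool) := cantorSetHomeomorphNatToBool.symm.injective.countable
  have e : (ℕ → Bool) ≃ Set ℕ := (Equiv.arrowCongr (Equiv.refl ℕ) Equiv.propEquivBool.symm)
  have h3 : Countable (Set ℕ) := e.symm.injective.countable
  obtain ⟨g, hg⟩ := exists_surjective_nat (Set ℕ)
  exact Function.cantor_surjective g hg

lemma isTotallyDisconnected_cantorSet : IsTotallyDisconnected cantorSet := by
  rw [← totallyDisconnectedSpace_subtype_iff]
  exact cantorSetHomeomorphNatToBool.symm.totallyDisconnectedSpace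

/-- The end points of the Cantor set. -/
def endpoints : Set ℝ := range leftEnd ∪ range rightEnd

/-- A piece is a similar copy of the uncountable Cantor set, whereas there are only countably many
endpoints. -/
lemma exists_mem_piece_notMem_endpoints (σ : List Bool) : ∃ c ∈ piece σ, c ∉ endpoints := by
  by_contra! h
  have h1 : (piece σ).Countable :=
    ((countable_range leftEnd).union (countable_range rightEnd)).mono h
  exact not_countable_cantorSet
    (countable_of_injective_of_countable_image (similarity_strictMono σ).injective.injOn h1)

lemma exists_isDenseNonEndpoints : ∃ d : ℕ → ℝ, IsDenseNonEndpoints d := by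
  choose x hx hx' using exists_mem_piece_notMem_endpoints
  have hdense : cantorSet ⊆ closure (range x) := by
    intro c hc
    rw [Metric.mem_closure_iff]
    intro ε hε
    obtain ⟨N, hN⟩ := exists_piece_subset_Ioo (c := c) hε
    obtain ⟨σ, hσ, hcσ⟩ := exists_mem_piece N hc
    refine ⟨x σ, mem_range_self σ, ?_⟩
    have := hN σ hσ.ge hcσ (hx σ)
    rw [dist_comm, Real.dist_eq, abs_lt]
    constructor <;> linarith [this.1, this.2]
  -- Different pieces may receive the same point, so the choice has to be re-enumerated without
  -- repetitions by `ℕ`. This needs an infinite range: a finite one would be closed and, by density,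
  -- contain the whole Cantor set.
  have hcount : Countable (range x) := (countable_range x).to_subtype
  have hinf : Infinite (range x) := by
    rw [infinite_coe_iff]
    intro hfin
    rw [hfin.isClosed.closure_eq] at hdense
    exact not_countable_cantorSet (hfin.countable.mono hdense)
  obtain ⟨e⟩ := nonempty_equiv_of_countable (α := ℕ) (β := range x)
  have hr : range (fun n => (e n : ℝ)) = range x := by
    rw [show (fun n => (e n : ℝ)) = Subtype.val ∘ e from rfl, range_comp, e.range_eq_univ,
      image_univ,
      Subtype.range_coe]
  have hm : ∀ n, ∃ σ, x σ = e n := fun n => (e n).2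
  refine ⟨fun n => e n, Subtype.val_injective.comp e.injective, fun n => ?_, by rwa [hr], ?_, ?_⟩
  · obtain ⟨σ, h⟩ := hm n
    exact h ▸ piece_subset_cantorSet σ (hx σ)
  · intro n τ h
    obtain ⟨σ, h'⟩ := hm n
    exact hx' σ (Or.inl ⟨τ, by rw [h', ← h]⟩)
  · intro n τ h
    obtain ⟨σ, h'⟩ := hm n
    exact hx' σ (Or.inr ⟨τ, by rw [h', ← h]⟩)

/-! ## The Dębski function -/

/-- The right-continuous version of the Dębski function. -/
noncomputable def debskiUpper (d : ℕ → ℝ) (c : ℝ) : ℝ :=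
  ∑' n : ℕ, if d n ≤ c then (1 / 2 : ℝ) ^ (n + 1) else 0

lemma hasSum_half_pow : HasSum (fun n : ℕ => (1 / 2 : ℝ) ^ (n + 1)) 1 := by
  have := hasSum_geometric_two.mul_left (1 / 2 : ℝ)
  simpa [pow_succ, mul_comm] using this

lemma summable_ite_half_pow (p : ℕ → Prop) [DecidablePred p] :
    Summable fun n : ℕ => if p n then (1 / 2 : ℝ) ^ (n + 1) else 0 := by
  refine Summable.of_nonneg_of_le (fun n => ?_) (fun n => ?_) hasSum_half_pow.summable
  · split_ifs <;> positivity
  · split_ifs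
    · exact le_rfl
    · positivity

/-- Some finite partial sum already exceeds `y`. Its finitely many satisfied conditions persist near
`x` because they are open, and all other terms are nonnegative. -/
lemma lowerSemicontinuous_tsum_ite {P : ℕ → ℝ → Prop} [∀ n x, Decidable (P n x)]
    (hP : ∀ n, IsOpen {x | P n x}) :
    LowerSemicontinuous fun x => ∑' n : ℕ, if P n x then (1 / 2 : ℝ) ^ (n + 1) else 0 := by
  intro x y hy
  have h1 := (summable_ite_half_pow fun n => P n x).hasSum
  obtain ⟨s, hs⟩ := (h1.eventually (lt_mem_nhds hy)).exists
  have h2 : ∀ᶠ x' in 𝓝 x, ∀ n ∈ s, P n x → P n x' := by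
    rw [eventually_all_finset]
    intro n _
    by_cases h : P n x
    · filter_upwards [(hP n).mem_nhds h] with x' hx' _ using hx'
    · exact Eventually.of_forall fun _ h' => absurd h' h
  filter_upwards [h2] with x' hx'
  refine hs.trans_le (le_trans (Finset.sum_le_sum fun n hn => ?_)
    ((summable_ite_half_pow fun n => P n x').sum_le_tsum s fun n _ => ?_))
  · by_cases h : P n x
    · simp [h, hx' n hn h]
    · simp only [h, if_false]
      split_ifs <;> positivity
  · split_ifs <;> positivity

lemma lowerSemicontinuous_debskiFun (d : ℕ → ℝ) : LowerSemicontinuous (debskiFun d) :=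
  lowerSemicontinuous_tsum_ite fun _ => isOpen_lt continuous_const continuous_id

/-- All weights add up to `1`. Passing to the complementary sum replaces the closed conditions `d n
≤ c` by open ones, so upper semicontinuity follows from the lower semicontinuity of such sums. -/
lemma debskiUpper_eq (d : ℕ → ℝ) (c : ℝ) :
    debskiUpper d c = 1 - ∑' n : ℕ, if c < d n then (1 / 2 : ℝ) ^ (n + 1) else 0 := by
  have h1 := (summable_ite_half_pow fun n => d n ≤ c).hasSum.add
    (summable_ite_half_pow fun n => c < d n).hasSum
  rw [eq_sub_iff_add_eq]
  refine h1.unique ?_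
  convert hasSum_half_pow using 2 with n
  by_cases h : d n ≤ c
  · simp [h, h.not_gt]
  · simp [h, not_le.1 h]

lemma upperSemicontinuous_debskiUpper (d : ℕ → ℝ) : UpperSemicontinuous (debskiUpper d) := by
  intro x y hy
  have h := lowerSemicontinuous_tsum_ite (P := fun n x => x < d n)
    fun _ => isOpen_lt continuous_id continuous_const
  rw [debskiUpper_eq] at hy
  filter_upwards [h x (1 - y) (by linarith)] with x' hx'
  rw [debskiUpper_eq]
  linarith

lemma debskiFun_nonneg (d : ℕ → ℝ) (c : ℝ) : 0 ≤ debskiFun d c :=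
  tsum_nonneg fun n => by split_ifs <;> positivity

lemma debskiFun_le_debskiUpper (d : ℕ → ℝ) (c : ℝ) : debskiFun d c ≤ debskiUpper d c := by
  refine (summable_ite_half_pow _).tsum_le_tsum (fun n => ?_) (summable_ite_half_pow _)
  by_cases h : d n < c
  · simp [h, h.le]
  · simp only [h, if_false]
    split_ifs <;> positivity

lemma debskiUpper_le_one (d : ℕ → ℝ) (c : ℝ) : debskiUpper d c ≤ 1 := by
  rw [debskiUpper_eq]
  have : 0 ≤ ∑' n : ℕ, if c < d n then (1 / 2 : ℝ) ^ (n + 1) else 0 :=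
    tsum_nonneg fun n => by split_ifs <;> positivity
  linarith

lemma debskiUpper_le_debskiFun (d : ℕ → ℝ) {c c' : ℝ} (h : c < c') :
    debskiUpper d c ≤ debskiFun d c' := by
  refine (summable_ite_half_pow _).tsum_le_tsum (fun n => ?_) (summable_ite_half_pow _)
  by_cases h' : d n ≤ c
  · simp [h', h'.trans_lt h]
  · simp only [h', if_false]
    split_ifs <;> positivity

lemma debskiUpper_lt_debskiFun {d : ℕ → ℝ} {c c' : ℝ} {k : ℕ} (h : c < d k) (h' : d k < c') :
    debskiUpper d c < debskiFun d c' := by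
  refine (summable_ite_half_pow _).tsum_lt_tsum (i := k) (fun n => ?_) ?_ (summable_ite_half_pow _)
  · by_cases h1 : d n ≤ c
    · simp [h1, h1.trans_lt (h.trans h')]
    · simp only [h1, if_false]
      split_ifs <;> positivity
  · simp [h.not_ge, h']

lemma debskiUpper_eq_debskiFun {d : ℕ → ℝ} {c : ℝ} (h : ∀ n, d n ≠ c) :
    debskiUpper d c = debskiFun d c := by
  unfold debskiUpper debskiFun
  congr 1
  ext n
  simp [le_iff_lt_or_eq, h n]

lemma debskiUpper_apply {d : ℕ → ℝ} (hd : Function.Injective d) (k : ℕ) :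
    debskiUpper d (d k) = debskiFun d (d k) + (1 / 2) ^ (k + 1) := by
  have h : ∑' n : ℕ, (if n = k then (1 / 2 : ℝ) ^ (n + 1) else 0) = (1 / 2) ^ (k + 1) :=
    tsum_ite_eq k _
  rw [← h, debskiUpper, debskiFun, ← (summable_ite_half_pow _).tsum_add (summable_ite_half_pow _)]
  congr 1
  ext n
  rcases lt_trichotomy (d n) (d k) with h | h | h
  · have : n ≠ k := fun e => by simp [e] at h
    simp [h, h.le, this]
  · simp [hd h]
  · have : n ≠ k := fun e => by simp [e] at h
    simp [h.not_gt, h.not_ge, this]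

lemma debskiFun_lt_debskiUpper_iff {d : ℕ → ℝ} (hd : Function.Injective d) {c : ℝ} :
    debskiFun d c < debskiUpper d c ↔ ∃ k, d k = c := by
  constructor
  · intro h
    by_contra! h'
    exact h.ne' (debskiUpper_eq_debskiFun h')
  · rintro ⟨k, rfl⟩
    rw [debskiUpper_apply hd]
    have : (0 : ℝ) < (1 / 2) ^ (k + 1) := by positivity
    linarith

lemma isClosed_setOf_debskiFun_le (d : ℕ → ℝ) : IsClosed {p : ℝ × ℝ | debskiFun d p.1 ≤ p.2} :=
  (lowerSemicontinuous_debskiFun d).isClosed_epigraph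

lemma isClosed_setOf_le_debskiUpper (d : ℕ → ℝ) : IsClosed {p : ℝ × ℝ | p.2 ≤ debskiUpper d p.1} :=
  (upperSemicontinuous_debskiUpper d).IsClosed_hypograph


/-- The bounds are semicontinuous, so `D` is closed. Since they agree off the jumps, this form
treats graph points and arcs uniformly, and later arguments use it in place of the definition. -/
lemma mem_setD {d : ℕ → ℝ} (hd : IsDenseNonEndpoints d) {p : ℝ × ℝ} :
    p ∈ setD d ↔ p.1 ∈ cantorSet ∧ debskiFun d p.1 ≤ p.2 ∧ p.2 ≤ debskiUpper d p.1 := by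
  obtain ⟨c, t⟩ := p
  simp only [setD, graphSet, mem_union, mem_ofPred_eq, mem_iUnion, mem_prod, mem_singleton_iff,
    mem_Icc]
  constructor
  · rintro (⟨h1, h2⟩ | ⟨n, rfl, h1⟩)
    · exact ⟨h1, h2.ge, h2.trans_le (debskiFun_le_debskiUpper d c)⟩
    · exact ⟨hd.mem n, h1.1, by rw [debskiUpper_apply hd.injective]; exact h1.2⟩
  · rintro ⟨h1, h2, h3⟩
    by_cases h : ∃ k, d k = c
    · obtain ⟨k, rfl⟩ := h
      rw [debskiUpper_apply hd.injective] at h3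
      exact Or.inr ⟨k, rfl, h2, h3⟩
    · rw [debskiUpper_eq_debskiFun (by simpa using h)] at h3
      exact Or.inl ⟨h1, le_antisymm h3 h2⟩

lemma mem_setE {d : ℕ → ℝ} (hd : IsDenseNonEndpoints d) {p : ℝ × ℝ} :
    p ∈ setE d ↔ p.1 ∈ cantorSet ∧ (p.2 = debskiFun d p.1 ∨ p.2 = debskiUpper d p.1) := by
  obtain ⟨c, t⟩ := p
  simp only [setE, graphSet, mem_union, mem_ofPred_eq, mem_range, Prod.mk.injEq]
  constructor
  · rintro (⟨h1, h2⟩ | ⟨n, rfl, h1⟩)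
    · exact ⟨h1, Or.inl h2⟩
    · exact ⟨hd.mem n, Or.inr (by rw [debskiUpper_apply hd.injective]; exact h1.symm)⟩
  · rintro ⟨h1, h2 | h2⟩
    · exact Or.inl ⟨h1, h2⟩
    · by_cases h : ∃ k, d k = c
      · obtain ⟨k, rfl⟩ := h
        rw [debskiUpper_apply hd.injective] at h2
        exact Or.inr ⟨k, rfl, h2.symm⟩
      · rw [debskiUpper_eq_debskiFun (by simpa using h)] at h2
        exact Or.inl ⟨h1, h2⟩

lemma mem_setM {d : ℕ → ℝ} {p : ℝ × ℝ} :
    p ∈ setM d ↔ ∃ n, p = (d n, debskiFun d (d n) + (1 / 2 : ℝ) ^ (n + 2)) := by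
  simp [setM, eq_comm]

lemma setE_subset_setD {d : ℕ → ℝ} (hd : IsDenseNonEndpoints d) : setE d ⊆ setD d := by
  intro p hp
  rw [mem_setE hd] at hp
  rw [mem_setD hd]
  have := debskiFun_le_debskiUpper d p.1
  rcases hp with ⟨h, h' | h'⟩ <;> exact ⟨h, by linarith, by linarith⟩

lemma setM_subset_setD {d : ℕ → ℝ} (hd : IsDenseNonEndpoints d) : setM d ⊆ setD d := by
  intro p hp
  obtain ⟨n, rfl⟩ := mem_setM.1 hp
  rw [mem_setD hd, debskiUpper_apply hd.injective]
  have h1 : (0 : ℝ) < (1 / 2) ^ (n + 1) := by positivity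
  have h2 : (1 / 2 : ℝ) ^ (n + 2) = (1 / 2) ^ (n + 1) / 2 := by rw [pow_succ]; ring
  exact ⟨hd.mem n, by simp only; linarith, by simp only; linarith⟩

lemma disjoint_setE_setM {d : ℕ → ℝ} (hd : IsDenseNonEndpoints d) : Disjoint (setE d) (setM d) := by
  rw [Set.disjoint_left]
  intro p hp hM
  obtain ⟨n, rfl⟩ := mem_setM.1 hM
  rw [mem_setE hd, debskiUpper_apply hd.injective] at hp
  have h1 : (0 : ℝ) < (1 / 2) ^ (n + 1) := by positivity
  have h2 : (1 / 2 : ℝ) ^ (n + 2) = (1 / 2) ^ (n + 1) / 2 := by rw [pow_succ]; ring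
  simp only at hp
  rcases hp with ⟨-, h | h⟩ <;> linarith

lemma setD_subset {d : ℕ → ℝ} (hd : IsDenseNonEndpoints d) : setD d ⊆ cantorSet ×ˢ Icc 0 1 := by
  intro p hp
  rw [mem_setD hd] at hp
  exact ⟨hp.1, (debskiFun_nonneg _ _).trans hp.2.1, hp.2.2.trans (debskiUpper_le_one _ _)⟩

lemma isCompact_setD {d : ℕ → ℝ} (hd : IsDenseNonEndpoints d) : IsCompact (setD d) := by
  refine (isCompact_cantorSet.prod isCompact_Icc).of_isClosed_subset ?_ (setD_subset hd)
  have : setD d = (Prod.fst ⁻¹' cantorSet) ∩ ({p : ℝ × ℝ | debskiFun d p.1 ≤ p.2} ∩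
      {p : ℝ × ℝ | p.2 ≤ debskiUpper d p.1}) := by
    ext p
    exact mem_setD hd
  rw [this]
  exact (isClosed_cantorSet.preimage continuous_fst).inter
    ((isClosed_setOf_debskiFun_le d).inter (isClosed_setOf_le_debskiUpper d))

/-- The height of a point of `D` lies strictly inside a jump only if the point lies on the
vertical arc over that jump. -/
lemma eq_of_height_mem_Ioo {d : ℕ → ℝ} {c t : ℝ} {c' : ℝ}
    (h1 : debskiFun d c ≤ t) (h2 : t ≤ debskiUpper d c)
    (h : t ∈ Ioo (debskiFun d c') (debskiUpper d c')) : c = c' := by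
  rcases lt_trichotomy c c' with h' | h' | h'
  · linarith [debskiUpper_le_debskiFun d h', h.1]
  · exact h'
  · linarith [debskiUpper_le_debskiFun d h', h.2]

/-- Only interior points of the vertical arcs have a height inside an open jump interval. Deleting
from `D` the open set of all such heights therefore leaves exactly `E`. -/
lemma isCompact_setE {d : ℕ → ℝ} (hd : IsDenseNonEndpoints d) : IsCompact (setE d) := by
  have : setE d = setD d \ Prod.snd ⁻¹' ⋃ c, Ioo (debskiFun d c) (debskiUpper d c) := by
    ext ⟨c, t⟩
    simp only [Set.mem_sdiff, mem_preimage, mem_iUnion, not_exists]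
    constructor
    · refine fun hp => ⟨setE_subset_setD hd hp, fun c' h => ?_⟩
      have hD := (mem_setD hd).1 (setE_subset_setD hd hp)
      obtain rfl := eq_of_height_mem_Ioo hD.2.1 hD.2.2 h
      rw [mem_setE hd] at hp
      rcases hp with ⟨-, e | e⟩ <;> simp only at e
      · exact h.1.ne' e
      · exact h.2.ne e
    · rintro ⟨hD, h⟩
      have hD := (mem_setD hd).1 hD
      rw [mem_setE hd]
      refine ⟨hD.1, ?_⟩
      by_contra! h'
      exact h c ⟨lt_of_le_of_ne hD.2.1 h'.1.symm, lt_of_le_of_ne hD.2.2 h'.2⟩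
  rw [this]
  exact (isCompact_setD hd).diff ((isOpen_iUnion fun _ => isOpen_Ioo).preimage continuous_snd)

lemma exists_mem_Ioo_of_cantorSet {d : ℕ → ℝ} (hd : IsDenseNonEndpoints d) {a b c : ℝ}
    (hc : c ∈ cantorSet) (h : c ∈ Ioo a b) : ∃ k, d k ∈ Ioo a b := by
  obtain ⟨_, h1, k, rfl⟩ := mem_closure_iff.1 (hd.dense hc) _ isOpen_Ioo h
  exact ⟨k, h1⟩

/-- Density gives some `d k` between the widened left bound of the piece and `c`. It must belong to
the piece, and being no endpoint it lies strictly to the right of `leftEnd σ`. This is the source of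
strict growth of `f` at the ends of pieces. -/
lemma exists_mem_Ioo_leftEnd {d : ℕ → ℝ} (hd : IsDenseNonEndpoints d) {σ : List Bool} {c : ℝ}
    (hc : c ∈ piece σ) (hne : c ≠ leftEnd σ) : ∃ k, d k ∈ Ioo (leftEnd σ) c := by
  have h1 := mem_Ioo_of_mem_piece (leftEnd_mem_piece σ)
  have h2 := mem_Ioo_of_mem_piece hc
  obtain ⟨k, hk⟩ := exists_mem_Ioo_of_cantorSet hd
    (piece_subset_cantorSet σ (leftEnd_mem_piece σ))
    ⟨h1.1, lt_of_le_of_ne (leftEnd_le_of_mem_piece hc) hne.symm⟩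
  have h3 := leftEnd_le_of_mem_piece
    (mem_piece_of_mem_Ioo (σ := σ) (hd.mem k) ⟨hk.1, hk.2.trans h2.2⟩)
  exact ⟨k, lt_of_le_of_ne h3 (hd.ne_leftEnd k σ).symm, hk.2⟩

lemma exists_mem_Ioo_rightEnd {d : ℕ → ℝ} (hd : IsDenseNonEndpoints d) {σ : List Bool} {c : ℝ}
    (hc : c ∈ piece σ) (hne : c ≠ rightEnd σ) : ∃ k, d k ∈ Ioo c (rightEnd σ) := by
  have h1 := mem_Ioo_of_mem_piece (rightEnd_mem_piece σ)
  have h2 := mem_Ioo_of_mem_piece hc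
  obtain ⟨k, hk⟩ := exists_mem_Ioo_of_cantorSet hd
    (piece_subset_cantorSet σ (rightEnd_mem_piece σ))
    ⟨lt_of_le_of_ne (le_rightEnd_of_mem_piece hc) hne, h1.2⟩
  have h3 := le_rightEnd_of_mem_piece
    (mem_piece_of_mem_Ioo (σ := σ) (hd.mem k) ⟨h2.1.trans hk.1, hk.2⟩)
  exact ⟨k, hk.1, lt_of_le_of_ne h3 (hd.ne_rightEnd k σ)⟩

lemma debskiUpper_leftEnd {d : ℕ → ℝ} (hd : IsDenseNonEndpoints d) (σ : List Bool) :
    debskiUpper d (leftEnd σ) = debskiFun d (leftEnd σ) :=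
  debskiUpper_eq_debskiFun fun n => hd.ne_leftEnd n σ

lemma debskiUpper_rightEnd {d : ℕ → ℝ} (hd : IsDenseNonEndpoints d) (σ : List Bool) :
    debskiUpper d (rightEnd σ) = debskiFun d (rightEnd σ) :=
  debskiUpper_eq_debskiFun fun n => hd.ne_rightEnd n σ

lemma debskiFun_zero {d : ℕ → ℝ} (hd : IsDenseNonEndpoints d) : debskiFun d 0 = 0 := by
  have : ∀ n, ¬ d n < 0 := fun n => (cantorSet_subset_unitInterval (hd.mem n)).1.not_gt
  simp [debskiFun, this]

lemma debskiUpper_one {d : ℕ → ℝ} (hd : IsDenseNonEndpoints d) : debskiUpper d 1 = 1 := by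
  have : ∀ n, d n ≤ 1 := fun n => (cantorSet_subset_unitInterval (hd.mem n)).2
  simp only [debskiUpper, this, if_true]
  exact hasSum_half_pow.tsum_eq

lemma debskiUpper_zero {d : ℕ → ℝ} (hd : IsDenseNonEndpoints d) : debskiUpper d 0 = 0 := by
  have := debskiUpper_leftEnd hd []
  rwa [leftEnd_nil, debskiFun_zero hd] at this

lemma debskiFun_one {d : ℕ → ℝ} (hd : IsDenseNonEndpoints d) : debskiFun d 1 = 1 := by
  have := debskiUpper_rightEnd hd []
  rw [← similarity_one, similarity_nil, debskiUpper_one hd] at this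
  exact this.symm

lemma debskiFun_pos {d : ℕ → ℝ} (hd : IsDenseNonEndpoints d) {c : ℝ} (hc : c ∈ cantorSet)
    (h : c ≠ 0) : 0 < debskiFun d c := by
  obtain ⟨k, hk⟩ := exists_mem_Ioo_leftEnd (σ := []) hd (by rwa [piece_nil]) (by rwa [leftEnd_nil])
  rw [leftEnd_nil] at hk
  have := debskiUpper_lt_debskiFun hk.1 hk.2
  rwa [debskiUpper_zero hd] at this

lemma debskiUpper_lt_one {d : ℕ → ℝ} (hd : IsDenseNonEndpoints d) {c : ℝ} (hc : c ∈ cantorSet)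
    (h : c ≠ 1) : debskiUpper d c < 1 := by
  have h1 : rightEnd [] = 1 := by rw [← similarity_one, similarity_nil]
  obtain ⟨k, hk⟩ := exists_mem_Ioo_rightEnd (σ := []) hd (by rwa [piece_nil]) (by rwa [h1])
  rw [h1] at hk
  have := debskiUpper_lt_debskiFun hk.1 hk.2
  rwa [debskiFun_one hd] at this

/-- The upper end of the jump at `d n` is approached along right ends of small pieces around `d n`.
These lie strictly to the right of `d n`, where `f` is at least `F (d n)`, and upper semicontinuity
of `F` bounds it from above. -/
lemma setE_subset_closure_graphSet {d : ℕ → ℝ} (hd : IsDenseNonEndpoints d) :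
    setE d ⊆ closure (graphSet d) := by
  rintro p (hp | ⟨n, rfl⟩)
  · exact subset_closure hp
  simp only [← debskiUpper_apply hd.injective]
  rw [Metric.mem_closure_iff]
  intro ε hε
  have h1 := upperSemicontinuous_debskiUpper d (d n) (debskiUpper d (d n) + ε) (by linarith)
  obtain ⟨δ, hδ, hδ'⟩ := Metric.eventually_nhds_iff.1 h1
  obtain ⟨N, hN⟩ := exists_piece_subset_Ioo (c := d n) (lt_min hδ hε)
  obtain ⟨σ, hσ, hcσ⟩ := exists_mem_piece N (hd.mem n)
  have h2 := hN σ hσ.ge hcσ (rightEnd_mem_piece σ)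
  have h3 : d n < rightEnd σ := lt_of_le_of_ne (le_rightEnd_of_mem_piece hcσ) (hd.ne_rightEnd n σ)
  have h4 : dist (d n) (rightEnd σ) < min δ ε := by
    rw [dist_comm, Real.dist_eq, abs_lt]
    constructor <;> linarith [h2.1, h2.2]
  refine ⟨(rightEnd σ, debskiFun d (rightEnd σ)),
    ⟨piece_subset_cantorSet σ (rightEnd_mem_piece σ), rfl⟩, ?_⟩
  rw [Prod.dist_eq]
  refine max_lt (h4.trans_le (min_le_right _ _)) ?_
  have h5 := hδ' (show dist (rightEnd σ) (d n) < δ by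
    rw [dist_comm]; exact h4.trans_le (min_le_left _ _))
  have h6 := debskiUpper_le_debskiFun d h3
  have h7 := debskiFun_le_debskiUpper d (rightEnd σ)
  rw [dist_comm, Real.dist_eq, abs_lt]
  constructor <;> simp only <;> linarith

lemma closure_graphSet {d : ℕ → ℝ} (hd : IsDenseNonEndpoints d) :
    closure (graphSet d) = setE d :=
  Subset.antisymm (closure_minimal subset_union_left (isCompact_setE hd).isClosed)
    (setE_subset_closure_graphSet hd)

/-! ## Copies of `D` in rectangles -/

namespace Rect

/-- The inverse of the horizontal part of `R.map`. -/
noncomputable def pull (R : Rect) (c : ℝ) : ℝ := (c - leftEnd R.word) * 3 ^ R.word.length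

/-- The lower height of the copy of `D` in `R` over `c`. -/
noncomputable def low (d : ℕ → ℝ) (R : Rect) (c : ℝ) : ℝ :=
  R.lo + debskiFun d (R.pull c) * (R.hi - R.lo)

/-- The upper height of the copy of `D` in `R` over `c`. -/
noncomputable def upp (d : ℕ → ℝ) (R : Rect) (c : ℝ) : ℝ :=
  R.lo + debskiUpper d (R.pull c) * (R.hi - R.lo)

variable {d : ℕ → ℝ} {R : Rect}

lemma pull_similarity (R : Rect) (x : ℝ) : R.pull (similarity R.word x) = x := by
  simp [pull, similarity]

lemma similarity_pull (R : Rect) (c : ℝ) : similarity R.word (R.pull c) = c := by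
  simp [pull, similarity]

lemma pull_strictMono (R : Rect) : StrictMono R.pull := by
  intro x y h
  unfold pull
  gcongr

lemma continuous_pull (R : Rect) : Continuous R.pull := by
  unfold pull
  fun_prop

lemma pull_mem_cantorSet_iff {c : ℝ} : R.pull c ∈ cantorSet ↔ c ∈ piece R.word := by
  constructor
  · exact fun h => ⟨_, h, similarity_pull R c⟩
  · rintro ⟨x, hx, rfl⟩
    rwa [pull_similarity]

lemma pull_leftEnd_append (R : Rect) (τ : List Bool) :
    R.pull (leftEnd (R.word ++ τ)) = leftEnd τ := by
  rw [← similarity_zero, similarity_append, pull_similarity, similarity_zero]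

lemma pull_rightEnd_append (R : Rect) (τ : List Bool) :
    R.pull (rightEnd (R.word ++ τ)) = rightEnd τ := by
  rw [← similarity_one, similarity_append, pull_similarity, similarity_one]

lemma pull_leftEnd (R : Rect) : R.pull (leftEnd R.word) = 0 := by
  rw [← similarity_zero, pull_similarity]

lemma pull_rightEnd (R : Rect) : R.pull (rightEnd R.word) = 1 := by
  rw [← similarity_one, pull_similarity]

lemma low_le_upp (hR : R.lo < R.hi) (c : ℝ) : R.low d c ≤ R.upp d c := by
  unfold low upp
  have := debskiFun_le_debskiUpper d (R.pull c)
  gcongr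

lemma lo_le_low (hR : R.lo < R.hi) (c : ℝ) : R.lo ≤ R.low d c := by
  unfold low
  have := mul_nonneg (debskiFun_nonneg d (R.pull c)) (sub_nonneg.2 hR.le)
  linarith

lemma upp_le_hi (hR : R.lo < R.hi) (c : ℝ) : R.upp d c ≤ R.hi := by
  unfold upp
  have := mul_le_mul_of_nonneg_right (debskiUpper_le_one d (R.pull c)) (sub_nonneg.2 hR.le)
  linarith

lemma upp_leftEnd (hd : IsDenseNonEndpoints d) : R.upp d (leftEnd R.word) = R.lo := by
  simp [upp, pull_leftEnd, debskiUpper_zero hd]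

lemma low_rightEnd (hd : IsDenseNonEndpoints d) : R.low d (rightEnd R.word) = R.hi := by
  simp [low, pull_rightEnd, debskiFun_one hd]

lemma upp_leftEnd_append (hd : IsDenseNonEndpoints d) (τ : List Bool) :
    R.upp d (leftEnd (R.word ++ τ)) = R.low d (leftEnd (R.word ++ τ)) := by
  simp [low, upp, pull_leftEnd_append, debskiUpper_leftEnd hd]

lemma upp_rightEnd_append (hd : IsDenseNonEndpoints d) (τ : List Bool) :
    R.upp d (rightEnd (R.word ++ τ)) = R.low d (rightEnd (R.word ++ τ)) := by
  simp [low, upp, pull_rightEnd_append, debskiUpper_rightEnd hd]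

/-- Some jump of the copy lies strictly between the left end and `c`. The strictness keeps a later
rectangle that merely abuts a gap from touching the earlier copy. -/
lemma upp_leftEnd_lt_low (hd : IsDenseNonEndpoints d) (hR : R.lo < R.hi) {τ : List Bool} {c : ℝ}
    (hc : c ∈ piece (R.word ++ τ)) (hne : c ≠ leftEnd (R.word ++ τ)) :
    R.upp d (leftEnd (R.word ++ τ)) < R.low d c := by
  obtain ⟨x, hx, rfl⟩ := hc
  rw [similarity_append] at hne ⊢
  have hne' : similarity τ x ≠ leftEnd τ := by
    rintro e
    rw [e, ← similarity_zero τ, ← similarity_append, similarity_zero] at hne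
    exact hne rfl
  obtain ⟨k, hk⟩ := exists_mem_Ioo_leftEnd hd ⟨x, hx, rfl⟩ hne'
  simp only [low, upp, pull_leftEnd_append, pull_similarity]
  have := debskiUpper_lt_debskiFun hk.1 hk.2
  have h := sub_pos.2 hR
  gcongr

lemma upp_lt_low_rightEnd (hd : IsDenseNonEndpoints d) (hR : R.lo < R.hi) {τ : List Bool} {c : ℝ}
    (hc : c ∈ piece (R.word ++ τ)) (hne : c ≠ rightEnd (R.word ++ τ)) :
    R.upp d c < R.low d (rightEnd (R.word ++ τ)) := by
  obtain ⟨x, hx, rfl⟩ := hc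
  rw [similarity_append] at hne ⊢
  have hne' : similarity τ x ≠ rightEnd τ := by
    rintro e
    rw [e, ← similarity_one τ, ← similarity_append, similarity_one] at hne
    exact hne rfl
  obtain ⟨k, hk⟩ := exists_mem_Ioo_rightEnd hd ⟨x, hx, rfl⟩ hne'
  simp only [low, upp, pull_rightEnd_append, pull_similarity]
  have := debskiUpper_lt_debskiFun hk.1 hk.2
  have h := sub_pos.2 hR
  gcongr

lemma upp_leftEnd_append_lt (hd : IsDenseNonEndpoints d) (hR : R.lo < R.hi) (τ : List Bool) :
    R.upp d (leftEnd (R.word ++ τ)) < R.low d (rightEnd (R.word ++ τ)) :=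
  upp_leftEnd_lt_low hd hR (rightEnd_mem_piece _) (leftEnd_lt_rightEnd _).ne'

lemma lo_lt_low (hd : IsDenseNonEndpoints d) (hR : R.lo < R.hi) {c : ℝ} (hc : c ∈ piece R.word)
    (h : c ≠ leftEnd R.word) : R.lo < R.low d c := by
  have h1 : R.pull c ≠ 0 := by
    rw [← pull_leftEnd]
    exact R.pull_strictMono.injective.ne h
  have := mul_pos (debskiFun_pos hd (pull_mem_cantorSet_iff.2 hc) h1) (sub_pos.2 hR)
  unfold low
  linarith

lemma upp_lt_hi (hd : IsDenseNonEndpoints d) (hR : R.lo < R.hi) {c : ℝ} (hc : c ∈ piece R.word)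
    (h : c ≠ rightEnd R.word) : R.upp d c < R.hi := by
  have h1 : R.pull c ≠ 1 := by
    rw [← pull_rightEnd]
    exact R.pull_strictMono.injective.ne h
  have := mul_lt_mul_of_pos_right
    (debskiUpper_lt_one hd (pull_mem_cantorSet_iff.2 hc) h1) (sub_pos.2 hR)
  unfold upp
  linarith

lemma isOpen_setOf_lt_low (hR : R.lo < R.hi) : IsOpen {p : ℝ × ℝ | p.2 < R.low d p.1} := by
  have : {p : ℝ × ℝ | p.2 < R.low d p.1} =
      (fun p : ℝ × ℝ => (R.pull p.1, (p.2 - R.lo) / (R.hi - R.lo))) ⁻¹'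
        {p : ℝ × ℝ | debskiFun d p.1 ≤ p.2}ᶜ := by
    ext p
    simp only [mem_ofPred_eq, preimage_compl, mem_compl_iff, mem_preimage, not_le, low]
    rw [div_lt_iff₀ (sub_pos.2 hR)]
    constructor <;> intro h <;> linarith
  rw [this]
  refine (isClosed_setOf_debskiFun_le d).isOpen_compl.preimage ?_
  have := R.continuous_pull
  fun_prop

lemma isOpen_setOf_upp_lt (hR : R.lo < R.hi) : IsOpen {p : ℝ × ℝ | R.upp d p.1 < p.2} := by
  have : {p : ℝ × ℝ | R.upp d p.1 < p.2} =
      (fun p : ℝ × ℝ => (R.pull p.1, (p.2 - R.lo) / (R.hi - R.lo))) ⁻¹'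
        {p : ℝ × ℝ | p.2 ≤ debskiUpper d p.1}ᶜ := by
    ext p
    simp only [mem_ofPred_eq, preimage_compl, mem_compl_iff, mem_preimage, not_le, upp]
    rw [lt_div_iff₀ (sub_pos.2 hR)]
    constructor <;> intro h <;> linarith
  rw [this]
  refine (isClosed_setOf_le_debskiUpper d).isOpen_compl.preimage ?_
  have := R.continuous_pull
  fun_prop

lemma map_eq_iff (hR : R.lo < R.hi) {p q : ℝ × ℝ} :
    R.map p = q ↔ p = (R.pull q.1, (q.2 - R.lo) / (R.hi - R.lo)) := by
  have h := (sub_pos.2 hR).ne'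
  constructor
  · rintro rfl
    ext
    · exact (pull_similarity R p.1).symm
    · simp [map, h]
  · rintro rfl
    ext
    · exact similarity_pull R q.1
    · simp [map, h]

lemma mem_map_image (hR : R.lo < R.hi) {A : Set (ℝ × ℝ)} {q : ℝ × ℝ} :
    q ∈ R.map '' A ↔ (R.pull q.1, (q.2 - R.lo) / (R.hi - R.lo)) ∈ A := by
  simp only [mem_image, map_eq_iff hR]
  exact ⟨fun ⟨_, h, e⟩ => e ▸ h, fun h => ⟨_, h, rfl⟩⟩

lemma map_injective (hR : R.lo < R.hi) : Function.Injective R.map := by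
  intro p q h
  rw [map_eq_iff hR] at h
  rw [h, eq_comm, ← map_eq_iff hR]

lemma mem_map_setD (hd : IsDenseNonEndpoints d) (hR : R.lo < R.hi) {p : ℝ × ℝ} :
    p ∈ R.map '' setD d ↔ p.1 ∈ piece R.word ∧ R.low d p.1 ≤ p.2 ∧ p.2 ≤ R.upp d p.1 := by
  rw [mem_map_image hR, mem_setD hd, pull_mem_cantorSet_iff]
  simp only [low, upp]
  rw [le_div_iff₀ (sub_pos.2 hR), div_le_iff₀ (sub_pos.2 hR), le_sub_iff_add_le',
    sub_le_iff_le_add']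

lemma mem_map_setE (hd : IsDenseNonEndpoints d) (hR : R.lo < R.hi) {p : ℝ × ℝ} :
    p ∈ R.map '' setE d ↔ p.1 ∈ piece R.word ∧ (p.2 = R.low d p.1 ∨ p.2 = R.upp d p.1) := by
  rw [mem_map_image hR, mem_setE hd, pull_mem_cantorSet_iff]
  simp only [low, upp]
  rw [div_eq_iff (sub_pos.2 hR).ne', div_eq_iff (sub_pos.2 hR).ne', sub_eq_iff_eq_add',
    sub_eq_iff_eq_add']

lemma continuous_map (R : Rect) : Continuous R.map := by
  unfold map
  fun_prop

lemma map_mem (R : Rect) {p : ℝ × ℝ} (hp : p.1 ∈ cantorSet) : (R.map p).1 ∈ piece R.word :=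
  ⟨p.1, hp, rfl⟩

end Rect

/-! ## Tilings -/

/-- An earlier rectangle contributes only if its word is a proper prefix of `σ`. Ends of pieces are
not jumps, so the copy has a single height over each of them. Naming it `upp` on the left and `low`
on the right is a choice that fits the later estimates. -/
lemma mem_gaps {d : ℕ → ℝ} (hd : IsDenseNonEndpoints d) {𝓡 : Set Rect}
    (h𝓡 : ∀ R ∈ 𝓡, R.lo < R.hi) {σ : List Bool} {t : ℝ} :
    t ∈ gaps d 𝓡 σ ↔ ∃ R ∈ 𝓡, ∃ ρ, ρ ≠ [] ∧ σ = R.word ++ ρ ∧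
      t ∈ Ioo (R.upp d (leftEnd σ)) (R.low d (rightEnd σ)) := by
  constructor
  · rintro ⟨R, hR, hl, x, y, hx, hy, ht⟩
    rw [Rect.mem_map_setD hd (h𝓡 R hR)] at hx hy
    obtain ⟨ρ, hρ⟩ := exists_eq_append_of_mem_piece hx.1 (leftEnd_mem_piece σ) hl.le
    refine ⟨R, hR, ρ, ?_, hρ, ?_⟩
    · rintro rfl
      simp [hρ] at hl
    · rw [hρ, Rect.upp_leftEnd_append hd, ← Rect.upp_rightEnd_append hd, ← hρ]
      exact ⟨hx.2.1.trans_lt ht.1, ht.2.trans_le hy.2.2⟩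
  · rintro ⟨R, hR, ρ, hρ, rfl, ht⟩
    refine ⟨R, hR, ?_, _, _, ?_, ?_, ht⟩
    · simpa using List.length_pos_iff.2 hρ
    · rw [Rect.mem_map_setD hd (h𝓡 R hR)]
      exact ⟨piece_append_subset _ _ (leftEnd_mem_piece _), Rect.low_le_upp (h𝓡 R hR) _, le_rfl⟩
    · rw [Rect.mem_map_setD hd (h𝓡 R hR)]
      exact ⟨piece_append_subset _ _ (rightEnd_mem_piece _), le_rfl, Rect.low_le_upp (h𝓡 R hR) _⟩

/-- The part of the definition of a tiling that forces the copies of `D` to be disjoint. -/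
structure IsPacking (d : ℕ → ℝ) (𝓡 : Set Rect) : Prop where
  lo_lt_hi : ∀ R ∈ 𝓡, R.lo < R.hi
  nonoverlapping : ∀ R ∈ 𝓡, ∀ S ∈ 𝓡, R.word = S.word → R ≠ S →
    Disjoint (Ioo R.lo R.hi) (Ioo S.lo S.hi)
  disjoint_gaps : ∀ S ∈ 𝓡, Disjoint (Icc S.lo S.hi) (gaps d 𝓡 S.word)

namespace IsPacking

variable {d : ℕ → ℝ} {𝓡 : Set Rect}

/-- The gap of `R` over the base of `S` is a nonempty open interval that misses the heights of `S`,
so `S` lies on one side of it. For equal bases the same formula gives the full interval `(R.lo,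
R.hi)`, and nonoverlapping takes the place of the gap condition. -/
lemma hi_le_upp_or (P : IsPacking d 𝓡) (hd : IsDenseNonEndpoints d) {R S : Rect} (hR : R ∈ 𝓡)
    (hS : S ∈ 𝓡) (hne : R ≠ S) {ρ : List Bool} (hρ : S.word = R.word ++ ρ) :
    S.hi ≤ R.upp d (leftEnd S.word) ∨ R.low d (rightEnd S.word) ≤ S.lo := by
  have hR' := P.lo_lt_hi R hR
  have hS' := P.lo_lt_hi S hS
  have hdisj : Disjoint (Ioo S.lo S.hi)
      (Ioo (R.upp d (leftEnd S.word)) (R.low d (rightEnd S.word))) := by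
    by_cases h0 : ρ = []
    · have e : S.word = R.word := by simpa [h0] using hρ
      rw [e, Rect.upp_leftEnd hd, Rect.low_rightEnd hd]
      exact (P.nonoverlapping R hR S hS e.symm hne).symm
    · refine ((P.disjoint_gaps S hS).mono_left Ioo_subset_Icc_self).mono_right fun t ht => ?_
      exact (mem_gaps hd P.lo_lt_hi).2 ⟨R, hR, ρ, h0, hρ, ht⟩
  rw [Ioo_disjoint_Ioo] at hdisj
  have := Rect.upp_leftEnd_append_lt hd hR' ρ
  rw [← hρ] at this
  rcases min_le_iff.1 hdisj with h | h <;> rcases le_max_iff.1 h with h' | h'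
  · exact absurd h' hS'.not_ge
  · exact Or.inl h'
  · exact Or.inr h'
  · exact absurd h' this.not_ge

/-- The copies of `D` in two rectangles of a packing are separated over every common point of
their bases. -/
lemma upp_lt_low (P : IsPacking d 𝓡) (hd : IsDenseNonEndpoints d) {R S : Rect} (hR : R ∈ 𝓡)
    (hS : S ∈ 𝓡) (hne : R ≠ S) {c : ℝ} (hcR : c ∈ piece R.word) (hcS : c ∈ piece S.word) :
    R.upp d c < S.low d c ∨ S.upp d c < R.low d c := by
  wlog hl : R.word.length ≤ S.word.length generalizing R S
  · exact (this hS hR hne.symm hcS hcR (not_le.1 hl).le).symm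
  have hR' := P.lo_lt_hi R hR
  have hS' := P.lo_lt_hi S hS
  obtain ⟨ρ, hρ⟩ := exists_eq_append_of_mem_piece hcR hcS hl
  rcases P.hi_le_upp_or hd hR hS hne hρ with h | h
  · right
    -- Over the left end the copy in `S` stays strictly below its ceiling `S.hi`. Over any other
    -- point the copy in `R` has risen strictly above the lower end of the gap. Either effect turns
    -- the weak inequality into a strict one.
    by_cases h1 : c = leftEnd S.word
    · have h2 := Rect.upp_lt_hi hd hS' hcS (h1 ▸ (leftEnd_lt_rightEnd _).ne)
      rw [h1, hρ, ← Rect.upp_leftEnd_append hd, ← hρ]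
      rw [h1] at h2
      exact h2.trans_le h
    · rw [hρ] at hcS h h1
      exact (Rect.upp_le_hi hS' _).trans_lt (h.trans_lt (Rect.upp_leftEnd_lt_low hd hR' hcS h1))
  · left
    by_cases h1 : c = rightEnd S.word
    · have h2 := Rect.lo_lt_low hd hS' hcS (h1 ▸ (leftEnd_lt_rightEnd _).ne')
      rw [h1, hρ, Rect.upp_rightEnd_append hd, ← hρ]
      rw [h1] at h2
      exact h.trans_lt h2
    · rw [hρ] at hcS h h1
      exact ((Rect.upp_lt_low_rightEnd hd hR' hcS h1).trans_le h).trans_le (Rect.lo_le_low hS' _)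

/-- The closed gaps over a piece of higher level than the rectangles are disjoint. -/
lemma gap_lt_gap (P : IsPacking d 𝓡) (hd : IsDenseNonEndpoints d) {R S : Rect} (hR : R ∈ 𝓡)
    (hS : S ∈ 𝓡) (hne : R ≠ S) {σ ρ τ : List Bool} (hρ : ρ ≠ []) (hτ : τ ≠ [])
    (eR : σ = R.word ++ ρ) (eS : σ = S.word ++ τ) :
    S.low d (rightEnd σ) < R.upp d (leftEnd σ) ∨ R.low d (rightEnd σ) < S.upp d (leftEnd σ) := by
  wlog hl : R.word.length ≤ S.word.length generalizing R S ρ τ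
  · exact (this hS hR hne.symm hτ hρ eS eR (not_le.1 hl).le).symm
  have hR' := P.lo_lt_hi R hR
  have hS' := P.lo_lt_hi S hS
  have hlS : leftEnd σ ∈ piece S.word := by
    rw [eS]; exact piece_append_subset _ _ (leftEnd_mem_piece _)
  have hrS : rightEnd σ ∈ piece S.word := by
    rw [eS]; exact piece_append_subset _ _ (rightEnd_mem_piece _)
  have hlR : leftEnd σ ∈ piece R.word := by
    rw [eR]; exact piece_append_subset _ _ (leftEnd_mem_piece _)
  obtain ⟨υ, hυ⟩ := exists_eq_append_of_mem_piece hlR hlS hl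
  -- The base over `σ` is too short to share both ends with the base of `S`. If one end is shared,
  -- the other end is not, and there the copy in `S` is strictly off its floor or ceiling.
  have hlen : rightEnd σ - leftEnd σ < rightEnd S.word - leftEnd S.word := by
    have h1 : S.word.length < σ.length := by
      rw [eS, List.length_append]
      have := List.length_pos_iff.2 hτ
      omega
    simp only [rightEnd, add_sub_cancel_left]
    gcongr
    norm_num
  rcases P.hi_le_upp_or hd hR hS hne hυ with h | h
  · left
    by_cases h1 : leftEnd σ = leftEnd S.word
    · have h2 := Rect.upp_lt_hi hd hS' hrS (fun e => by linarith)
      rw [h1]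
      exact (Rect.low_le_upp hS' _).trans_lt (h2.trans_le h)
    · rw [hυ] at hlS h h1
      have := (h.trans_lt (Rect.upp_leftEnd_lt_low hd hR' hlS h1))
      exact ((Rect.low_le_upp hS' _).trans (Rect.upp_le_hi hS' _)).trans_lt
        (this.trans_le (Rect.low_le_upp hR' _))
  · right
    by_cases h1 : rightEnd σ = rightEnd S.word
    · have h2 := Rect.lo_lt_low hd hS' hlS (fun e => by linarith)
      rw [h1]
      exact (h.trans_lt h2).trans_le (Rect.low_le_upp hS' _)
    · rw [hυ] at hrS h h1
      have := (Rect.upp_lt_low_rightEnd hd hR' hrS h1).trans_le h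
      exact ((Rect.low_le_upp hR' _).trans_lt this).trans_le
        ((Rect.lo_le_low hS' _).trans (Rect.low_le_upp hS' _))

end IsPacking

/-! ### Density of the copies of `D` over a point of the Cantor set -/

namespace IsTiling

variable {d : ℕ → ℝ} {𝓡 : Set Rect}

lemma Icc_subset (T : IsTiling d 𝓡) {R : Rect} (hR : R ∈ 𝓡) (h : R.word ≠ []) :
    Icc R.lo R.hi ⊆ Icc (-(R.word.length : ℝ)) ((R.word.length : ℝ) + 1) \ gaps d 𝓡 R.word := by
  rw [← T.tile R.word h]
  exact subset_biUnion_of_mem (u := fun R : Rect => Icc R.lo R.hi)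
    (show R ∈ {S ∈ 𝓡 | S.word = R.word} from ⟨hR, rfl⟩)

lemma disjoint_gaps (T : IsTiling d 𝓡) {R : Rect} (hR : R ∈ 𝓡) :
    Disjoint (Icc R.lo R.hi) (gaps d 𝓡 R.word) := by
  by_cases h : R.word = []
  · rw [Set.disjoint_left]
    rintro t - ⟨S, -, hl, -⟩
    simp [h] at hl
  · exact Set.disjoint_left.2 fun t ht => (T.Icc_subset hR h ht).2

lemma isPacking (T : IsTiling d 𝓡) : IsPacking d 𝓡 where
  lo_lt_hi := T.lo_lt_hi
  nonoverlapping := T.nonoverlapping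
  disjoint_gaps _ h := T.disjoint_gaps h

lemma finite_le (T : IsTiling d 𝓡) (N : ℕ) : {R ∈ 𝓡 | R.word.length ≤ N}.Finite := by
  have : {R ∈ 𝓡 | R.word.length ≤ N} = ⋃ n ∈ Iic N, {R ∈ 𝓡 | R.word.length = n} := by
    ext R
    simp [and_comm]
  rw [this]
  exact (finite_Iic N).biUnion fun n _ => T.finite n

lemma countable (T : IsTiling d 𝓡) : 𝓡.Countable := by
  have : 𝓡 = ⋃ n, {R ∈ 𝓡 | R.word.length = n} := by
    ext R
    simp
  rw [this]
  exact countable_iUnion fun n => (T.finite n).countable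

/-- The gap over `σ` is bounded by heights of the copy over the two ends of `σ`. As the pieces
shrink to `c`, semicontinuity keeps the relevant bound on its side of `t`. -/
lemma eventually_notMem {R : Rect} (hR : R.lo < R.hi) {c t : ℝ}
    (ht : t < R.low d c ∨ R.upp d c < t) : ∃ N, ∀ σ : List Bool, N ≤ σ.length → c ∈ piece σ →
      t ∉ Ioo (R.upp d (leftEnd σ)) (R.low d (rightEnd σ)) := by
  rcases ht with ht | ht
  · have h := (Rect.isOpen_setOf_lt_low (d := d) hR).mem_nhds (show ((c, t) : ℝ × ℝ) ∈ _ from ht)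
    have h2 : ∀ᶠ c' in 𝓝 c, t < R.low d c' :=
      (Continuous.prodMk_left (X := ℝ) t).continuousAt.preimage_mem_nhds h
    obtain ⟨δ, hδ, hδ'⟩ := Metric.eventually_nhds_iff.1 h2
    obtain ⟨N, hN⟩ := exists_piece_subset_Ioo (c := c) hδ
    refine ⟨N, fun σ hσ hcσ ht' => ?_⟩
    have h3 := hN σ hσ hcσ (leftEnd_mem_piece σ)
    have h4 := hδ' (show dist (leftEnd σ) c < δ by
      rw [Real.dist_eq, abs_lt]; constructor <;> linarith [h3.1, h3.2])
    linarith [ht'.1, Rect.low_le_upp (d := d) hR (leftEnd σ)]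
  · have h := (Rect.isOpen_setOf_upp_lt (d := d) hR).mem_nhds (show ((c, t) : ℝ × ℝ) ∈ _ from ht)
    have h2 : ∀ᶠ c' in 𝓝 c, R.upp d c' < t :=
      (Continuous.prodMk_left (X := ℝ) t).continuousAt.preimage_mem_nhds h
    obtain ⟨δ, hδ, hδ'⟩ := Metric.eventually_nhds_iff.1 h2
    obtain ⟨N, hN⟩ := exists_piece_subset_Ioo (c := c) hδ
    refine ⟨N, fun σ hσ hcσ ht' => ?_⟩
    have h3 := hN σ hσ hcσ (rightEnd_mem_piece σ)
    have h4 := hδ' (show dist (rightEnd σ) c < δ by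
      rw [Real.dist_eq, abs_lt]; constructor <;> linarith [h3.1, h3.2])
    linarith [ht'.2, Rect.low_le_upp (d := d) hR (rightEnd σ)]

/-- Over a small enough piece around `c`, the height `t` lies either in a tile of that level or in a
gap. The finitely many rectangles of low level eventually have no gap around `t`, so in both cases
`t` lies between `R.lo` and `R.hi` for a rectangle of high level, hence of small height. -/
lemma exists_near (T : IsTiling d 𝓡) (hd : IsDenseNonEndpoints d) {c t ε : ℝ}
    (hc : c ∈ cantorSet) (ht : ∀ R ∈ 𝓡, c ∈ piece R.word → t < R.low d c ∨ R.upp d c < t)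
    (hε : 0 < ε) :
    ∃ R ∈ 𝓡, c ∈ piece R.word ∧ t - ε < R.low d c ∧ R.upp d c < t + ε := by
  obtain ⟨N, hN⟩ := exists_nat_one_div_lt hε
  have hsmall : ∀ R ∈ 𝓡, N ≤ R.word.length → t ∈ Icc R.lo R.hi →
      t - ε < R.low d c ∧ R.upp d c < t + ε := by
    intro R hR hNR htR
    have h1 := T.height_le R hR
    have h2 : 1 / ((R.word.length : ℝ) + 1) ≤ 1 / ((N : ℝ) + 1) := by gcongr
    have h3 := Rect.lo_le_low (d := d) (T.lo_lt_hi R hR) c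
    have h4 := Rect.upp_le_hi (d := d) (T.lo_lt_hi R hR) c
    constructor <;> linarith [htR.1, htR.2]
  have hfin : ∃ N', ∀ R ∈ {R ∈ 𝓡 | R.word.length ≤ N}, c ∈ piece R.word → ∀ σ : List Bool,
      N' ≤ σ.length → c ∈ piece σ → t ∉ Ioo (R.upp d (leftEnd σ)) (R.low d (rightEnd σ)) := by
    have h1 : ∀ R : Rect, ∃ N', R ∈ 𝓡 → c ∈ piece R.word → ∀ σ : List Bool,
        N' ≤ σ.length → c ∈ piece σ → t ∉ Ioo (R.upp d (leftEnd σ)) (R.low d (rightEnd σ)) := by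
      intro R
      by_cases h : R ∈ 𝓡 ∧ c ∈ piece R.word
      · obtain ⟨N', h'⟩ := eventually_notMem (T.lo_lt_hi R h.1) (ht R h.1 h.2)
        exact ⟨N', fun _ _ => h'⟩
      · exact ⟨0, fun h1 h2 => absurd ⟨h1, h2⟩ h⟩
    choose g hg using h1
    obtain ⟨N', hN'⟩ := ((T.finite_le N).image g).bddAbove
    exact ⟨N', fun R hR hcR σ hσ => hg R hR.1 hcR σ ((hN' (mem_image_of_mem g hR)).trans hσ)⟩
  obtain ⟨N', hN'⟩ := hfin
  obtain ⟨K, hK⟩ := exists_nat_ge |t|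
  -- Beyond `N` the rectangles are thinner than `ε`, beyond `N'` the gaps of the thick ones avoid
  -- `t`, and beyond `K` the tiled strip contains `t`.
  obtain ⟨σ, hσ, hcσ⟩ := exists_mem_piece (max (N + 1) (max N' K)) hc
  have hσN : N + 1 ≤ σ.length := hσ ▸ le_max_left _ _
  have hσN' : N' ≤ σ.length := hσ ▸ (le_max_left _ _).trans (le_max_right _ _)
  have hσK : K ≤ σ.length := hσ ▸ (le_max_right _ _).trans (le_max_right _ _)
  have hσ0 : σ ≠ [] := by
    rintro rfl
    simp at hσN
  have ht1 : t ∈ Icc (-(σ.length : ℝ)) ((σ.length : ℝ) + 1) := by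
    have h1 : (K : ℝ) ≤ σ.length := by exact_mod_cast hσK
    constructor <;> linarith [abs_le.1 hK]
  by_cases hgap : t ∈ gaps d 𝓡 σ
  · obtain ⟨R, hR, ρ, hρ, e, htR⟩ := (mem_gaps hd T.lo_lt_hi).1 hgap
    have hcR : c ∈ piece R.word := piece_append_subset _ ρ (e ▸ hcσ)
    have hNR : N < R.word.length := by
      by_contra! h
      exact hN' R ⟨hR, h⟩ hcR σ hσN' hcσ htR
    refine ⟨R, hR, hcR, hsmall R hR hNR.le ?_⟩
    have hlh := T.lo_lt_hi R hR
    exact ⟨((Rect.lo_le_low hlh _).trans (Rect.low_le_upp hlh _)).trans htR.1.le,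
      htR.2.le.trans ((Rect.low_le_upp hlh _).trans (Rect.upp_le_hi hlh _))⟩
  · have h1 : t ∈ ⋃ R ∈ {R ∈ 𝓡 | R.word = σ}, Icc R.lo R.hi := by
      rw [T.tile σ hσ0]
      exact ⟨ht1, hgap⟩
    simp only [mem_iUnion, exists_prop] at h1
    obtain ⟨R, ⟨hR, e⟩, htR⟩ := h1
    exact ⟨R, hR, e ▸ hcσ, hsmall R hR (by rw [e]; omega) htR⟩

/-- Probing a height between `t` and `t'` either succeeds at once or hits a copy, which lies above
`t`. If that copy reaches `t'`, a second probe strictly between `t` and its lower height can only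
hit a different copy, and separation confines that one below the first. -/
lemma exists_above (T : IsTiling d 𝓡) (hd : IsDenseNonEndpoints d) {c t t' : ℝ}
    (hc : c ∈ cantorSet) (ht : ∀ R ∈ 𝓡, c ∈ piece R.word → t < R.low d c ∨ R.upp d c < t)
    (htt' : t < t') : ∃ R ∈ 𝓡, c ∈ piece R.word ∧ t < R.low d c ∧ R.upp d c < t' := by
  have step : ∀ s, t < s → s < t' → (∃ R ∈ 𝓡, c ∈ piece R.word ∧ t < R.low d c ∧ R.upp d c < t') ∨
      ∃ R ∈ 𝓡, c ∈ piece R.word ∧ R.low d c ≤ s ∧ s ≤ R.upp d c := by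
    intro s h1 h2
    by_cases h : ∀ R ∈ 𝓡, c ∈ piece R.word → s < R.low d c ∨ R.upp d c < s
    · left
      obtain ⟨R, hR, hcR, h3, h4⟩ :=
        T.exists_near hd hc h (lt_min (sub_pos.2 h1) (sub_pos.2 h2))
      exact ⟨R, hR, hcR, by linarith [min_le_left (s - t) (t' - s)],
        by linarith [min_le_right (s - t) (t' - s)]⟩
    · push Not at h
      exact Or.inr h
  rcases step ((t + t') / 2) (by linarith) (by linarith) with h | ⟨R, hR, hcR, h1, h2⟩
  · exact h
  have h3 : t < R.low d c := by
    rcases ht R hR hcR with h | h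
    · exact h
    · linarith
  by_cases h4 : R.upp d c < t'
  · exact ⟨R, hR, hcR, h3, h4⟩
  rcases step ((t + R.low d c) / 2) (by linarith) (by linarith) with h | ⟨S, hS, hcS, h5, h6⟩
  · exact h
  have h7 : t < S.low d c := by
    rcases ht S hS hcS with h | h
    · exact h
    · linarith
  refine ⟨S, hS, hcS, h7, ?_⟩
  have hne : S ≠ R := by
    rintro rfl
    linarith
  rcases T.isPacking.upp_lt_low hd hS hR hne hcS hcR with h | h <;> linarith

lemma exists_below (T : IsTiling d 𝓡) (hd : IsDenseNonEndpoints d) {c t t' : ℝ}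
    (hc : c ∈ cantorSet) (ht : ∀ R ∈ 𝓡, c ∈ piece R.word → t < R.low d c ∨ R.upp d c < t)
    (htt' : t' < t) : ∃ R ∈ 𝓡, c ∈ piece R.word ∧ t' < R.low d c ∧ R.upp d c < t := by
  have step : ∀ s, s < t → t' < s → (∃ R ∈ 𝓡, c ∈ piece R.word ∧ t' < R.low d c ∧ R.upp d c < t) ∨
      ∃ R ∈ 𝓡, c ∈ piece R.word ∧ R.low d c ≤ s ∧ s ≤ R.upp d c := by
    intro s h1 h2
    by_cases h : ∀ R ∈ 𝓡, c ∈ piece R.word → s < R.low d c ∨ R.upp d c < s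
    · left
      obtain ⟨R, hR, hcR, h3, h4⟩ :=
        T.exists_near hd hc h (lt_min (sub_pos.2 h1) (sub_pos.2 h2))
      exact ⟨R, hR, hcR, by linarith [min_le_right (t - s) (s - t')],
        by linarith [min_le_left (t - s) (s - t')]⟩
    · push Not at h
      exact Or.inr h
  rcases step ((t + t') / 2) (by linarith) (by linarith) with h | ⟨R, hR, hcR, h1, h2⟩
  · exact h
  have h3 : R.upp d c < t := by
    rcases ht R hR hcR with h | h
    · linarith
    · exact h
  by_cases h4 : t' < R.low d c
  · exact ⟨R, hR, hcR, h4, h3⟩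
  rcases step ((t + R.upp d c) / 2) (by linarith) (by linarith) with h | ⟨S, hS, hcS, h5, h6⟩
  · exact h
  have h7 : S.upp d c < t := by
    rcases ht S hS hcS with h | h
    · linarith
    · exact h
  refine ⟨S, hS, hcS, ?_, h7⟩
  have hne : S ≠ R := by
    rintro rfl
    linarith
  rcases T.isPacking.upp_lt_low hd hS hR hne hcS hcR with h | h <;> linarith

/-- A vertical segment lies in an open vertical arc of one of the copies of `D` or meets one of
the copies of `E`. -/
lemma exists_arc_or (T : IsTiling d 𝓡) (hd : IsDenseNonEndpoints d) {c t t' : ℝ}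
    (hc : c ∈ cantorSet) (htt' : t < t') :
    (∃ R ∈ 𝓡, c ∈ piece R.word ∧ R.low d c < t ∧ t' < R.upp d c) ∨
      ∃ R ∈ 𝓡, ∃ s ∈ Icc t t', (c, s) ∈ R.map '' setE d := by
  by_cases h : ∀ R ∈ 𝓡, c ∈ piece R.word → t < R.low d c ∨ R.upp d c < t
  · obtain ⟨R, hR, hcR, h1, h2⟩ := T.exists_above hd hc h htt'
    have := Rect.low_le_upp (d := d) (T.lo_lt_hi R hR) c
    exact Or.inr ⟨R, hR, R.low d c, ⟨h1.le, by linarith⟩,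
      (Rect.mem_map_setE hd (T.lo_lt_hi R hR)).2 ⟨hcR, Or.inl rfl⟩⟩
  · push Not at h
    obtain ⟨R, hR, hcR, h1, h2⟩ := h
    by_cases h3 : R.upp d c ≤ t'
    · exact Or.inr ⟨R, hR, R.upp d c, ⟨h2, h3⟩,
        (Rect.mem_map_setE hd (T.lo_lt_hi R hR)).2 ⟨hcR, Or.inr rfl⟩⟩
    · by_cases h4 : R.low d c = t
      · exact Or.inr ⟨R, hR, R.low d c, ⟨h4.ge, by linarith⟩,
          (Rect.mem_map_setE hd (T.lo_lt_hi R hR)).2 ⟨hcR, Or.inl rfl⟩⟩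
      · exact Or.inl ⟨R, hR, hcR, lt_of_le_of_ne h1 h4, not_le.1 h3⟩

end IsTiling

/-! ## Existence of tilings -/

/-- `A` is a finite set of nonoverlapping intervals of length at most `ε` with union `S`. -/
structure IsTileSet (S : Set ℝ) (ε : ℝ) (A : Set (ℝ × ℝ)) : Prop where
  finite : A.Finite
  lt : ∀ p ∈ A, p.1 < p.2
  length_le : ∀ p ∈ A, p.2 - p.1 ≤ ε
  disjoint : ∀ p ∈ A, ∀ q ∈ A, p ≠ q → Disjoint (Ioo p.1 p.2) (Ioo q.1 q.2)
  iUnion_eq : ⋃ p ∈ A, Icc p.1 p.2 = S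

lemma IsTileSet.Icc_subset {S : Set ℝ} {ε : ℝ} {A : Set (ℝ × ℝ)} (h : IsTileSet S ε A)
    {p : ℝ × ℝ} (hp : p ∈ A) : Icc p.1 p.2 ⊆ S := by
  rw [← h.iUnion_eq]
  exact subset_biUnion_of_mem (u := fun p : ℝ × ℝ => Icc p.1 p.2) hp

lemma IsTileSet.union {S S' : Set ℝ} {ε m : ℝ} {A A' : Set (ℝ × ℝ)} (h : IsTileSet S ε A)
    (h' : IsTileSet S' ε A') (hS : S ⊆ Iic m) (hS' : S' ⊆ Ici m) :
    IsTileSet (S ∪ S') ε (A ∪ A') := by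
  have key : ∀ p ∈ A, ∀ q ∈ A', Disjoint (Ioo p.1 p.2) (Ioo q.1 q.2) := by
    intro p hp q hq
    have h1 : p.2 ≤ m := hS (h.Icc_subset hp ⟨(h.lt p hp).le, le_rfl⟩)
    have h2 : m ≤ q.1 := hS' (h'.Icc_subset hq ⟨le_rfl, (h'.lt q hq).le⟩)
    rw [Set.disjoint_left]
    intro t ht ht'
    linarith [ht.2, ht'.1]
  refine ⟨h.finite.union h'.finite, ?_, ?_, ?_, ?_⟩
  · rintro p (hp | hp)
    exacts [h.lt p hp, h'.lt p hp]
  · rintro p (hp | hp)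
    exacts [h.length_le p hp, h'.length_le p hp]
  · rintro p (hp | hp) q (hq | hq) hne
    exacts [h.disjoint p hp q hq hne, key p hp q hq, (key q hq p hp).symm,
      h'.disjoint p hp q hq hne]
  · rw [biUnion_union, h.iUnion_eq, h'.iUnion_eq]

lemma exists_isTileSet_Icc {ε : ℝ} (hε : 0 < ε) {a b : ℝ} (hab : a < b) :
    ∃ A, IsTileSet (Icc a b) ε A := by
  obtain ⟨n, hn⟩ := exists_nat_ge ((b - a) / ε)
  rw [div_le_iff₀ hε] at hn
  induction n generalizing a with
  | zero => simp at hn; linarith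
  | succ n ih =>
    by_cases h : b - a ≤ ε
    · refine ⟨{(a, b)}, finite_singleton _, ?_, ?_, ?_, ?_⟩
      · simpa
      · simpa using sub_le_iff_le_add.1 h
      · rintro p rfl q rfl hne
        exact absurd rfl hne
      · simp
    · obtain ⟨A, hA⟩ := ih (a := a + ε) (by linarith) (by push_cast at hn; linarith)
      have h1 : IsTileSet (Icc a (a + ε)) ε {(a, a + ε)} := by
        refine ⟨finite_singleton _, ?_, ?_, ?_, ?_⟩
        · simpa
        · simp [add_comm]
        · rintro p rfl q rfl hne
          exact absurd rfl hne
        · simp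
      have h2 := h1.union hA Icc_subset_Iic_self Icc_subset_Ici_self
      rw [Icc_union_Icc_eq_Icc (by linarith) (by linarith)] at h2
      exact ⟨_, h2⟩

/-- Cutting at one gap leaves two nondegenerate intervals with fewer gaps each. The gaps must have
disjoint closures: two gaps with a common end would isolate a single point, which no nondegenerate
interval can tile. -/
lemma exists_isTileSet_diff {ε : ℝ} (hε : 0 < ε) (G : Finset (ℝ × ℝ)) {a b : ℝ} (hab : a < b)
    (hG : ∀ g ∈ G, a < g.1 ∧ g.1 < g.2 ∧ g.2 < b)
    (hG' : ∀ g ∈ G, ∀ g' ∈ G, g ≠ g' → g.2 < g'.1 ∨ g'.2 < g.1) :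
    ∃ A, IsTileSet (Icc a b \ ⋃ g ∈ G, Ioo g.1 g.2) ε A := by
  induction G using Finset.strongInduction generalizing a b with
  | H G ih =>
    by_cases h0 : G = ∅
    · obtain ⟨A, hA⟩ := exists_isTileSet_Icc hε hab
      exact ⟨A, by simpa [h0] using hA⟩
    obtain ⟨g, hg⟩ := Finset.nonempty_iff_ne_empty.2 h0
    obtain ⟨hag, hgg, hgb⟩ := hG g hg
    have hs1 : G.filter (fun g' => g'.2 < g.1) ⊂ G :=
      Finset.filter_ssubset.2 ⟨g, hg, not_lt.2 hgg.le⟩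
    have hs2 : G.filter (fun g' => g.2 < g'.1) ⊂ G :=
      Finset.filter_ssubset.2 ⟨g, hg, not_lt.2 hgg.le⟩
    obtain ⟨A, hA⟩ := ih _ hs1 (a := a) (b := g.1) hag
      (fun g' h => by
        rw [Finset.mem_filter] at h
        exact ⟨(hG g' h.1).1, (hG g' h.1).2.1, h.2⟩)
      (fun g' h g'' h' => hG' g' (Finset.mem_filter.1 h).1 g'' (Finset.mem_filter.1 h').1)
    obtain ⟨B, hB⟩ := ih _ hs2 (a := g.2) (b := b) hgb
      (fun g' h => by
        rw [Finset.mem_filter] at h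
        exact ⟨h.2, (hG g' h.1).2⟩)
      (fun g' h g'' h' => hG' g' (Finset.mem_filter.1 h).1 g'' (Finset.mem_filter.1 h').1)
    have hAB := hA.union hB (m := g.1) (sdiff_subset.trans Icc_subset_Iic_self)
      ((sdiff_subset.trans Icc_subset_Ici_self).trans (Ici_subset_Ici.2 hgg.le))
    refine ⟨A ∪ B, ?_⟩
    convert hAB using 1
    ext t
    simp only [Set.mem_sdiff, mem_union, mem_iUnion, Finset.mem_filter, mem_Icc, mem_Ioo,
      exists_prop,
      not_exists, not_and, and_imp, Prod.forall]
    constructor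
    · rintro ⟨⟨h1, h2⟩, h3⟩
      rcases le_or_gt t g.1 with h4 | h4
      · exact Or.inl ⟨⟨h1, h4⟩, fun x y h5 _ => h3 x y h5⟩
      · exact Or.inr ⟨⟨not_lt.1 (h3 _ _ hg h4), h2⟩, fun x y h5 _ => h3 x y h5⟩
    · rintro (⟨⟨h1, h2⟩, h3⟩ | ⟨⟨h1, h2⟩, h3⟩)
      · refine ⟨⟨h1, by linarith⟩, fun x y h4 h5 h6 => ?_⟩
        by_cases h7 : (x, y) = g
        · subst h7
          linarith
        · rcases hG' (x, y) h4 g hg h7 with h8 | h8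
          · exact h3 x y h4 h8 h5 h6
          · linarith
      · refine ⟨⟨by linarith, h2⟩, fun x y h4 h5 h6 => ?_⟩
        by_cases h7 : (x, y) = g
        · subst h7
          linarith
        · rcases hG' (x, y) h4 g hg h7 with h8 | h8
          · linarith
          · exact h3 x y h4 h8 h5 h6

lemma gaps_congr {d : ℕ → ℝ} {𝓡 𝓢 : Set Rect} {σ : List Bool}
    (h : ∀ R : Rect, R.word.length < σ.length → (R ∈ 𝓡 ↔ R ∈ 𝓢)) :
    gaps d 𝓡 σ = gaps d 𝓢 σ := by
  ext t
  constructor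
  · rintro ⟨R, hR, hl, h'⟩
    exact ⟨R, (h R hl).1 hR, hl, h'⟩
  · rintro ⟨R, hR, hl, h'⟩
    exact ⟨R, (h R hl).2 hR, hl, h'⟩

/-- The properties of the rectangles of level at most `n` of a tiling. -/
structure IsPartialTiling (d : ℕ → ℝ) (n : ℕ) (𝓡 : Set Rect) : Prop extends IsPacking d 𝓡 where
  finite : 𝓡.Finite
  length_le : ∀ R ∈ 𝓡, R.word.length ≤ n
  neg_le_lo : ∀ R ∈ 𝓡, -(R.word.length : ℝ) ≤ R.lo
  hi_le : ∀ R ∈ 𝓡, R.hi ≤ R.word.length + 1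

/-- Rectangles of level at most `n` have heights in `[-n, n + 1]`, so their gaps lie strictly inside
the strip of the next level, and `gap_lt_gap` keeps the closed gaps apart. -/
lemma IsPartialTiling.exists_isTileSet {d : ℕ → ℝ} (hd : IsDenseNonEndpoints d) {n : ℕ}
    {𝓡 : Set Rect} (P : IsPartialTiling d n 𝓡) {σ : List Bool} (hσ : σ.length = n + 1) :
    ∃ A, IsTileSet (Icc (-(σ.length : ℝ)) (σ.length + 1) \ gaps d 𝓡 σ)
      (1 / ((σ.length : ℝ) + 1)) A := by
  classical
  let I : Set Rect := {R ∈ 𝓡 | ∃ ρ, ρ ≠ [] ∧ σ = R.word ++ ρ}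
  have hI : I.Finite := P.finite.subset (sep_subset _ _)
  let G : Finset (ℝ × ℝ) :=
    hI.toFinset.image fun R => (R.upp d (leftEnd σ), R.low d (rightEnd σ))
  have hG : gaps d 𝓡 σ = ⋃ g ∈ G, Ioo g.1 g.2 := by
    ext t
    rw [mem_gaps hd P.lo_lt_hi]
    simp only [G, I, mem_iUnion, Finset.mem_image, Finite.mem_toFinset, exists_prop]
    constructor
    · rintro ⟨R, hR, ρ, hρ, e, ht⟩
      exact ⟨_, ⟨R, ⟨hR, ρ, hρ, e⟩, rfl⟩, ht⟩
    · rintro ⟨_, ⟨R, ⟨hR, ρ, hρ, e⟩, rfl⟩, ht⟩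
      exact ⟨R, hR, ρ, hρ, e, ht⟩
  rw [hG]
  have hpos : (0 : ℝ) ≤ σ.length := Nat.cast_nonneg _
  refine exists_isTileSet_diff (by positivity) G (by linarith) ?_ ?_
  · intro g hg
    simp only [G, I, Finset.mem_image, Finite.mem_toFinset] at hg
    obtain ⟨R, ⟨hR, ρ, hρ, e⟩, rfl⟩ := hg
    have hlt := P.lo_lt_hi R hR
    have h1 : (R.word.length : ℝ) + 1 ≤ σ.length := by
      have := P.length_le R hR
      rw [hσ]
      exact_mod_cast Nat.succ_le_succ this
    refine ⟨?_, ?_, ?_⟩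
    · have h2 := (Rect.lo_le_low (d := d) hlt (leftEnd σ)).trans (Rect.low_le_upp hlt _)
      have h3 := P.neg_le_lo R hR
      simp only
      linarith
    · simp only
      rw [e]
      exact Rect.upp_leftEnd_append_lt hd hlt ρ
    · have h2 := (Rect.low_le_upp (d := d) hlt (rightEnd σ)).trans (Rect.upp_le_hi hlt _)
      have h3 := P.hi_le R hR
      simp only
      linarith
  · intro g hg g' hg' hne
    simp only [G, I, Finset.mem_image, Finite.mem_toFinset] at hg hg'
    obtain ⟨R, ⟨hR, ρ, hρ, e⟩, rfl⟩ := hg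
    obtain ⟨S, ⟨hS, τ, hτ, e'⟩, rfl⟩ := hg'
    have hRS : R ≠ S := fun h => hne (by rw [h])
    exact (P.gap_lt_gap hd hR hS hRS hρ hτ e e').symm

open Classical in
/-- A choice of tiles over the piece with address `σ`. -/
noncomputable def tiles (d : ℕ → ℝ) (𝓡 : Set Rect) (σ : List Bool) : Set (ℝ × ℝ) :=
  if h : ∃ A, IsTileSet (Icc (-(σ.length : ℝ)) (σ.length + 1) \ gaps d 𝓡 σ)
    (1 / ((σ.length : ℝ) + 1)) A then h.choose else ∅

/-- The rectangles of level at most `n` of a tiling. -/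
noncomputable def partialTiling (d : ℕ → ℝ) : ℕ → Set Rect
  | 0 => {⟨[], 0, 1⟩}
  | n + 1 => partialTiling d n ∪
      {R | R.word.length = n + 1 ∧ (R.lo, R.hi) ∈ tiles d (partialTiling d n) R.word}

lemma IsPartialTiling.isTileSet_tiles {d : ℕ → ℝ} (hd : IsDenseNonEndpoints d) {n : ℕ}
    {𝓡 : Set Rect} (P : IsPartialTiling d n 𝓡) {σ : List Bool} (hσ : σ.length = n + 1) :
    IsTileSet (Icc (-(σ.length : ℝ)) (σ.length + 1) \ gaps d 𝓡 σ)
      (1 / ((σ.length : ℝ) + 1)) (tiles d 𝓡 σ) := by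
  have h := P.exists_isTileSet hd hσ
  rw [tiles, dif_pos h]
  exact h.choose_spec

lemma isPartialTiling_partialTiling {d : ℕ → ℝ} (hd : IsDenseNonEndpoints d) (n : ℕ) :
    IsPartialTiling d n (partialTiling d n) := by
  induction n with
  | zero =>
    refine ⟨⟨?_, ?_, ?_⟩, finite_singleton _, ?_, ?_, ?_⟩
    · rintro R rfl
      norm_num
    · rintro R rfl S rfl - hne
      exact absurd rfl hne
    · rintro R rfl
      rw [Set.disjoint_left]
      rintro t - ⟨S, -, hl, -⟩
      simp at hl
    all_goals
      rintro R rfl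
      simp
  | succ n P =>
    have hgap : ∀ σ : List Bool, σ.length ≤ n + 1 →
        gaps d (partialTiling d (n + 1)) σ = gaps d (partialTiling d n) σ := by
      refine fun σ hσ => gaps_congr fun R hl => ⟨?_, Or.inl⟩
      rintro (h | h)
      · exact h
      · have := h.1
        omega
    refine ⟨⟨?_, ?_, ?_⟩, ?_, ?_, ?_, ?_⟩
    · rintro R (hR | ⟨hl, hR⟩)
      · exact P.lo_lt_hi R hR
      · exact (P.isTileSet_tiles hd hl).lt _ hR
    · rintro R (hR | ⟨hl, hR⟩) S (hS | ⟨hl', hS⟩) e hne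
      · exact P.nonoverlapping R hR S hS e hne
      · have := P.length_le R hR
        rw [e] at this
        omega
      · have := P.length_le S hS
        rw [← e] at this
        omega
      · rw [← e] at hS
        refine (P.isTileSet_tiles hd hl).disjoint _ hR _ hS fun h => hne ?_
        rw [Prod.mk.injEq] at h
        exact Rect.ext e h.1 h.2
    · rintro R (hR | ⟨hl, hR⟩)
      · rw [hgap _ ((P.length_le R hR).trans n.le_succ)]
        exact P.disjoint_gaps R hR
      · rw [hgap _ hl.le]
        exact Set.disjoint_left.2 fun t ht => ((P.isTileSet_tiles hd hl).Icc_subset hR ht).2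
    · refine P.finite.union ?_
      have hfin : (⋃ σ ∈ {σ : List Bool | σ.length = n + 1},
          (fun p : ℝ × ℝ => Rect.mk σ p.1 p.2) '' tiles d (partialTiling d n) σ).Finite :=
        (List.finite_length_eq Bool (n + 1)).biUnion fun σ hσ =>
          (P.isTileSet_tiles hd hσ).finite.image _
      refine hfin.subset ?_
      rintro R ⟨hl, hR⟩
      simp only [mem_iUnion]
      exact ⟨R.word, hl, _, hR, rfl⟩
    · rintro R (hR | ⟨hl, hR⟩)
      · exact (P.length_le R hR).trans n.le_succ
      · exact hl.le
    · rintro R (hR | ⟨hl, hR⟩)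
      · exact P.neg_le_lo R hR
      · have T := P.isTileSet_tiles hd hl
        exact (T.Icc_subset hR ⟨le_rfl, (T.lt _ hR).le⟩).1.1
    · rintro R (hR | ⟨hl, hR⟩)
      · exact P.hi_le R hR
      · have T := P.isTileSet_tiles hd hl
        exact (T.Icc_subset hR ⟨(T.lt _ hR).le, le_rfl⟩).1.2

/-- Stage `n + 1` adds only words of length exactly `n + 1`, so whether `R` occurs is settled at the
stage given by its own level. This lets the stages be glued into one family with unchanged gaps. -/
lemma mem_partialTiling_iff {d : ℕ → ℝ} (hd : IsDenseNonEndpoints d) {n : ℕ} {R : Rect} :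
    R ∈ partialTiling d n ↔ R.word.length ≤ n ∧ R ∈ partialTiling d R.word.length := by
  have key : ∀ m k, R.word.length ≤ m → (R ∈ partialTiling d (m + k) ↔ R ∈ partialTiling d m) := by
    intro m k hm
    induction k with
    | zero => rfl
    | succ k ih =>
      rw [← ih]
      refine ⟨?_, Or.inl⟩
      rintro (h | h)
      · exact h
      · have h' : R.word.length = m + k + 1 := h.1
        omega
  constructor
  · intro h
    have hl := (isPartialTiling_partialTiling hd n).length_le R h
    refine ⟨hl, ?_⟩
    rw [← key _ (n - R.word.length) le_rfl]
    rwa [Nat.add_sub_cancel' hl]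
  · rintro ⟨hl, h⟩
    rw [← key _ (n - R.word.length) le_rfl] at h
    rwa [Nat.add_sub_cancel' hl] at h

lemma exists_isTiling {d : ℕ → ℝ} (hd : IsDenseNonEndpoints d) : ∃ 𝓡, IsTiling d 𝓡 := by
  have P := isPartialTiling_partialTiling hd
  let 𝓡 : Set Rect := {R | R ∈ partialTiling d R.word.length}
  have hacc : ∀ (n : ℕ) (R : Rect), R.word.length ≤ n → (R ∈ 𝓡 ↔ R ∈ partialTiling d n) := by
    intro n R hl
    rw [mem_partialTiling_iff hd (n := n)]
    exact ⟨fun h => ⟨hl, h⟩, fun h => h.2⟩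
  refine ⟨𝓡, ?_, ?_, ?_, ?_, ?_, ?_⟩
  · ext R
    constructor
    · rintro ⟨hR, hl⟩
      rw [hacc 0 R hl.le] at hR
      exact hR
    · rintro rfl
      exact ⟨(hacc 0 _ le_rfl).2 rfl, rfl⟩
  · intro n
    refine (P n).finite.subset ?_
    rintro R ⟨hR, hl⟩
    exact (hacc n R hl.le).1 hR
  · exact fun R hR => (P _).lo_lt_hi R hR
  · intro R hR
    have hR' : R ∈ partialTiling d R.word.length := hR
    rcases hl : R.word.length with _ | n
    · rw [hl] at hR'
      obtain rfl : R = ⟨[], 0, 1⟩ := hR'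
      norm_num
    · rw [hl] at hR'
      rcases hR' with hR' | ⟨hl', hR'⟩
      · have := (P n).length_le R hR'
        omega
      · rw [← hl]
        exact ((P n).isTileSet_tiles hd hl').length_le _ hR'
  · intro R hR S hS e hne
    have hS' : S ∈ partialTiling d R.word.length := by
      rw [e]
      exact hS
    exact (P _).nonoverlapping R hR S hS' e hne
  · intro σ hσ
    obtain ⟨n, hn⟩ : ∃ n, σ.length = n + 1 :=
      Nat.exists_eq_succ_of_ne_zero (List.length_pos_iff.2 hσ).ne'
    have T := (P n).isTileSet_tiles hd hn
    rw [gaps_congr (𝓢 := partialTiling d n) fun R hl => hacc n R (by omega), ← T.iUnion_eq]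
    ext t
    simp only [mem_iUnion, exists_prop]
    constructor
    · rintro ⟨R, ⟨hR, e⟩, ht⟩
      refine ⟨(R.lo, R.hi), ?_, ht⟩
      rw [hacc (n + 1) R (by rw [e]; exact hn.le)] at hR
      rcases hR with hR | ⟨-, hR⟩
      · have := (P n).length_le R hR
        rw [e] at this
        omega
      · rwa [e] at hR
    · rintro ⟨p, hp, ht⟩
      exact ⟨⟨σ, p.1, p.2⟩, ⟨(hacc (n + 1) _ hn.le).2 (Or.inr ⟨hn, hp⟩), rfl⟩, ht⟩

/-! ### Infinitude of a tiling -/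

namespace IsTiling

variable {d : ℕ → ℝ} {𝓡 : Set Rect}

lemma neg_le_lo (T : IsTiling d 𝓡) {R : Rect} (hR : R ∈ 𝓡) : -(R.word.length : ℝ) ≤ R.lo := by
  by_cases h : R.word = []
  · have h1 : R ∈ {R ∈ 𝓡 | R.word.length = 0} := ⟨hR, by simp [h]⟩
    rw [T.zero] at h1
    obtain rfl : R = ⟨[], 0, 1⟩ := h1
    simp
  · exact (T.Icc_subset hR h ⟨le_rfl, (T.lo_lt_hi R hR).le⟩).1.1

/-- The bottom height `-|σ|` of a strip lies in no gap, as gaps are open intervals whose lower ends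
are not below it. Some tile over `σ` must contain it, so the levels are unbounded. -/
lemma infinite (T : IsTiling d 𝓡) (hd : IsDenseNonEndpoints d) : 𝓡.Infinite := by
  intro hfin
  obtain ⟨N, hN⟩ := (hfin.image fun R => R.word.length).bddAbove
  let σ : List Bool := List.replicate (N + 1) false
  have hσ : σ.length = N + 1 := List.length_replicate
  have hσ0 : σ ≠ [] := List.length_pos_iff.1 (by omega)
  have h1 : -(σ.length : ℝ) ∈ ⋃ R ∈ {R ∈ 𝓡 | R.word = σ}, Icc R.lo R.hi := by
    rw [T.tile σ hσ0]
    have hpos : (0 : ℝ) ≤ σ.length := Nat.cast_nonneg _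
    refine ⟨⟨le_rfl, by linarith⟩, fun h => ?_⟩
    obtain ⟨R, hR, ρ, hρ, e, ht⟩ := (mem_gaps hd T.lo_lt_hi).1 h
    have hlt := T.lo_lt_hi R hR
    have h2 := (Rect.lo_le_low (d := d) hlt (leftEnd σ)).trans (Rect.low_le_upp hlt _)
    have h3 := T.neg_le_lo hR
    have h4 : (R.word.length : ℝ) ≤ σ.length := by
      rw [e, List.length_append]
      push_cast
      have : (0 : ℝ) ≤ ρ.length := Nat.cast_nonneg _
      linarith
    linarith [ht.1]
  simp only [mem_iUnion, exists_prop] at h1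
  obtain ⟨R, ⟨hR, e⟩, -⟩ := h1
  have := hN (mem_image_of_mem _ hR)
  simp only [e] at this
  omega

end IsTiling

/-! ## The embedding of the strip into the plane -/

/-- Continuity of the inverse is needed only at values of `f`. This suits `fanBase` and the tangent,
which are not continuous everywhere. -/
lemma isInducing_of_continuousAt_leftInverse {X Y : Type*} [TopologicalSpace X]
    [TopologicalSpace Y] {f : X → Y} {g : Y → X} (hf : Continuous f)
    (hgf : Function.LeftInverse g f) (hg : ∀ x, ContinuousAt g (f x)) : IsInducing f := by
  rw [isInducing_iff_nhds]
  intro x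
  refine le_antisymm (map_le_iff_le_comap.1 hf.continuousAt) ?_
  have h : Tendsto (g ∘ f) (comap f (𝓝 (f x))) (𝓝 (g (f x))) := (hg x).tendsto.comp tendsto_comap
  rw [hgf.comp_eq_id, hgf x] at h
  exact h

/-- The increasing homeomorphism of the real line onto `(0, 1)` used by `squeeze`. -/
noncomputable def squash (t : ℝ) : ℝ := 1 / Real.pi * Real.arctan t + 1 / 2

/-- The inverse of `squash`. -/
noncomputable def unsquash (y : ℝ) : ℝ := Real.tan (Real.pi * (y - 1 / 2))

lemma unsquash_squash (t : ℝ) : unsquash (squash t) = t := by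
  have : Real.pi * (squash t - 1 / 2) = Real.arctan t := by
    unfold squash
    field_simp [Real.pi_ne_zero]
    ring
  rw [unsquash, this, Real.tan_arctan]

lemma pi_mul_mem_Ioo {y : ℝ} (hy : y ∈ Ioo (0 : ℝ) 1) :
    Real.pi * (y - 1 / 2) ∈ Ioo (-(Real.pi / 2)) (Real.pi / 2) := by
  have := Real.pi_pos
  constructor <;> nlinarith [hy.1, hy.2]

lemma squash_unsquash {y : ℝ} (hy : y ∈ Ioo (0 : ℝ) 1) : squash (unsquash y) = y := by
  have h := pi_mul_mem_Ioo hy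
  rw [squash, unsquash, Real.arctan_tan h.1 h.2]
  field_simp [Real.pi_ne_zero]
  ring

lemma squash_strictMono : StrictMono squash := by
  intro s t h
  have h1 := Real.arctan_strictMono h
  have h2 := Real.pi_pos
  unfold squash
  gcongr

lemma squash_mem_Ioo (t : ℝ) : squash t ∈ Ioo (0 : ℝ) 1 := by
  have h1 := Real.arctan_lt_pi_div_two t
  have h2 := Real.neg_pi_div_two_lt_arctan t
  have h3 := Real.pi_pos
  unfold squash
  constructor
  · have : 1 / Real.pi * (-(Real.pi / 2)) < 1 / Real.pi * Real.arctan t := by gcongr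
    have e : 1 / Real.pi * (-(Real.pi / 2)) = -(1 / 2) := by field_simp
    linarith
  · have : 1 / Real.pi * Real.arctan t < 1 / Real.pi * (Real.pi / 2) := by gcongr
    have e : 1 / Real.pi * (Real.pi / 2) = 1 / 2 := by field_simp
    linarith

lemma continuous_squash : Continuous squash := by
  unfold squash
  fun_prop

/-- The derivative is at most `1 / π`. Height bounds for rectangles thus carry over to the fan. -/
lemma abs_squash_sub_le (s t : ℝ) : |squash s - squash t| ≤ |s - t| := by
  have h : LipschitzWith 1 squash := by
    have hder : ∀ x, HasDerivAt squash (1 / Real.pi * (1 / (1 + x ^ 2))) x := fun x =>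
      ((Real.hasDerivAt_arctan x).const_mul _).add_const _
    refine lipschitzWith_of_nnnorm_deriv_le (fun x => (hder x).differentiableAt) fun x => ?_
    rw [(hder x).deriv, ← NNReal.coe_le_coe, coe_nnnorm, Real.norm_eq_abs, abs_of_nonneg]
    · have h1 : 1 / Real.pi ≤ 1 := by
        rw [div_le_one Real.pi_pos]
        linarith [Real.pi_gt_three]
      have h2 : 1 / (1 + x ^ 2) ≤ 1 := by
        rw [div_le_one (by positivity)]
        nlinarith
      simpa using mul_le_one₀ h1 (by positivity) h2
    · have := Real.pi_pos
      positivity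
  simpa [Real.dist_eq] using h.dist_le_mul s t

lemma nabla_apply_zero (p : ℝ × ℝ) : nabla p 0 = (p.2 * (2 * p.1 - 1) + 1) / 2 := rfl

lemma nabla_apply_one (p : ℝ × ℝ) : nabla p 1 = p.2 := rfl

lemma continuous_nabla : Continuous nabla := by
  unfold nabla
  refine (PiLp.continuous_toLp 2 _).comp (continuous_pi fun i => ?_)
  fin_cases i <;> simp <;> fun_prop

/-- The base coordinate of a point of the plane with nonzero height. -/
noncomputable def fanBase (z : Plane) : ℝ := ((2 * z 0 - 1) / z 1 + 1) / 2

lemma fanBase_nabla {p : ℝ × ℝ} (hp : p.2 ≠ 0) : fanBase (nabla p) = p.1 := by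
  rw [fanBase, nabla_apply_zero, nabla_apply_one]
  field_simp
  ring

lemma continuousAt_fanBase {z : Plane} (hz : z 1 ≠ 0) : ContinuousAt fanBase z := by
  have h0 : ContinuousAt (fun z : Plane => z 0) z := by fun_prop
  have h1 : ContinuousAt (fun z : Plane => z 1) z := by fun_prop
  unfold fanBase
  exact ((((h0.const_mul 2).sub_const 1).div h1 hz).add_const 1).div_const 2

lemma nabla_zero_height (c : ℝ) : nabla (c, 0) = vertex := by
  simp [nabla, vertex]

/-- The embedding of `ℝ × ℝ` into the plane that maps `C × ℝ` onto the open Cantor fan. -/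
noncomputable def toStrip (p : ℝ × ℝ) : Plane := nabla (squeeze p)

lemma squeeze_eq (p : ℝ × ℝ) : squeeze p = (p.1, squash p.2) := rfl

lemma toStrip_apply_one (p : ℝ × ℝ) : toStrip p 1 = squash p.2 := rfl

lemma fanBase_toStrip (p : ℝ × ℝ) : fanBase (toStrip p) = p.1 :=
  fanBase_nabla (squash_mem_Ioo p.2).1.ne'

lemma continuous_squeeze : Continuous squeeze := by
  have := continuous_squash
  simp only [funext squeeze_eq]
  fun_prop

lemma continuous_toStrip : Continuous toStrip := continuous_nabla.comp continuous_squeeze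

lemma isEmbedding_toStrip : IsEmbedding toStrip := by
  have hinv : Function.LeftInverse (fun z : Plane => (fanBase z, unsquash (z 1))) toStrip := by
    intro p
    ext
    · exact fanBase_toStrip p
    · simp only [toStrip_apply_one, unsquash_squash]
  refine ⟨isInducing_of_continuousAt_leftInverse continuous_toStrip hinv fun p => ?_,
    hinv.injective⟩
  have h1 := squash_mem_Ioo p.2
  refine (continuousAt_fanBase h1.1.ne').prodMk ?_
  have h2 : ContinuousAt Real.tan (Real.pi * (toStrip p 1 - 1 / 2)) :=
    Real.continuousAt_tan.2 (Real.cos_pos_of_mem_Ioo (pi_mul_mem_Ioo h1)).ne'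
  have h3 : ContinuousAt (fun z : Plane => Real.pi * (z 1 - 1 / 2)) (toStrip p) := by fun_prop
  exact ContinuousAt.comp (f := fun z : Plane => Real.pi * (z 1 - 1 / 2)) h2 h3

lemma toStrip_image_strip : toStrip '' (cantorSet ×ˢ univ) = nabla '' (cantorSet ×ˢ Ioo 0 1) := by
  ext z
  constructor
  · rintro ⟨p, hp, rfl⟩
    exact ⟨squeeze p, ⟨hp.1, squash_mem_Ioo p.2⟩, rfl⟩
  · rintro ⟨p, hp, rfl⟩
    refine ⟨(p.1, unsquash p.2), ⟨hp.1, mem_univ _⟩, ?_⟩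
    rw [toStrip, squeeze_eq]
    simp only [squash_unsquash hp.2]

lemma toFan_image (R : Rect) (A : Set (ℝ × ℝ)) : R.toFan '' A = toStrip '' (R.map '' A) := by
  rw [← image_comp]
  rfl

lemma continuous_toFan (R : Rect) : Continuous R.toFan :=
  continuous_toStrip.comp R.continuous_map

lemma toFan_injective {R : Rect} (hR : R.lo < R.hi) : Function.Injective R.toFan :=
  isEmbedding_toStrip.injective.comp (Rect.map_injective hR)

lemma dist_nabla_le {p q : ℝ × ℝ} (hp : p.1 ∈ Icc (0 : ℝ) 1) (hq : q.2 ∈ Icc (0 : ℝ) 1) :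
    dist (nabla p) (nabla q) ≤ |p.1 - q.1| + 2 * |p.2 - q.2| := by
  have h1 : |nabla p 0 - nabla q 0| ≤ |p.1 - q.1| + |p.2 - q.2| := by
    have e : nabla p 0 - nabla q 0 = (p.2 - q.2) * ((2 * p.1 - 1) / 2) + q.2 * (p.1 - q.1) := by
      rw [nabla_apply_zero, nabla_apply_zero]
      ring
    have a1 : |(2 * p.1 - 1) / 2| ≤ 1 := abs_le.2 ⟨by linarith [hp.1], by linarith [hp.2]⟩
    have a2 : |q.2| ≤ 1 := abs_le.2 ⟨by linarith [hq.1], hq.2⟩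
    rw [e]
    refine (abs_add_le _ _).trans ?_
    rw [abs_mul, abs_mul]
    nlinarith [abs_nonneg (p.2 - q.2), abs_nonneg (p.1 - q.1)]
  have h2 : |nabla p 1 - nabla q 1| = |p.2 - q.2| := rfl
  have h0 := abs_nonneg (nabla p 0 - nabla q 0)
  rw [EuclideanSpace.dist_eq, Fin.sum_univ_two, Real.dist_eq, Real.dist_eq, h2]
  refine Real.sqrt_le_iff.2 ⟨by positivity, ?_⟩
  nlinarith [abs_nonneg (p.2 - q.2), abs_nonneg (p.1 - q.1)]

/-! ## The copies of `D` -/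

/-- All the copies of `D` given by a tiling. -/
def unionD (d : ℕ → ℝ) (𝓡 : Set Rect) : Set (ℝ × ℝ) := ⋃ R ∈ 𝓡, R.map '' setD d

section

variable {d : ℕ → ℝ} {𝓡 : Set Rect} {R : ℕ → Rect}

lemma map_image_subset (S : Rect) {A : Set (ℝ × ℝ)} (hA : A ⊆ cantorSet ×ˢ univ) :
    S.map '' A ⊆ cantorSet ×ˢ univ := by
  rintro _ ⟨p, hp, rfl⟩
  exact ⟨piece_subset_cantorSet _ (S.map_mem (hA hp).1), mem_univ _⟩

lemma setD_subset_strip (hd : IsDenseNonEndpoints d) : setD d ⊆ cantorSet ×ˢ univ :=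
  fun _ hp => ⟨(setD_subset hd hp).1, mem_univ _⟩

lemma copyD_subset (hd : IsDenseNonEndpoints d) (n : ℕ) :
    copyD d R n ⊆ nabla '' (cantorSet ×ˢ Ioo 0 1) := by
  rw [copyD, toFan_image, ← toStrip_image_strip]
  exact image_mono (map_image_subset _ (setD_subset_strip hd))

lemma isEmbedding_toFan (hd : IsDenseNonEndpoints d) {S : Rect} (hS : S.lo < S.hi) :
    IsEmbedding ((setD d).domRestrict S.toFan) := by
  have : CompactSpace (setD d) := isCompact_iff_compactSpace.1 (isCompact_setD hd)
  exact (((continuous_toFan S).comp continuous_subtype_val).isClosedEmbedding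
    ((toFan_injective hS).comp Subtype.val_injective)).isEmbedding

namespace IsTiling

lemma disjoint_map (T : IsTiling d 𝓡) (hd : IsDenseNonEndpoints d) {S S' : Rect} (hS : S ∈ 𝓡)
    (hS' : S' ∈ 𝓡) (hne : S ≠ S') : Disjoint (S.map '' setD d) (S'.map '' setD d) := by
  rw [Set.disjoint_left]
  intro p hp hp'
  rw [Rect.mem_map_setD hd (T.lo_lt_hi S hS)] at hp
  rw [Rect.mem_map_setD hd (T.lo_lt_hi S' hS')] at hp'
  rcases T.isPacking.upp_lt_low hd hS hS' hne hp.1 hp'.1 with h | h <;> linarith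

lemma disjoint_copyD (T : IsTiling d 𝓡) (hd : IsDenseNonEndpoints d) (hR : Function.Injective R)
    (hr : range R = 𝓡) : Pairwise fun m n => Disjoint (copyD d R m) (copyD d R n) := by
  subst hr
  intro m n hne
  rw [copyD, copyD, toFan_image, toFan_image, disjoint_image_iff isEmbedding_toStrip.injective]
  exact T.disjoint_map hd (mem_range_self _) (mem_range_self _) (hR.ne hne)

lemma tendsto_length (T : IsTiling d 𝓡) (hR : Function.Injective R) (hr : range R = 𝓡) :
    Tendsto (fun n => (R n).word.length) atTop atTop := by
  subst hr
  rw [tendsto_atTop]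
  intro b
  have h : (R ⁻¹' {S ∈ range R | S.word.length ≤ b}).Finite :=
    (T.finite_le b).preimage hR.injOn
  have := h.eventually_cofinite_notMem
  rw [Nat.cofinite_eq_atTop] at this
  filter_upwards [this] with n hn
  by_contra! h'
  exact hn ⟨mem_range_self n, h'.le⟩

/-- Both sides of a rectangle of level `m` are at most `1 / (m + 1)`, and only finitely many
rectangles have a given level. The factor `3` is `1` for the horizontal and `2` for the vertical
displacement in `dist_nabla_le`. -/
lemma isNullSequence_of_subset (T : IsTiling d 𝓡) (hd : IsDenseNonEndpoints d)
    (hR : Function.Injective R) (hr : range R = 𝓡) {A : Set (ℝ × ℝ)} (hA : A ⊆ setD d) :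
    IsNullSequence fun n => (R n).toFan '' A := by
  have h1 : Tendsto (fun n => 3 * (1 / (((R n).word.length : ℝ) + 1))) atTop (𝓝 0) := by
    have := (tendsto_one_div_add_atTop_nhds_zero_nat (𝕜 := ℝ)).comp (T.tendsto_length hR hr)
    simpa using this.const_mul 3
  refine squeeze_zero (fun _ => Metric.diam_nonneg) (fun n => ?_) h1
  refine Metric.diam_le_of_forall_dist_le (by positivity) ?_
  rintro _ ⟨p, hp, rfl⟩ _ ⟨q, hq, rfl⟩
  have hp' := setD_subset hd (hA hp)
  have hq' := setD_subset hd (hA hq)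
  have hn : R n ∈ 𝓡 := hr ▸ mem_range_self n
  have hh := T.height_le _ hn
  have hlt := T.lo_lt_hi _ hn
  have hc : |((R n).map p).1 - ((R n).map q).1| ≤ 1 / (((R n).word.length : ℝ) + 1) := by
    have h2 : |p.1 - q.1| ≤ 1 := by
      have h3 := cantorSet_subset_unitInterval hp'.1
      have h4 := cantorSet_subset_unitInterval hq'.1
      exact abs_le.2 ⟨by linarith [h3.1, h4.2], by linarith [h3.2, h4.1]⟩
    have e : ((R n).map p).1 - ((R n).map q).1 = (p.1 - q.1) / 3 ^ (R n).word.length := by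
      simp only [Rect.map]
      ring
    rw [e, abs_div, abs_of_pos (by positivity : (0 : ℝ) < 3 ^ (R n).word.length)]
    gcongr
    have : (R n).word.length + 1 ≤ 3 ^ (R n).word.length := Nat.lt_pow_self (by norm_num)
    exact_mod_cast this
  have ht : |((R n).map p).2 - ((R n).map q).2| ≤ 1 / (((R n).word.length : ℝ) + 1) := by
    have h2 : |p.2 - q.2| ≤ 1 :=
      abs_le.2 ⟨by linarith [hp'.2.1, hq'.2.2], by linarith [hp'.2.2, hq'.2.1]⟩
    have e : ((R n).map p).2 - ((R n).map q).2 = (p.2 - q.2) * ((R n).hi - (R n).lo) := by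
      simp only [Rect.map]
      ring
    rw [e, abs_mul, abs_of_pos (sub_pos.2 hlt)]
    nlinarith
  refine (dist_nabla_le (p := squeeze ((R n).map p)) (q := squeeze ((R n).map q)) ?_ ?_).trans ?_
  · exact cantorSet_subset_unitInterval (piece_subset_cantorSet _ ((R n).map_mem hp'.1))
  · exact Ioo_subset_Icc_self (squash_mem_Ioo _)
  · have h5 := abs_squash_sub_le ((R n).map p).2 ((R n).map q).2
    simp only [squeeze_eq]
    linarith

end IsTiling

/-! ### Zero-dimensionality of the complement of the copies of `D` -/

lemma isZeroDimensional_iff {X : Type*} [TopologicalSpace X] :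
    IsZeroDimensional X ↔ ∀ x : X, ∀ U, IsOpen U → x ∈ U → ∃ V, IsClopen V ∧ x ∈ V ∧ V ⊆ U := by
  constructor
  · intro h x U hU hx
    exact h.exists_subset_of_mem_open hx hU
  · intro h
    refine TopologicalSpace.isTopologicalBasis_of_isOpen_of_nhds (fun U hU => hU.2) ?_
    intro x U hx hU
    exact h x U hU hx

lemma IsZeroDimensional.of_homeomorph {X Y : Type*} [TopologicalSpace X] [TopologicalSpace Y]
    (h : IsZeroDimensional X) (e : X ≃ₜ Y) : IsZeroDimensional Y := by
  rw [isZeroDimensional_iff] at h ⊢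
  intro y U hU hy
  obtain ⟨V, hV, hyV, hVU⟩ := h (e.symm y) (e ⁻¹' U) (hU.preimage e.continuous) (by simpa using hy)
  refine ⟨e.symm ⁻¹' V, hV.preimage e.symm.continuous, hyV, fun z hz => ?_⟩
  simpa using hVU hz

/-- Around a point off the copies, take a small piece of the Cantor set and the region over it
between one copy just below and one just above. The boundary of that region consists of points of
copies, so it is clopen in the complement. -/
lemma IsTiling.isZeroDimensional (T : IsTiling d 𝓡) (hd : IsDenseNonEndpoints d) :
    IsZeroDimensional ((cantorSet ×ˢ univ) \ unionD d 𝓡 : Set (ℝ × ℝ)) := by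
  have hnot : ∀ q ∈ (cantorSet ×ˢ univ) \ unionD d 𝓡, ∀ S ∈ 𝓡, q.1 ∈ piece S.word →
      q.2 < S.low d q.1 ∨ S.upp d q.1 < q.2 := by
    intro q hq S hS hqS
    by_contra! h
    exact hq.2 (mem_biUnion hS ((Rect.mem_map_setD hd (T.lo_lt_hi S hS)).2 ⟨hqS, h⟩))
  rw [isZeroDimensional_iff]
  rintro ⟨⟨c, t⟩, hp⟩ U hU hpU
  obtain ⟨U', hU', rfl⟩ := isOpen_induced_iff.1 hU
  obtain ⟨ε, hε, hεU⟩ := Metric.isOpen_iff.1 hU' _ hpU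
  have hc : c ∈ cantorSet := hp.1.1
  obtain ⟨S, hS, hcS, hS1, hS2⟩ := T.exists_above hd hc (hnot _ hp) (show t < t + ε by linarith)
  obtain ⟨S', hS', hcS', hS1', hS2'⟩ :=
    T.exists_below hd hc (hnot _ hp) (show t - ε < t by linarith)
  have hlt := T.lo_lt_hi S hS
  have hlt' := T.lo_lt_hi S' hS'
  have h1 : ∀ᶠ c' in 𝓝 c, S.upp d c' < t + ε :=
    (Continuous.prodMk_left (X := ℝ) (t + ε)).continuousAt.preimage_mem_nhds
      ((Rect.isOpen_setOf_upp_lt hlt).mem_nhds hS2)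
  have h2 : ∀ᶠ c' in 𝓝 c, t - ε < S'.low d c' :=
    (Continuous.prodMk_left (X := ℝ) (t - ε)).continuousAt.preimage_mem_nhds
      ((Rect.isOpen_setOf_lt_low hlt').mem_nhds hS1')
  obtain ⟨δ, hδ, hδ'⟩ := Metric.eventually_nhds_iff.1 (h1.and h2)
  obtain ⟨N, hN⟩ := exists_piece_subset_Ioo (c := c) (lt_min hδ hε)
  obtain ⟨σ, hσ, hcσ⟩ :=
    exists_mem_piece (max N (max S.word.length S'.word.length)) hc
  have hσN := hN σ (hσ ▸ le_max_left _ _) hcσ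
  obtain ⟨ρ, hρ⟩ := exists_eq_append_of_mem_piece hcS hcσ
    (hσ ▸ (le_max_left _ _).trans (le_max_right _ _))
  obtain ⟨ρ', hρ'⟩ := exists_eq_append_of_mem_piece hcS' hcσ
    (hσ ▸ (le_max_right _ _).trans (le_max_right _ _))
  have hσS : piece σ ⊆ piece S.word := hρ ▸ piece_append_subset _ _
  have hσS' : piece σ ⊆ piece S'.word := hρ' ▸ piece_append_subset _ _
  let V : Set (ℝ × ℝ) := {q | q.1 ∈ piece σ ∧ S'.upp d q.1 < q.2 ∧ q.2 < S.low d q.1}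
  refine ⟨Subtype.val ⁻¹' V, ⟨?_, ?_⟩, ⟨hcσ, hS2', hS1⟩, ?_⟩
  -- Off the copies it makes no difference whether a copy is bounded by `low` or by `upp`. The outer
  -- bounds with weak inequalities give a closed set, the inner ones with strict inequalities an
  -- open set.
  · have e : Subtype.val ⁻¹' V = (Subtype.val ⁻¹' (Prod.fst ⁻¹' piece σ ∩
        ({q | S'.low d q.1 ≤ q.2} ∩ {q | q.2 ≤ S.upp d q.1})) :
          Set ((cantorSet ×ˢ univ) \ unionD d 𝓡 : Set (ℝ × ℝ))) := by
      ext ⟨q, hq⟩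
      constructor
      · rintro ⟨h3, h4, h5⟩
        exact ⟨h3, (Rect.low_le_upp hlt' _).trans h4.le, h5.le.trans (Rect.low_le_upp hlt _)⟩
      · rintro ⟨h3, h4, h5⟩
        exact ⟨h3, (hnot q hq S' hS' (hσS' h3)).resolve_left h4.not_gt,
          (hnot q hq S hS (hσS h3)).resolve_right h5.not_gt⟩
    rw [e]
    refine IsClosed.preimage continuous_subtype_val
      (((isClosed_piece σ).preimage continuous_fst).inter (IsClosed.inter ?_ ?_))
    · simpa [← isOpen_compl_iff, compl_ofPred] using Rect.isOpen_setOf_lt_low (d := d) hlt'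
    · simpa [← isOpen_compl_iff, compl_ofPred] using Rect.isOpen_setOf_upp_lt (d := d) hlt
  · have e : Subtype.val ⁻¹' V = (Subtype.val ⁻¹' (Prod.fst ⁻¹'
        Ioo (leftEnd σ - 1 / 3 ^ σ.length) (rightEnd σ + 1 / 3 ^ σ.length) ∩
        ({q | S'.upp d q.1 < q.2} ∩ {q | q.2 < S.low d q.1})) :
          Set ((cantorSet ×ˢ univ) \ unionD d 𝓡 : Set (ℝ × ℝ))) := by
      ext ⟨q, hq⟩
      exact and_congr_left fun _ => ⟨mem_Ioo_of_mem_piece, mem_piece_of_mem_Ioo hq.1.1⟩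
    rw [e]
    exact IsOpen.preimage continuous_subtype_val ((isOpen_Ioo.preimage continuous_fst).inter
      ((Rect.isOpen_setOf_upp_lt hlt').inter (Rect.isOpen_setOf_lt_low hlt)))
  · rintro ⟨q, hq⟩ ⟨h3, h4, h5⟩
    apply hεU
    have h6 := hσN h3
    have h7 : dist q.1 c < min δ ε := by
      rw [Real.dist_eq, abs_lt]
      constructor <;> linarith [h6.1, h6.2]
    have h8 := hδ' (h7.trans_le (min_le_left _ _))
    rw [Metric.mem_ball, Prod.dist_eq]
    refine max_lt (h7.trans_le (min_le_right _ _)) ?_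
    rw [Real.dist_eq, abs_lt]
    constructor <;> simp only <;>
      linarith [Rect.low_le_upp (d := d) hlt q.1, Rect.low_le_upp (d := d) hlt' q.1, h8.1, h8.2]

lemma iUnion_copyD (hr : range R = 𝓡) : ⋃ n, copyD d R n = toStrip '' unionD d 𝓡 := by
  subst hr
  simp only [copyD, toFan_image, unionD, image_iUnion, biUnion_range]

lemma IsTiling.isZeroDimensional_diff (T : IsTiling d 𝓡) (hd : IsDenseNonEndpoints d)
    (hr : range R = 𝓡) :
    IsZeroDimensional ((nabla '' (cantorSet ×ˢ Ioo 0 1) \ ⋃ n, copyD d R n : Set Plane)) := by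
  rw [iUnion_copyD hr, ← toStrip_image_strip, ← image_sdiff isEmbedding_toStrip.injective]
  exact (T.isZeroDimensional hd).of_homeomorph (isEmbedding_toStrip.homeomorphImage _)

/-! ### The set `X` against the copies of `D` and `E` -/

lemma vertex_notMem_toStrip (A : Set (ℝ × ℝ)) : vertex ∉ toStrip '' A := by
  rintro ⟨p, -, h⟩
  have h1 : toStrip p 1 = vertex 1 := by rw [h]
  rw [toStrip_apply_one] at h1
  exact (squash_mem_Ioo p.2).1.ne' h1

lemma dotNabla_setX : dotNabla (setX d 𝓡) = toStrip '' setY d 𝓡 ∪ {vertex} := by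
  rw [dotNabla, setX, ← image_comp]
  rfl

/-- The copies are disjoint, so a point of the copy in `S` can be deleted only by `S` itself. -/
lemma IsTiling.mem_setY (T : IsTiling d 𝓡) (hd : IsDenseNonEndpoints d) {S : Rect} (hS : S ∈ 𝓡)
    {p : ℝ × ℝ} (hp : p ∈ S.map '' setD d) : p ∈ setY d 𝓡 ↔ p ∈ S.map '' setM d := by
  have hinj := Rect.map_injective (T.lo_lt_hi S hS)
  constructor
  · rintro ⟨-, h⟩
    by_contra hM
    refine h (mem_biUnion hS ?_)
    rw [image_sdiff hinj]
    exact ⟨hp, hM⟩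
  · intro hM
    refine ⟨map_image_subset S (setD_subset_strip hd) hp, ?_⟩
    simp only [mem_iUnion, not_exists]
    intro S' hS' hp'
    by_cases e : S = S'
    · subst e
      rw [image_sdiff hinj] at hp'
      exact hp'.2 hM
    · exact Set.disjoint_left.1 (T.disjoint_map hd hS hS' e) hp (image_mono sdiff_subset hp')

lemma IsTiling.dotNabla_inter (T : IsTiling d 𝓡) (hd : IsDenseNonEndpoints d)
    (hr : range R = 𝓡) :
    dotNabla (setX d 𝓡) ∩ (⋃ n, copyD d R n) = ⋃ n, (R n).toFan '' setM d := by
  subst hr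
  rw [dotNabla_setX, inter_iUnion]
  refine iUnion_congr fun n => ?_
  rw [copyD, toFan_image, toFan_image]
  ext z
  constructor
  · rintro ⟨h | h, h'⟩
    · obtain ⟨p, hp, rfl⟩ := h'
      rw [isEmbedding_toStrip.injective.mem_set_image, T.mem_setY hd (mem_range_self n) hp] at h
      exact mem_image_of_mem _ h
    · rw [mem_singleton_iff.1 h] at h'
      exact absurd h' (vertex_notMem_toStrip _)
  · rintro ⟨p, hp, rfl⟩
    have hp' := image_mono (setM_subset_setD hd) hp
    exact ⟨Or.inl (mem_image_of_mem _ ((T.mem_setY hd (mem_range_self n) hp').2 hp)),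
      mem_image_of_mem _ hp'⟩

lemma isCompact_copyE (hd : IsDenseNonEndpoints d) (n : ℕ) : IsCompact (copyE d R n) :=
  (isCompact_setE hd).image (continuous_toFan _)

lemma copyE_subset_copyD (hd : IsDenseNonEndpoints d) (n : ℕ) : copyE d R n ⊆ copyD d R n :=
  image_mono (setE_subset_setD hd)

lemma IsTiling.disjoint_copyE_dotNabla (T : IsTiling d 𝓡) (hd : IsDenseNonEndpoints d)
    (hr : range R = 𝓡) (n : ℕ) : Disjoint (copyE d R n) (dotNabla (setX d 𝓡)) := by
  subst hr
  rw [dotNabla_setX, copyE, toFan_image, Set.disjoint_left]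
  rintro _ ⟨p, hp, rfl⟩ (h | h)
  · have hp' := image_mono (setE_subset_setD hd) hp
    rw [isEmbedding_toStrip.injective.mem_set_image, T.mem_setY hd (mem_range_self n) hp'] at h
    exact Set.disjoint_left.1 ((disjoint_image_iff (Rect.map_injective
      (T.lo_lt_hi _ (mem_range_self n)))).2 (disjoint_setE_setM hd)) hp h
  · exact vertex_notMem_toStrip _ ⟨p, hp, mem_singleton_iff.1 h⟩

end

/-! ## Shrinking a null-sequence of compact sets to points -/

/-- As `q` is closed, the points whose fibre lies in a given open set form an open set. A fibre is
compact, so finite unions of basic sets suffice, and a countable basis has only countably many of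
these. -/
lemma secondCountableTopology_of_surjective {X Y : Type*} [TopologicalSpace X]
    [TopologicalSpace Y] [CompactSpace X] [SecondCountableTopology X] [T2Space Y] {q : X → Y}
    (hq : Continuous q) (hs : Function.Surjective q) : SecondCountableTopology Y := by
  have hcl : IsClosedMap q := hq.isClosedMap
  let b := TopologicalSpace.countableBasis X
  let W : Set (Set X) → Set Y := fun s => (q '' (⋃₀ s)ᶜ)ᶜ
  have hb := TopologicalSpace.isBasis_countableBasis X
  have hbasis : TopologicalSpace.IsTopologicalBasis (W '' {s | s ⊆ b ∧ s.Finite}) := by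
    refine TopologicalSpace.isTopologicalBasis_of_isOpen_of_nhds ?_ ?_
    · rintro _ ⟨s, ⟨hsb, -⟩, rfl⟩
      exact (hcl _ (isOpen_sUnion fun u hu => hb.isOpen (hsb hu)).isClosed_compl).isOpen_compl
    · intro y O hy hO
      have hK : IsCompact (q ⁻¹' {y}) := (isClosed_singleton.preimage hq).isCompact
      have hcov : ∀ x ∈ q ⁻¹' {y}, ∃ u ∈ b, x ∈ u ∧ u ⊆ q ⁻¹' O := by
        rintro x rfl
        exact hb.exists_subset_of_mem_open hy (hO.preimage hq)
      choose! u hub hxu huO using hcov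
      obtain ⟨t, ht, htc⟩ := hK.elim_nhds_subcover u
        fun x hx => (hb.isOpen (hub x hx)).mem_nhds (hxu x hx)
      refine ⟨W (u '' (t : Set X)), ⟨_, ⟨?_, t.finite_toSet.image _⟩, rfl⟩, ?_, ?_⟩
      · rintro _ ⟨x, hx, rfl⟩
        exact hub x (ht x hx)
      · rintro ⟨x, hx, e⟩
        apply hx
        obtain ⟨x', hx', h⟩ := mem_iUnion₂.1 (htc e)
        exact ⟨u x', ⟨x', hx', rfl⟩, h⟩
      · intro z hz
        obtain ⟨x, rfl⟩ := hs z
        by_contra hxO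
        refine hz ⟨x, ?_, rfl⟩
        rintro ⟨_, ⟨x', hx', rfl⟩, hxu'⟩
        exact hxO (huO x' (ht x' hx') hxu')
  have hcount : {s | s ⊆ b ∧ s.Finite}.Countable := by
    simpa only [and_comm] using
      countable_ofPred_finite_subset (TopologicalSpace.countable_countableBasis X)
  exact hbasis.secondCountableTopology (hcount.image W)

/-- For a closed continuous map, neighbourhoods of `q x` pull back to a base of neighbourhoods of
the fibre, and here the fibre is the single point `x`. -/
lemma isEmbedding_domRestrict_of_isClosedMap {X Y : Type*} [TopologicalSpace X]
    [TopologicalSpace Y] {q : X → Y} (hq : Continuous q) (hcl : IsClosedMap q) {A : Set X}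
    (hA : ∀ x ∈ A, ∀ x', q x' = q x → x' = x) : IsEmbedding (A.domRestrict q) := by
  refine ⟨isInducing_iff_nhds.2 fun x => ?_, fun x y h => Subtype.ext (hA y y.2 x h)⟩
  have h1 : q ⁻¹' {q x} = {(x : X)} := by
    ext x'
    exact ⟨fun h => hA x x.2 x' h, fun h => congrArg q h⟩
  have h2 := hcl.comap_nhds_eq hq (q x)
  rw [h1, nhdsSet_singleton] at h2
  rw [nhds_subtype, ← h2, comap_comap]
  rfl

section

variable {X : Type*} [MetricSpace X] {A : ℕ → Set X}

/-- A null-sequence of disjoint nonempty compact sets. -/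
structure IsShrinkable (A : ℕ → Set X) : Prop where
  nonempty : ∀ n, (A n).Nonempty
  compact : ∀ n, IsCompact (A n)
  disjoint : Pairwise fun m n => Disjoint (A m) (A n)
  diam : Tendsto (fun n => Metric.diam (A n)) atTop (𝓝 0)

namespace IsShrinkable

lemma eq_of_mem (h : IsShrinkable A) {m n : ℕ} {x : X} (hm : x ∈ A m) (hn : x ∈ A n) : m = n := by
  by_contra hne
  exact Set.disjoint_left.1 (h.disjoint hne) hm hn

/-- The `A n` are disjoint, so the relation is already symmetric and transitive, and the generated
equivalence adds only the diagonal. -/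
lemma mk_eq_mk (h : IsShrinkable A) {x y : X} :
    (Quot.mk _ x : Shrink A) = Quot.mk _ y ↔ x = y ∨ ∃ n, x ∈ A n ∧ y ∈ A n := by
  rw [Quot.eq]
  constructor
  · intro hr
    induction hr with
    | rel x y hxy => exact Or.inr hxy
    | refl x => exact Or.inl rfl
    | symm x y _ ih =>
      rcases ih with rfl | ⟨n, h1, h2⟩
      · exact Or.inl rfl
      · exact Or.inr ⟨n, h2, h1⟩
    | trans x y z _ _ ih1 ih2 =>
      rcases ih1 with rfl | ⟨n, h1, h2⟩
      · exact ih2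
      · rcases ih2 with rfl | ⟨m, h3, h4⟩
        · exact Or.inr ⟨n, h1, h2⟩
        · obtain rfl := h.eq_of_mem h2 h3
          exact Or.inr ⟨n, h1, h4⟩
  · rintro (rfl | hxy)
    · exact Relation.EqvGen.refl _
    · exact Relation.EqvGen.rel _ _ hxy

lemma fiber_of_mem (h : IsShrinkable A) {n : ℕ} {x : X} (hx : x ∈ A n) :
    (Quot.mk _ : X → Shrink A) ⁻¹' {Quot.mk _ x} = A n := by
  ext y
  rw [mem_preimage, mem_singleton_iff, h.mk_eq_mk]
  constructor
  · rintro (rfl | ⟨m, h1, h2⟩)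
    · exact hx
    · obtain rfl := h.eq_of_mem h2 hx
      exact h1
  · exact fun hy => Or.inr ⟨n, hy, hx⟩

lemma fiber_of_notMem (h : IsShrinkable A) {x : X} (hx : x ∉ ⋃ n, A n) :
    (Quot.mk _ : X → Shrink A) ⁻¹' {Quot.mk _ x} = {x} := by
  ext y
  rw [mem_preimage, mem_singleton_iff, mem_singleton_iff, h.mk_eq_mk]
  constructor
  · rintro (rfl | ⟨m, h1, h2⟩)
    · rfl
    · exact absurd (mem_iUnion_of_mem m h2) hx
  · exact Or.inl

lemma range_fiber (h : IsShrinkable A) :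
    range (fun p : Shrink A => (Quot.mk _ : X → Shrink A) ⁻¹' {p}) =
      range A ∪ {B | ∃ x, x ∉ ⋃ n, A n ∧ B = {x}} := by
  ext B
  constructor
  · rintro ⟨p, rfl⟩
    obtain ⟨x, rfl⟩ := Quot.exists_rep p
    by_cases hx : x ∈ ⋃ n, A n
    · obtain ⟨n, hn⟩ := mem_iUnion.1 hx
      exact Or.inl ⟨n, (h.fiber_of_mem hn).symm⟩
    · exact Or.inr ⟨x, hx, h.fiber_of_notMem hx⟩
  · rintro (⟨n, rfl⟩ | ⟨x, hx, rfl⟩)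
    · obtain ⟨x, hx⟩ := h.nonempty n
      exact ⟨Quot.mk _ x, h.fiber_of_mem hx⟩
    · exact ⟨Quot.mk _ x, h.fiber_of_notMem hx⟩

lemma isCompact_fiber (h : IsShrinkable A) (p : Shrink A) :
    IsCompact ((Quot.mk _ : X → Shrink A) ⁻¹' {p}) := by
  have hp : (Quot.mk _ : X → Shrink A) ⁻¹' {p} ∈ range A ∪ {B | ∃ x, x ∉ ⋃ n, A n ∧ B = {x}} := by
    rw [← h.range_fiber]
    exact mem_range_self p
  rcases hp with ⟨n, e⟩ | ⟨x, -, e⟩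
  · exact e ▸ h.compact n
  · exact e ▸ isCompact_singleton

/-- The union of the members of the decomposition that are contained in an open set is open. -/
lemma isOpen_core (h : IsShrinkable A) {U : Set X} (hU : IsOpen U) :
    IsOpen {p : Shrink A | (Quot.mk _ : X → Shrink A) ⁻¹' {p} ⊆ U} := by
  rw [← isQuotientMap_quot_mk.isOpen_preimage, isOpen_iff_mem_nhds]
  intro x hx
  have hxU : x ∈ U := hx rfl
  obtain ⟨δ, hδ, hδU⟩ := Metric.isOpen_iff.1 hU x hxU
  -- Members of index at least `N` that meet the ball of radius `δ / 2` stay inside `U`. The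
  -- finitely many earlier ones not contained in `U` are closed and miss `x`, because the fibre of
  -- `x` lies in `U`; a smaller neighbourhood avoids them.
  have hev : ∀ᶠ n in atTop, Metric.diam (A n) < δ / 2 :=
    h.diam.eventually (gt_mem_nhds (by positivity))
  obtain ⟨N, hN⟩ := eventually_atTop.1 hev
  let F : Set ℕ := {n | n < N ∧ ¬ A n ⊆ U}
  have hF : F.Finite := (finite_lt_nat N).subset fun n hn => hn.1
  have hW : (⋃ n ∈ F, A n)ᶜ ∈ 𝓝 x := by
    refine (hF.isClosed_biUnion fun n _ => (h.compact n).isClosed).isOpen_compl.mem_nhds ?_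
    simp only [mem_compl_iff, mem_iUnion, not_exists]
    intro n hn hxn
    apply hn.2
    rw [← h.fiber_of_mem hxn]
    exact hx
  filter_upwards [hW, Metric.ball_mem_nhds x (half_pos hδ)] with y hyW hyx
  have hyU : y ∈ U := hδU (Metric.ball_subset_ball (by linarith) hyx)
  by_cases hy : y ∈ ⋃ n, A n
  · obtain ⟨n, hn⟩ := mem_iUnion.1 hy
    change (Quot.mk _ : X → Shrink A) ⁻¹' {Quot.mk _ y} ⊆ U
    rw [h.fiber_of_mem hn]
    by_contra hnU
    have hnN : N ≤ n := by
      by_contra! hlt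
      exact hyW (mem_biUnion (show n ∈ F from ⟨hlt, hnU⟩) hn)
    refine hnU fun z hz => hδU ?_
    have h1 := Metric.dist_le_diam_of_mem (h.compact n).isBounded hz hn
    have h2 := hN n hnN
    rw [Metric.mem_ball] at hyx ⊢
    linarith [dist_triangle z y x]
  · change (Quot.mk _ : X → Shrink A) ⁻¹' {Quot.mk _ y} ⊆ U
    rw [h.fiber_of_notMem hy]
    exact singleton_subset_iff.2 hyU

lemma isUSCDecomposition (h : IsShrinkable A) :
    IsUSCDecomposition (range A ∪ {B | ∃ x, x ∉ ⋃ n, A n ∧ B = {x}}) := by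
  rw [← h.range_fiber]
  refine ⟨⟨?_, ?_⟩, ?_, ?_⟩
  · rintro ⟨p, hp⟩
    obtain ⟨x, rfl⟩ := Quot.exists_rep p
    exact (Set.ext_iff.1 hp x).1 rfl
  · intro x
    refine ⟨_, ⟨⟨Quot.mk _ x, rfl⟩, rfl⟩, ?_⟩
    rintro _ ⟨⟨p, rfl⟩, hp⟩
    rw [← mem_singleton_iff.1 hp]
  · rintro _ ⟨p, rfl⟩
    exact h.isCompact_fiber p
  · rintro _ ⟨p, rfl⟩ U hU hpU
    refine ⟨Quot.mk _ ⁻¹' {p : Shrink A | (Quot.mk _ : X → Shrink A) ⁻¹' {p} ⊆ U},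
      (h.isOpen_core hU).preimage continuous_quot_mk, ?_, ?_⟩
    · rintro x rfl
      exact hpU
    · rintro _ ⟨p', rfl⟩ ⟨x, hx, hx'⟩
      rw [← mem_singleton_iff.1 hx]
      exact hx'

lemma t2Space (h : IsShrinkable A) : T2Space (Shrink A) := by
  refine ⟨fun p p' hne => ?_⟩
  have hdisj : Disjoint ((Quot.mk _ : X → Shrink A) ⁻¹' {p}) (Quot.mk _ ⁻¹' {p'}) :=
    (disjoint_singleton.2 hne).preimage _
  obtain ⟨U, V, hU, hV, hpU, hpV, hUV⟩ :=
    SeparatedNhds.of_isCompact_isCompact (h.isCompact_fiber p) (h.isCompact_fiber p') hdisj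
  refine ⟨_, _, h.isOpen_core hU, h.isOpen_core hV, hpU, hpV, ?_⟩
  rw [Set.disjoint_left]
  intro r hr hr'
  obtain ⟨x, rfl⟩ := Quot.exists_rep r
  exact Set.disjoint_left.1 hUV (hr rfl) (hr' rfl)

lemma metrizableSpace [CompactSpace X] (h : IsShrinkable A) :
    TopologicalSpace.MetrizableSpace (Shrink A) := by
  have := h.t2Space
  have : SecondCountableTopology (Shrink A) :=
    secondCountableTopology_of_surjective continuous_quot_mk Quot.mk_surjective
  infer_instance

lemma isEmbedding_domRestrict [CompactSpace X] (h : IsShrinkable A) {B : Set X}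
    (hB : Disjoint B (⋃ n, A n)) : IsEmbedding (B.domRestrict (Quot.mk _ : X → Shrink A)) := by
  have := h.t2Space
  refine isEmbedding_domRestrict_of_isClosedMap continuous_quot_mk
    continuous_quot_mk.isClosedMap fun x hx x' e => ?_
  have hx' := h.fiber_of_notMem (Set.disjoint_left.1 hB hx)
  rw [← mem_singleton_iff, ← hx']
  exact e

end IsShrinkable

end

/-! ## The space `𝓕` -/

section

variable {d : ℕ → ℝ} {𝓡 : Set Rect} {R : ℕ → Rect}

lemma copyD_subset_cantorFan (hd : IsDenseNonEndpoints d) (n : ℕ) : copyD d R n ⊆ cantorFan :=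
  (copyD_subset hd n).trans (image_mono (prod_mono le_rfl Ioo_subset_Icc_self))

lemma isCompact_cantorFan : IsCompact cantorFan :=
  (isCompact_cantorSet.prod isCompact_Icc).image continuous_nabla

instance : CompactSpace cantorFan := isCompact_iff_compactSpace.1 isCompact_cantorFan

lemma val_image_fanE (hd : IsDenseNonEndpoints d) (n : ℕ) :
    Subtype.val '' fanE d R n = copyE d R n := by
  rw [fanE, Subtype.image_preimage_coe, inter_eq_right]
  exact (copyE_subset_copyD hd n).trans (copyD_subset_cantorFan hd n)

lemma IsTiling.isShrinkable (T : IsTiling d 𝓡) (hd : IsDenseNonEndpoints d)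
    (hR : Function.Injective R) (hr : range R = 𝓡) : IsShrinkable (fanE d R) := by
  refine ⟨fun n => ?_, fun n => ?_, fun m n hne => ?_, ?_⟩
  · have : (copyE d R n).Nonempty :=
      Nonempty.image _ ⟨(0, debskiFun d 0), Or.inl ⟨zero_mem_cantorSet, rfl⟩⟩
    rw [← val_image_fanE hd] at this
    exact this.of_image
  · rw [Subtype.isCompact_iff, val_image_fanE hd]
    exact isCompact_copyE hd n
  · exact ((T.disjoint_copyD hd hR hr hne).mono (copyE_subset_copyD hd m)
      (copyE_subset_copyD hd n)).preimage _
  · have := T.isNullSequence_of_subset hd hR hr (setE_subset_setD hd)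
    refine this.congr fun n => ?_
    change Metric.diam (copyE d R n) = _
    rw [← val_image_fanE hd]
    exact Isometry.diam_image (f := (Subtype.val : cantorFan → Plane)) isometry_subtype_coe _

end

/-! ### Connectedness of the fan and subcontinua of `𝓕` -/

section

variable {d : ℕ → ℝ} {𝓡 : Set Rect} {R : ℕ → Rect}

lemma vertex_mem_cantorFan : vertex ∈ cantorFan :=
  ⟨(0, 0), ⟨zero_mem_cantorSet, by simp⟩, nabla_zero_height 0⟩

lemma isConnected_cantorFan : IsConnected cantorFan := by
  refine ⟨⟨_, vertex_mem_cantorFan⟩, isPreconnected_of_forall vertex ?_⟩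
  rintro _ ⟨p, hp, rfl⟩
  refine ⟨nabla '' ({p.1} ×ˢ Icc 0 1), ?_, ⟨(p.1, 0), by simp, nabla_zero_height _⟩,
    ⟨p, ⟨rfl, hp.2⟩, rfl⟩, ?_⟩
  · exact image_mono (prod_mono (singleton_subset_iff.2 hp.1) le_rfl)
  · exact (isPreconnected_singleton.prod isPreconnected_Icc).image _ continuous_nabla.continuousOn

lemma height_of_mem_copyE {n : ℕ} {z : Plane} (hz : z ∈ copyE d R n) : z 1 ∈ Ioo (0 : ℝ) 1 := by
  obtain ⟨p, -, rfl⟩ := hz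
  exact squash_mem_Ioo _

lemma toStrip_mem_copyE (hr : range R = 𝓡) {S : Rect} (hS : S ∈ 𝓡) {p : ℝ × ℝ}
    (hp : p ∈ S.map '' setE d) : toStrip p ∈ ⋃ n, copyE d R n := by
  subst hr
  obtain ⟨n, rfl⟩ := hS
  refine mem_iUnion_of_mem n ?_
  rw [copyE, toFan_image]
  exact mem_image_of_mem _ hp

lemma toStrip_unsquash {c y : ℝ} (hy : y ∈ Ioo (0 : ℝ) 1) :
    toStrip (c, unsquash y) = nabla (c, y) := by
  rw [toStrip, squeeze_eq]
  simp only [squash_unsquash hy]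

namespace IsTiling

lemma isContinuum_FSpace (T : IsTiling d 𝓡) (hd : IsDenseNonEndpoints d)
    (hR : Function.Injective R) (hr : range R = 𝓡) : IsContinuum (FSpace d R) := by
  have h := T.isShrinkable hd hR hr
  have hconn : ConnectedSpace cantorFan := isConnected_iff_connectedSpace.1 isConnected_cantorFan
  refine ⟨inferInstance, ?_, h.metrizableSpace, ?_⟩
  · exact Quot.mk_surjective.connectedSpace continuous_quot_mk
  · let x : cantorFan := ⟨vertex, vertex_mem_cantorFan⟩
    let y : cantorFan := ⟨nabla (0, 1), (0, 1), ⟨zero_mem_cantorSet, by simp⟩, rfl⟩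
    refine ⟨Quot.mk _ x, Quot.mk _ y, fun e => ?_⟩
    rcases h.mk_eq_mk.1 e with e | ⟨n, hn, -⟩
    · have : vertex 1 = nabla (0, 1) 1 := by
        rw [show vertex = nabla (0, 1) from congrArg Subtype.val e]
      rw [nabla_apply_one] at this
      simp [vertex] at this
    · have := (height_of_mem_copyE hn).1
      simp [x, vertex] at this

/-- A vertical segment of the fan lies in an open vertical arc of one of the copies of `D` or meets
one of the copies of `E`. -/
lemma exists_arc_or_squash (T : IsTiling d 𝓡) (hd : IsDenseNonEndpoints d) {c y y' : ℝ}
    (hc : c ∈ cantorSet) (hy : 0 < y) (hyy' : y < y') (hy' : y' ≤ 1) :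
    (∃ S ∈ 𝓡, c ∈ piece S.word ∧ squash (S.low d c) < y ∧ y' < squash (S.upp d c)) ∨
      ∃ S ∈ 𝓡, ∃ s, squash s ∈ Icc y y' ∧ (c, s) ∈ S.map '' setE d := by
  -- The middle third has heights strictly between `0` and `1`, where `squash` can be inverted, even
  -- if `y' = 1`. If an arc covers the middle third but not the whole segment, one of its ends lies
  -- in the segment and belongs to `E`.
  have h1 : (2 * y + y') / 3 ∈ Ioo (0 : ℝ) 1 := ⟨by linarith, by linarith⟩
  have h2 : (y + 2 * y') / 3 ∈ Ioo (0 : ℝ) 1 := ⟨by linarith, by linarith⟩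
  have e1 := squash_unsquash h1
  have e2 := squash_unsquash h2
  have hlt : unsquash ((2 * y + y') / 3) < unsquash ((y + 2 * y') / 3) := by
    rw [← squash_strictMono.lt_iff_lt, e1, e2]
    linarith
  rcases T.exists_arc_or hd hc hlt with ⟨S, hS, hcS, h3, h4⟩ | ⟨S, hS, s, hs, hE⟩
  · rw [← squash_strictMono.lt_iff_lt, e1] at h3
    rw [← squash_strictMono.lt_iff_lt, e2] at h4
    have h5 := squash_strictMono.monotone (Rect.low_le_upp (d := d) (T.lo_lt_hi S hS) c)
    by_cases h6 : squash (S.low d c) < y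
    · by_cases h7 : y' < squash (S.upp d c)
      · exact Or.inl ⟨S, hS, hcS, h6, h7⟩
      · exact Or.inr ⟨S, hS, S.upp d c, ⟨by linarith, not_lt.1 h7⟩,
          (Rect.mem_map_setE hd (T.lo_lt_hi S hS)).2 ⟨hcS, Or.inr rfl⟩⟩
    · exact Or.inr ⟨S, hS, S.low d c, ⟨not_lt.1 h6, by linarith⟩,
        (Rect.mem_map_setE hd (T.lo_lt_hi S hS)).2 ⟨hcS, Or.inl rfl⟩⟩
  · refine Or.inr ⟨S, hS, s, ?_, hE⟩
    have h3 := squash_strictMono.monotone hs.1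
    have h4 := squash_strictMono.monotone hs.2
    rw [e1] at h3
    rw [e2] at h4
    constructor <;> linarith

/-- A segment below `y` meets a copy of `E` or lies in an open arc, and then the lower end of that
arc is a point of `E` lower still. Every blade of the fan thus carries points of the copies of `E`
arbitrarily close to the vertex. -/
lemma exists_mem_copyE_below (T : IsTiling d 𝓡) (hd : IsDenseNonEndpoints d) (hr : range R = 𝓡)
    {c y : ℝ} (hc : c ∈ cantorSet) (hy : 0 < y) (hy' : y ≤ 1) :
    ∃ y₀ ∈ Ioo 0 y, nabla (c, y₀) ∈ ⋃ n, copyE d R n := by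
  have key : ∃ S ∈ 𝓡, ∃ s, squash s < y ∧ (c, s) ∈ S.map '' setE d := by
    have h1 : 0 < y / 3 := by positivity
    have h2 : y / 3 < y / 2 := by linarith
    have h3 : y / 2 ≤ 1 := by linarith
    rcases T.exists_arc_or_squash hd hc h1 h2 h3 with ⟨S, hS, hcS, h3, h4⟩ | ⟨S, hS, s, hs, hE⟩
    · exact ⟨S, hS, S.low d c, by linarith,
        (Rect.mem_map_setE hd (T.lo_lt_hi S hS)).2 ⟨hcS, Or.inl rfl⟩⟩
    · exact ⟨S, hS, s, by linarith [hs.2], hE⟩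
  obtain ⟨S, hS, s, hs, hE⟩ := key
  have h := toStrip_mem_copyE hr hS hE
  rw [toStrip, squeeze_eq] at h
  exact ⟨squash s, ⟨(squash_mem_Ioo s).1, hs⟩, h⟩

/-- Below any other point of `K`, at height `y₀` on the same blade, there is a point of a copy of
`E`, which the closed set `K` misses together with all points at that height over a small piece `σ`.
The part of `K` over `σ` above `y₀` is then separated from the rest, which contains the vertex. -/
lemma subset_vertex (T : IsTiling d 𝓡) (hd : IsDenseNonEndpoints d) (hr : range R = 𝓡)
    {K : Set Plane} (hK : IsClosed K) (hconn : IsPreconnected K) (hKF : K ⊆ cantorFan)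
    (hKE : Disjoint K (⋃ n, copyE d R n)) (hv : vertex ∈ K) : K ⊆ {vertex} := by
  intro z hz
  obtain ⟨⟨c, y⟩, ⟨hc, hy⟩, rfl⟩ := hKF hz
  rcases hy.1.eq_or_lt with h0 | h0
  · simp only at h0
    rw [← h0, nabla_zero_height]
    rfl
  exfalso
  obtain ⟨y₀, hy₀, hE⟩ := T.exists_mem_copyE_below hd hr hc h0 hy.2
  have hnear : ∀ᶠ c' in 𝓝 c, nabla (c', y₀) ∈ Kᶜ :=
    (continuous_nabla.comp (Continuous.prodMk_left y₀)).continuousAt.preimage_mem_nhds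
      (hK.isOpen_compl.mem_nhds fun h => Set.disjoint_left.1 hKE h hE)
  obtain ⟨δ, hδ, hδ'⟩ := Metric.eventually_nhds_iff.1 hnear
  obtain ⟨N, hN⟩ := exists_piece_subset_Ioo (c := c) hδ
  obtain ⟨σ, hσ, hcσ⟩ := exists_mem_piece N hc
  have hσK : ∀ c' ∈ piece σ, nabla (c', y₀) ∉ K := by
    intro c' hc'
    have := hN σ hσ.ge hcσ hc'
    refine hδ' ?_
    rw [Real.dist_eq, abs_lt]
    constructor <;> linarith [this.1, this.2]
  have hcont : Continuous fun z : Plane => z 1 := by fun_prop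
  let I := Ioo (leftEnd σ - 1 / 3 ^ σ.length) (rightEnd σ + 1 / 3 ^ σ.length)
  have hO1 : IsOpen ({z : Plane | y₀ < z 1} ∩ fanBase ⁻¹' I) :=
    ContinuousOn.isOpen_inter_preimage
      (fun z hz =>
        (continuousAt_fanBase (hy₀.1.trans (show y₀ < z 1 from hz)).ne').continuousWithinAt)
      (isOpen_lt continuous_const hcont) isOpen_Ioo
  have hO2 : IsOpen ({z : Plane | z 1 < y₀} ∪ ({z : Plane | 0 < z 1} ∩ fanBase ⁻¹' (piece σ)ᶜ)) :=
    (isOpen_lt hcont continuous_const).union (ContinuousOn.isOpen_inter_preimage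
      (fun z hz => (continuousAt_fanBase (show 0 < z 1 from hz).ne').continuousWithinAt)
      (isOpen_lt continuous_const hcont) (isClosed_piece σ).isOpen_compl)
  have hcov : K ⊆ ({z : Plane | y₀ < z 1} ∩ fanBase ⁻¹' I) ∪
      ({z : Plane | z 1 < y₀} ∪ ({z : Plane | 0 < z 1} ∩ fanBase ⁻¹' (piece σ)ᶜ)) := by
    intro w hwK
    obtain ⟨⟨c', y'⟩, ⟨hc', -⟩, rfl⟩ := hKF hwK
    simp only [mem_union, mem_inter_iff, mem_ofPred_eq, mem_preimage, nabla_apply_one,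
      mem_compl_iff]
    rcases lt_trichotomy y' y₀ with h | h | h
    · exact Or.inr (Or.inl h)
    · subst h
      rw [fanBase_nabla hy₀.1.ne']
      exact Or.inr (Or.inr ⟨hy₀.1, fun h => hσK c' h hwK⟩)
    · rw [fanBase_nabla (hy₀.1.trans h).ne']
      by_cases hc'σ : c' ∈ piece σ
      · exact Or.inl ⟨h, mem_Ioo_of_mem_piece hc'σ⟩
      · exact Or.inr (Or.inr ⟨hy₀.1.trans h, hc'σ⟩)
  have hne1 : (K ∩ ({z : Plane | y₀ < z 1} ∩ fanBase ⁻¹' I)).Nonempty := by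
    refine ⟨_, hz, hy₀.2, ?_⟩
    rw [mem_preimage, fanBase_nabla (ne_of_gt h0)]
    exact mem_Ioo_of_mem_piece hcσ
  have hne2 : (K ∩ ({z : Plane | z 1 < y₀} ∪
      ({z : Plane | 0 < z 1} ∩ fanBase ⁻¹' (piece σ)ᶜ))).Nonempty :=
    ⟨_, hv, Or.inl (by simpa [vertex] using hy₀.1)⟩
  obtain ⟨w, hwK, ⟨hw1, hw2⟩, hw3⟩ := hconn _ _ hO1 hO2 hcov hne1 hne2
  obtain ⟨⟨c', y'⟩, ⟨hc', -⟩, rfl⟩ := hKF hwK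
  simp only [mem_union, mem_inter_iff, mem_ofPred_eq, mem_preimage, nabla_apply_one,
    mem_compl_iff] at hw1 hw2 hw3
  rw [fanBase_nabla (hy₀.1.trans hw1).ne'] at hw2 hw3
  rcases hw3 with hw3 | ⟨-, hw3⟩
  · exact lt_asymm hw1 hw3
  · exact hw3 (mem_piece_of_mem_Ioo hc' hw2)

/-- A nondegenerate compact connected subset of the fan that misses all copies of `E` is a segment
in an open vertical arc of a copy of `D`. -/
lemma exists_eq_segment (T : IsTiling d 𝓡) (hd : IsDenseNonEndpoints d) (hr : range R = 𝓡)
    {K : Set Plane} (hK : IsCompact K) (hconn : IsPreconnected K) (hKF : K ⊆ cantorFan)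
    (hKE : Disjoint K (⋃ n, copyE d R n)) (hnt : K.Nontrivial) :
    ∃ S ∈ 𝓡, ∃ c ∈ piece S.word, ∃ y y', y < y' ∧ squash (S.low d c) < y ∧
      y' < squash (S.upp d c) ∧ K = nabla '' ({c} ×ˢ Icc y y') := by
  have hv : vertex ∉ K := fun hv =>
    hnt.not_subset_singleton (T.subset_vertex hd hr hK.isClosed hconn hKF hKE hv)
  have hpos : ∀ z ∈ K, 0 < z 1 := by
    intro z hz
    obtain ⟨⟨c, y⟩, ⟨-, hy⟩, rfl⟩ := hKF hz
    refine lt_of_le_of_ne hy.1 fun h => hv ?_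
    have h : 0 = y := h
    rwa [← h, nabla_zero_height] at hz
  have hbase : ∀ z ∈ K, fanBase z ∈ cantorSet ∧ z = nabla (fanBase z, z 1) ∧ z 1 ≤ 1 := by
    intro z hz
    have h0 := hpos z hz
    obtain ⟨⟨c, y⟩, ⟨hc, hy⟩, rfl⟩ := hKF hz
    rw [fanBase_nabla (ne_of_gt h0)]
    exact ⟨hc, rfl, hy.2⟩
  have hsub : (fanBase '' K).Subsingleton := by
    refine isTotallyDisconnected_cantorSet _ ?_ (hconn.image _ fun z hz =>
      (continuousAt_fanBase (hpos z hz).ne').continuousWithinAt)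
    rintro _ ⟨z, hz, rfl⟩
    exact (hbase z hz).1
  have hcont : Continuous fun z : Plane => z 1 := by fun_prop
  obtain ⟨z₀, hz₀⟩ := hnt.nonempty
  have hc : ∀ z ∈ K, fanBase z = fanBase z₀ := fun z hz =>
    hsub (mem_image_of_mem _ hz) (mem_image_of_mem _ hz₀)
  have hH := eq_Icc_of_connected_compact
    ⟨hnt.nonempty.image _, hconn.image (fun z : Plane => z 1) hcont.continuousOn⟩ (hK.image hcont)
  set c := fanBase z₀
  set y := sInf ((fun z : Plane => z 1) '' K)
  set y' := sSup ((fun z : Plane => z 1) '' K)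
  have hKeq : K = nabla '' ({c} ×ˢ Icc y y') := by
    ext z
    constructor
    · intro hz
      refine ⟨(c, z 1), ⟨rfl, ?_⟩, ?_⟩
      · rw [← hH]
        exact mem_image_of_mem _ hz
      · rw [← hc z hz]
        exact (hbase z hz).2.1.symm
    · rintro ⟨⟨c', t⟩, ⟨hc', ht⟩, rfl⟩
      obtain rfl : c' = c := hc'
      rw [← hH] at ht
      obtain ⟨z, hz, e⟩ := ht
      have e : z 1 = t := e
      rw [← e, ← hc z hz, ← (hbase z hz).2.1]
      exact hz
  have hle : y ≤ y' := by
    by_contra! h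
    rw [hKeq, Icc_eq_empty h.not_ge] at hz₀
    simp at hz₀
  have hlt : y < y' := by
    refine lt_of_le_of_ne hle fun e => ?_
    rw [hKeq, e, Icc_self, singleton_prod_singleton, image_singleton] at hnt
    exact hnt.not_subsingleton subsingleton_singleton
  have hmem : ∀ t ∈ Icc y y', nabla (c, t) ∈ K := by
    intro t ht
    rw [hKeq]
    exact ⟨(c, t), ⟨rfl, ht⟩, rfl⟩
  have hy0 : 0 < y := hpos _ (hmem y ⟨le_rfl, hle⟩)
  have hy1 : y' ≤ 1 := (hbase _ (hmem y' ⟨hle, le_rfl⟩)).2.2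
  rcases T.exists_arc_or_squash hd (hbase z₀ hz₀).1 hy0 hlt hy1 with
    ⟨S, hS, hcS, h3, h4⟩ | ⟨S, hS, s, hs, hE⟩
  · exact ⟨S, hS, c, hcS, y, y', hlt, h3, h4, hKeq⟩
  · exact absurd (toStrip_mem_copyE hr hS hE) (Set.disjoint_left.1 hKE (hmem _ hs))

/-- A subcontinuum of `𝓕` that misses all shrunk copies of `E` is the image of a segment in an
open vertical arc of a copy of `D`. -/
lemma exists_eq_proj_image (T : IsTiling d 𝓡) (hd : IsDenseNonEndpoints d)
    (hR : Function.Injective R) (hr : range R = 𝓡) {S : Set (FSpace d R)} (hS : IsContinuum S)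
    (hSE : ∀ n, Disjoint (proj d R ⁻¹' S) (fanE d R n)) :
    ∃ n, ∃ c ∈ piece (R n).word, ∃ y y', y < y' ∧ squash ((R n).low d c) < y ∧
      y' < squash ((R n).upp d c) ∧
      Subtype.val '' (proj d R ⁻¹' S) = nabla '' ({c} ×ˢ Icc y y') := by
  have h := T.isShrinkable hd hR hr
  have hT2 := h.t2Space
  have hScomp : IsCompact S := isCompact_iff_compactSpace.2 hS.compact
  have hB : IsCompact (proj d R ⁻¹' S) :=
    (hScomp.isClosed.preimage continuous_quot_mk).isCompact
  have hemb := h.isEmbedding_domRestrict (disjoint_iUnion_right.2 hSE)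
  have hrange : (proj d R ⁻¹' S).domRestrict (Quot.mk _ : cantorFan → FSpace d R) '' univ = S := by
    rw [image_univ, range_domRestrict]
    exact image_preimage_eq S Quot.mk_surjective
  -- The preimage misses all `E_n`, so the quotient map embeds it and connectedness passes from `S`
  -- back to the fan.
  have hconn : IsPreconnected (proj d R ⁻¹' S) := by
    rw [isPreconnected_iff_preconnectedSpace, preconnectedSpace_iff_univ,
      ← hemb.isInducing.isPreconnected_image, hrange, isPreconnected_iff_preconnectedSpace]
    exact hS.connected.toPreconnectedSpace
  have hnt : (proj d R ⁻¹' S).Nontrivial := by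
    have hSnt : S.Nontrivial := nontrivial_coe_sort.1 hS.nontrivial
    rw [← image_preimage_eq S Quot.mk_surjective] at hSnt
    exact nontrivial_of_image _ _ hSnt
  obtain ⟨S', hS', c, hc, y, y', hyy', h1, h2, e⟩ := T.exists_eq_segment hd hr
    (hB.image continuous_subtype_val)
    (hconn.image _ continuous_subtype_val.continuousOn) (by rintro _ ⟨x, -, rfl⟩; exact x.2) (by
      rw [disjoint_iUnion_right]
      intro n
      rw [← val_image_fanE hd, disjoint_image_iff Subtype.val_injective]
      exact hSE n) (hnt.image Subtype.val_injective)
  subst hr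
  obtain ⟨n, rfl⟩ := hS'
  exact ⟨n, c, hc, y, y', hyy', h1, h2, e⟩

lemma nabla_mem_copyD (T : IsTiling d 𝓡) (hd : IsDenseNonEndpoints d) (hr : range R = 𝓡) {n : ℕ}
    {c t : ℝ} (hc : c ∈ piece (R n).word)
    (ht : t ∈ Icc (squash ((R n).low d c)) (squash ((R n).upp d c))) :
    nabla (c, t) ∈ copyD d R n := by
  subst hr
  have ht1 : t ∈ Ioo (0 : ℝ) 1 :=
    ⟨(squash_mem_Ioo _).1.trans_le ht.1, ht.2.trans_lt (squash_mem_Ioo _).2⟩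
  rw [copyD, toFan_image, ← toStrip_unsquash ht1]
  refine mem_image_of_mem _ ?_
  rw [Rect.mem_map_setD hd (T.lo_lt_hi _ (mem_range_self n))]
  rw [← squash_unsquash ht1, mem_Icc, squash_strictMono.le_iff_le,
    squash_strictMono.le_iff_le] at ht
  exact ⟨hc, ht⟩

lemma exists_subset_quotD_and_isArc (T : IsTiling d 𝓡) (hd : IsDenseNonEndpoints d)
    (hR : Function.Injective R) (hr : range R = 𝓡) {S : Set (FSpace d R)} (hS : IsContinuum S)
    (hSE : ∀ n, Disjoint (proj d R ⁻¹' S) (fanE d R n)) :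
    ∃ m, S ⊆ quotD d R m ∧ IsArc S := by
  have hT2 := (T.isShrinkable hd hR hr).t2Space
  have h := T.isShrinkable hd hR hr
  obtain ⟨n, c, hc, y, y', hyy', h1, h2, e⟩ := T.exists_eq_proj_image hd hR hr hS hSE
  have hSeq : ∀ p ∈ S, ∃ x : cantorFan, ∃ t ∈ Icc y y',
      proj d R x = p ∧ (x : Plane) = nabla (c, t) := by
    intro p hp
    obtain ⟨x, rfl⟩ := Quot.exists_rep p
    have hx : (x : Plane) ∈ nabla '' ({c} ×ˢ Icc y y') := e ▸ mem_image_of_mem _ hp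
    obtain ⟨⟨c', t⟩, ⟨hc', ht⟩, e'⟩ := hx
    obtain rfl : c' = c := hc'
    exact ⟨x, t, ht, rfl, e'.symm⟩
  refine ⟨n, ?_, ?_⟩
  · intro p hp
    obtain ⟨x, t, ht, rfl, e'⟩ := hSeq p hp
    refine ⟨x, ?_, rfl⟩
    rw [mem_preimage, e']
    exact T.nabla_mem_copyD hd hr hc ⟨h1.le.trans ht.1, ht.2.trans h2.le⟩
  · have hmem : ∀ t : Icc y y', nabla (c, t) ∈ Subtype.val '' (proj d R ⁻¹' S) := by
      intro t
      rw [e]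
      exact ⟨(c, t), ⟨rfl, t.2⟩, rfl⟩
    have hF : ∀ t : Icc y y', nabla (c, t) ∈ cantorFan := by
      intro t
      obtain ⟨x, -, hx⟩ := hmem t
      exact hx ▸ x.2
    let g : Icc y y' → FSpace d R := fun t => proj d R ⟨nabla (c, t), hF t⟩
    have hgS : ∀ t, g t ∈ S := by
      intro t
      obtain ⟨x, hx, hx'⟩ := hmem t
      have : (⟨nabla (c, t), hF t⟩ : cantorFan) = x := Subtype.ext hx'.symm
      simp only [g, this]
      exact hx
    have hg : Continuous g := by
      refine continuous_quot_mk.comp (Continuous.subtype_mk ?_ _)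
      exact continuous_nabla.comp (by fun_prop)
    have hginj : Function.Injective g := by
      intro t t' ht
      have hE : (⟨nabla (c, t), hF t⟩ : cantorFan) ∉ ⋃ n, fanE d R n := by
        rw [mem_iUnion]
        rintro ⟨m, hm⟩
        exact Set.disjoint_left.1 (hSE m) (hgS t) hm
      rcases h.mk_eq_mk.1 ht with e' | ⟨m, hm, -⟩
      · exact Subtype.ext (congrArg (fun x : cantorFan => (x : Plane) 1) e')
      · exact absurd (mem_iUnion_of_mem m hm) hE
    have hgr : range g = S := by
      refine Subset.antisymm (range_subset_iff.2 hgS) fun p hp => ?_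
      obtain ⟨x, t, ht, rfl, e'⟩ := hSeq p hp
      exact ⟨⟨t, ht⟩, congrArg (proj d R) (Subtype.ext e'.symm)⟩
    have hemb : IsEmbedding g := (hg.isClosedEmbedding hginj).isEmbedding
    exact ⟨((Homeomorph.setCongr hgr.symm).trans hemb.toHomeomorph.symm).trans
      (iccHomeoI y y' hyy')⟩

end IsTiling

/-- A countable set of points on the vertical arcs of the copies of `D`. -/
def arcPoints (d : ℕ → ℝ) (R : ℕ → Rect) : Set Plane :=
  range fun i : ℕ × ℕ × ℚ => toStrip (similarity (R i.1).word (d i.2.1), (i.2.2 : ℝ))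

/-- A countable subset of `𝓕` that meets every subcontinuum. -/
def countablePart (d : ℕ → ℝ) (R : ℕ → Rect) : Set (FSpace d R) :=
  (⋃ n, proj d R '' fanE d R n) ∪ proj d R '' (Subtype.val ⁻¹' arcPoints d R)

/-! ### The Suslinian property and the punctiform part -/

namespace IsTiling

lemma countable_countablePart (T : IsTiling d 𝓡) (hd : IsDenseNonEndpoints d)
    (hR : Function.Injective R) (hr : range R = 𝓡) : (countablePart d R).Countable := by
  have h := T.isShrinkable hd hR hr
  refine (countable_iUnion fun n => ?_).union
    (((countable_range _).preimage Subtype.val_injective).image _)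
  refine Subsingleton.countable ?_
  rintro _ ⟨x, hx, rfl⟩ _ ⟨y, hy, rfl⟩
  exact h.mk_eq_mk.2 (Or.inr ⟨n, hx, hy⟩)

/-- A subcontinuum through no `e_n` is a segment inside an open arc. Its base point is a jump of the
copy, and its unsqueezed heights include a rational number. -/
lemma inter_countablePart_nonempty (T : IsTiling d 𝓡) (hd : IsDenseNonEndpoints d)
    (hR : Function.Injective R) (hr : range R = 𝓡) {S : Set (FSpace d R)} (hS : IsContinuum S) :
    (S ∩ countablePart d R).Nonempty := by
  by_cases hSE : ∀ n, Disjoint (proj d R ⁻¹' S) (fanE d R n)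
  · obtain ⟨n, c, hc, y, y', hyy', h1, h2, e⟩ := T.exists_eq_proj_image hd hR hr hS hSE
    have hy : y ∈ Ioo (0 : ℝ) 1 :=
      ⟨(squash_mem_Ioo _).1.trans h1, hyy'.trans (h2.trans (squash_mem_Ioo _).2)⟩
    have hy' : y' ∈ Ioo (0 : ℝ) 1 :=
      ⟨(squash_mem_Ioo _).1.trans (h1.trans hyy'), h2.trans (squash_mem_Ioo _).2⟩
    have hlt : unsquash y < unsquash y' := by
      rwa [← squash_strictMono.lt_iff_lt, squash_unsquash hy, squash_unsquash hy']
    obtain ⟨r, hr1, hr2⟩ := exists_rat_btwn hlt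
    have hlu : (R n).low d c < (R n).upp d c := by
      rw [← squash_strictMono.lt_iff_lt]
      exact h1.trans (hyy'.trans h2)
    -- The arc is nondegenerate, so `f` and `F` differ over the pulled-back base point, which
    -- happens only at a jump.
    have hk : ∃ k, d k = (R n).pull c := by
      rw [← debskiFun_lt_debskiUpper_iff hd.injective]
      have hpos := sub_pos.2 (T.lo_lt_hi (R n) (hr ▸ mem_range_self n))
      unfold Rect.low Rect.upp at hlu
      exact lt_of_mul_lt_mul_right (by linarith) hpos.le
    obtain ⟨k, hk⟩ := hk
    have hmem : nabla (c, squash r) ∈ Subtype.val '' (proj d R ⁻¹' S) := by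
      rw [e]
      refine ⟨(c, squash r), ⟨rfl, ?_, ?_⟩, rfl⟩
      · rw [← squash_unsquash hy]
        exact squash_strictMono.monotone hr1.le
      · rw [← squash_unsquash hy']
        exact squash_strictMono.monotone hr2.le
    obtain ⟨x, hxS, hx⟩ := hmem
    refine ⟨proj d R x, hxS, Or.inr ⟨x, ⟨(n, k, r), ?_⟩, rfl⟩⟩
    rw [hx]
    simp only [hk, Rect.similarity_pull]
    rfl
  · push Not at hSE
    obtain ⟨n, hn⟩ := hSE
    obtain ⟨x, hx, hx'⟩ := Set.not_disjoint_iff.1 hn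
    exact ⟨proj d R x, hx, Or.inl (mem_iUnion_of_mem n (mem_image_of_mem _ hx'))⟩

/-- Pairwise disjoint subcontinua pick distinct points of a countable set. -/
lemma isSuslinianContinuum_FSpace (T : IsTiling d 𝓡) (hd : IsDenseNonEndpoints d)
    (hR : Function.Injective R) (hr : range R = 𝓡) : IsSuslinianContinuum (FSpace d R) := by
  refine ⟨T.isContinuum_FSpace hd hR hr, fun 𝒮 h𝒮 hdisj => ?_⟩
  have h : ∀ S ∈ 𝒮, ∃ p, p ∈ S ∧ p ∈ countablePart d R := fun S hS =>
    T.inter_countablePart_nonempty hd hR hr (h𝒮 S hS)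
  have : Nonempty (FSpace d R) := (T.isContinuum_FSpace hd hR hr).nontrivial.to_nonempty
  choose! p hpS hpQ using h
  refine MapsTo.countable_of_injOn (f := p) hpQ ?_ (T.countable_countablePart hd hR hr)
  intro S hS S' hS' e
  exact hdisj.elim_set hS hS' (p S) (hpS S hS) (e ▸ hpS S' hS')

lemma isPunctiform_compl_countablePart (T : IsTiling d 𝓡) (hd : IsDenseNonEndpoints d)
    (hR : Function.Injective R) (hr : range R = 𝓡) : IsPunctiform (countablePart d R)ᶜ := by
  intro K hK hcont
  obtain ⟨p, hp, hp'⟩ := T.inter_countablePart_nonempty hd hR hr hcont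
  exact hK hp hp'

lemma dotNabla_subset_cantorFan : dotNabla (setX d 𝓡) ⊆ cantorFan := by
  rw [dotNabla_setX]
  refine union_subset ?_ (singleton_subset_iff.2 vertex_mem_cantorFan)
  refine (image_mono sdiff_subset).trans ?_
  rw [toStrip_image_strip]
  exact image_mono (prod_mono le_rfl Ioo_subset_Icc_self)

end IsTiling

end

/-! ## Hawaiian earrings -/

lemma nonempty_homeomorph_of_isQuotientMap {X Y Z : Type*} [TopologicalSpace X]
    [TopologicalSpace Y] [TopologicalSpace Z] {f : X → Y} {g : X → Z} (hf : IsQuotientMap f)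
    (hg : IsQuotientMap g) (h : ∀ x y, f x = f y ↔ g x = g y) : Nonempty (Y ≃ₜ Z) := by
  let f' : C(X, Y) := ⟨f, hf.continuous⟩
  let g' : C(X, Z) := ⟨g, hg.continuous⟩
  have e : Setoid.ker f' = Setoid.ker g' := Setoid.ext fun x y => h x y
  have hf' := IsQuotientMap.homeomorph (f := f') hf
  rw [e] at hf'
  exact ⟨hf'.symm.trans (IsQuotientMap.homeomorph (f := g') hg)⟩

/-- The parametrization of the `k`-th circle of the Hawaiian earring. -/
noncomputable def earringCircle (k : ℕ) (z : Circle) : ℂ := ((1 / 2 : ℝ) ^ k : ℝ) * (1 - z)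

lemma continuous_earringCircle (k : ℕ) : Continuous (earringCircle k) := by
  unfold earringCircle
  fun_prop

lemma half_pow_ne_zero (k : ℕ) : (((1 / 2 : ℝ) ^ k : ℝ) : ℂ) ≠ 0 :=
  Complex.ofReal_ne_zero.2 (by positivity)

lemma earringCircle_injective (k : ℕ) : Function.Injective (earringCircle k) := by
  intro z w h
  have := mul_left_cancel₀ (half_pow_ne_zero k) h
  exact Circle.ext (by linear_combination -this)

lemma earringCircle_one (k : ℕ) : earringCircle k 1 = 0 := by simp [earringCircle]

lemma norm_earringCircle_le (k : ℕ) (z : Circle) : ‖earringCircle k z‖ ≤ (1 / 2 : ℝ) ^ k * 2 := by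
  rw [earringCircle, norm_mul, Complex.norm_real, Real.norm_eq_abs, abs_of_pos (by positivity)]
  gcongr
  refine (norm_sub_le _ _).trans ?_
  rw [norm_one, Circle.norm_coe]
  norm_num

/-- This is the equation of the circle of radius `2⁻ᵏ` tangent to the imaginary axis at `0`.
Subtracting two of these forces the real part to vanish, so different circles meet only at `0`. -/
lemma normSq_of_mem_range {k : ℕ} {w : ℂ} (hw : w ∈ range (earringCircle k)) :
    w.re ^ 2 + w.im ^ 2 = 2 * (1 / 2 : ℝ) ^ k * w.re := by
  obtain ⟨z, rfl⟩ := hw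
  have h : (z : ℂ).re ^ 2 + (z : ℂ).im ^ 2 = 1 := by
    have := Circle.normSq_coe z
    rw [Complex.normSq_apply] at this
    linarith
  rw [earringCircle, Complex.re_ofReal_mul, Complex.im_ofReal_mul]
  simp only [Complex.sub_re, Complex.one_re, Complex.sub_im, Complex.one_im]
  linear_combination ((1 / 2 : ℝ) ^ k) ^ 2 * h

lemma range_earringCircle_inter {m n : ℕ} (h : m ≠ n) :
    range (earringCircle m) ∩ range (earringCircle n) = {0} := by
  refine Subset.antisymm ?_ (singleton_subset_iff.2
    ⟨⟨1, earringCircle_one m⟩, ⟨1, earringCircle_one n⟩⟩)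
  rintro w ⟨hm, hn⟩
  have h1 := normSq_of_mem_range hm
  have h2 := normSq_of_mem_range hn
  have hne : (1 / 2 : ℝ) ^ m - (1 / 2) ^ n ≠ 0 :=
    sub_ne_zero.2 fun e => h (pow_right_injective₀ (by norm_num) (by norm_num) e)
  have hre : w.re = 0 := by
    have : ((1 / 2 : ℝ) ^ m - (1 / 2) ^ n) * w.re = 0 := by linarith
    exact (mul_eq_zero.1 this).resolve_left hne
  have him : w.im = 0 := by
    rw [hre] at h1
    simpa using h1
  exact Complex.ext hre him

/-- The isometry of the complex plane onto the Euclidean plane. -/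
noncomputable def planeIso : ℂ ≃ₗᵢ[ℝ] Plane := Complex.orthonormalBasisOneI.repr

lemma isHawaiianEarring_earring :
    IsHawaiianEarring (planeIso '' ⋃ k, range (earringCircle k)) := by
  refine ⟨fun k => range fun z => planeIso (earringCircle k z), 0, fun k => ?_, ?_, ?_, ?_⟩
  · have hemb : IsEmbedding fun z => planeIso (earringCircle k z) :=
      ((planeIso.continuous.comp (continuous_earringCircle k)).isClosedEmbedding
        (planeIso.injective.comp (earringCircle_injective k))).isEmbedding
    exact ⟨hemb.toHomeomorph⟩
  · have h0 : Tendsto (fun k : ℕ => (1 / 2 : ℝ) ^ k * 4) atTop (𝓝 0) := by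
      simpa using (tendsto_pow_atTop_nhds_zero_of_lt_one (by norm_num : (0 : ℝ) ≤ 1 / 2)
        (by norm_num)).mul_const 4
    refine squeeze_zero (fun _ => Metric.diam_nonneg) (fun k => ?_) h0
    refine Metric.diam_le_of_forall_dist_le (by positivity) ?_
    rintro _ ⟨z, rfl⟩ _ ⟨w, rfl⟩
    rw [planeIso.dist_map, dist_eq_norm]
    linarith [norm_sub_le (earringCircle k z) (earringCircle k w), norm_earringCircle_le k z,
      norm_earringCircle_le k w]
  · rw [image_iUnion]
    exact iUnion_congr fun k => (range_comp planeIso (earringCircle k)).symm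
  · intro m n h
    simp only
    rw [show (fun z => planeIso (earringCircle m z)) = planeIso ∘ earringCircle m from rfl,
      show (fun z => planeIso (earringCircle n z)) = planeIso ∘ earringCircle n from rfl,
      range_comp, range_comp, ← image_inter planeIso.injective, range_earringCircle_inter h]
    simp

/-- The position of the height `t` in the `k`-th jump, cut off at `0` and `1`. -/
noncomputable def jumpParam (d : ℕ → ℝ) (k : ℕ) (t : ℝ) : ℝ :=
  max 0 (min 1 ((t - debskiFun d (d k)) / (1 / 2) ^ (k + 1)))

/-- The map that winds the `k`-th jump once around the `k`-th circle. -/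
noncomputable def loop (d : ℕ → ℝ) (k : ℕ) (t : ℝ) : ℂ :=
  earringCircle k (Circle.exp (2 * Real.pi * jumpParam d k t))

/-- The map that winds every jump once around the corresponding circle. -/
noncomputable def earringMap (d : ℕ → ℝ) (t : ℝ) : ℂ := ∑' k, loop d k t

lemma continuous_loop (d : ℕ → ℝ) (k : ℕ) : Continuous (loop d k) := by
  have : Continuous (jumpParam d k) := by
    unfold jumpParam
    fun_prop
  exact (continuous_earringCircle k).comp (Circle.exp.continuous.comp (by fun_prop))

/-- The circles shrink geometrically, so the series of loops converges uniformly. -/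
lemma continuous_earringMap (d : ℕ → ℝ) : Continuous (earringMap d) := by
  refine continuous_tsum (continuous_loop d) (u := fun k => (1 / 2 : ℝ) ^ k * 2) ?_
    fun k t => norm_earringCircle_le k _
  exact (summable_geometric_of_lt_one (by norm_num) (by norm_num)).mul_right 2

section

variable {d : ℕ → ℝ}

lemma loop_eq_zero (hd : Function.Injective d) {k : ℕ} {t : ℝ}
    (h : t ∉ Ioo (debskiFun d (d k)) (debskiUpper d (d k))) : loop d k t = 0 := by
  have hpos : (0 : ℝ) < (1 / 2) ^ (k + 1) := by positivity
  rw [debskiUpper_apply hd, mem_Ioo, not_and_or, not_lt, not_lt] at h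
  have : jumpParam d k t = 0 ∨ jumpParam d k t = 1 := by
    unfold jumpParam
    rcases h with h | h
    · left
      refine max_eq_left ((min_le_right _ _).trans ?_)
      exact div_nonpos_of_nonpos_of_nonneg (by linarith) hpos.le
    · right
      rw [min_eq_left, max_eq_right zero_le_one]
      rw [le_div_iff₀ hpos]
      linarith
  rcases this with e | e <;> rw [loop, e]
  · rw [mul_zero, Circle.exp_zero, earringCircle_one]
  · rw [mul_one, Circle.exp_two_pi, earringCircle_one]

lemma jumpParam_of_mem {k : ℕ} {u : ℝ} (hu : u ∈ Icc (0 : ℝ) 1) :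
    jumpParam d k (debskiFun d (d k) + u * (1 / 2) ^ (k + 1)) = u := by
  have hpos : (0 : ℝ) < (1 / 2) ^ (k + 1) := by positivity
  rw [jumpParam, add_sub_cancel_left, mul_div_cancel_right₀ _ hpos.ne', min_eq_right hu.2,
    max_eq_right hu.1]

/-- A loop is nonzero only inside its own jump interval, and these intervals are disjoint. This is
why a function of the height alone can tell the arcs apart. -/
lemma earringMap_eq_loop (hd : IsDenseNonEndpoints d) {k : ℕ} {t : ℝ}
    (h1 : debskiFun d (d k) ≤ t) (h2 : t ≤ debskiUpper d (d k)) : earringMap d t = loop d k t := by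
  refine tsum_eq_single k fun j hj => loop_eq_zero hd.injective fun h => hj ?_
  exact hd.injective (eq_of_height_mem_Ioo h1 h2 h).symm

lemma earringMap_of_mem_setE (hd : IsDenseNonEndpoints d) {p : ℝ × ℝ} (hp : p ∈ setE d) :
    earringMap d p.2 = 0 := by
  have hD := (mem_setD hd).1 (setE_subset_setD hd hp)
  rw [mem_setE hd] at hp
  have : ∀ k, loop d k p.2 = 0 := by
    refine fun k => loop_eq_zero hd.injective fun h => ?_
    have e := eq_of_height_mem_Ioo hD.2.1 hD.2.2 h
    rw [← e] at h
    rcases hp.2 with e' | e'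
    · exact h.1.ne' e'
    · exact h.2.ne e'
  simp [earringMap, this]

/-- A point of `D` outside `E` lies in the interior of a vertical arc. -/
lemma exists_of_notMem_setE (hd : IsDenseNonEndpoints d) {p : ℝ × ℝ} (hp : p ∈ setD d)
    (hE : p ∉ setE d) : ∃ k, ∃ u ∈ Ioo (0 : ℝ) 1,
      p = (d k, debskiFun d (d k) + u * (1 / 2) ^ (k + 1)) ∧
      earringMap d p.2 = earringCircle k (Circle.exp (2 * Real.pi * u)) := by
  rw [mem_setD hd] at hp
  rw [mem_setE hd, not_and, not_or] at hE
  have hE := hE hp.1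
  have h1 := lt_of_le_of_ne hp.2.1 (Ne.symm hE.1)
  have h2 := lt_of_le_of_ne hp.2.2 hE.2
  obtain ⟨k, hk⟩ := (debskiFun_lt_debskiUpper_iff hd.injective).1 (h1.trans h2)
  obtain ⟨c, t⟩ := p
  simp only at hk
  subst hk
  simp only at h1 h2
  have hpos : (0 : ℝ) < (1 / 2) ^ (k + 1) := by positivity
  have ht : t = debskiFun d (d k) +
      (t - debskiFun d (d k)) / (1 / 2) ^ (k + 1) * (1 / 2) ^ (k + 1) := by
    rw [div_mul_cancel₀ _ hpos.ne']
    ring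
  have hu : (t - debskiFun d (d k)) / (1 / 2) ^ (k + 1) ∈ Ioo (0 : ℝ) 1 := by
    rw [debskiUpper_apply hd.injective] at h2
    refine ⟨div_pos (by linarith) hpos, ?_⟩
    rw [div_lt_one hpos]
    linarith
  refine ⟨k, _, hu, Prod.ext rfl ht, ?_⟩
  simp only
  rw [earringMap_eq_loop hd h1.le h2.le, loop]
  congr 3
  conv_lhs => rw [ht]
  exact jumpParam_of_mem (Ioo_subset_Icc_self hu)

lemma circleExp_injOn : InjOn (fun u : ℝ => Circle.exp (2 * Real.pi * u)) (Ico 0 1) := by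
  intro u hu v hv h
  have hpi := Real.pi_pos
  obtain ⟨m, hm⟩ := Circle.exp_eq_exp.1 h
  have h1 : u = v + m := by
    have : 2 * Real.pi * u = 2 * Real.pi * (v + m) := by rw [hm]; ring
    exact mul_left_cancel₀ (by positivity) this
  have h2 : (m : ℝ) < 1 := by linarith [hu.2, hv.1]
  have h3 : (-1 : ℝ) < m := by linarith [hu.1, hv.2]
  have h4 : m < 1 := by exact_mod_cast h2
  have h5 : -1 < m := by exact_mod_cast h3
  have h6 : m = 0 := by omega
  rw [h1, h6]
  simp

lemma earringMap_ne_zero (hd : IsDenseNonEndpoints d) {p : ℝ × ℝ} (hp : p ∈ setD d)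
    (hE : p ∉ setE d) : earringMap d p.2 ≠ 0 := by
  obtain ⟨k, u, hu, -, e⟩ := exists_of_notMem_setE hd hp hE
  rw [e, ← earringCircle_one k]
  intro h
  have h1 := earringCircle_injective k h
  have h2 : u = 0 := circleExp_injOn (Ioo_subset_Ico_self hu) ⟨le_rfl, one_pos⟩ (by simpa using h1)
  exact hu.1.ne' h2

/-- Each open arc is mapped injectively into its circle without `0`, circles of different arcs share
only `0`, and the value `0` is taken precisely on `E`. -/
lemma earringMap_eq_iff (hd : IsDenseNonEndpoints d) {p p' : ℝ × ℝ} (hp : p ∈ setD d)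
    (hp' : p' ∈ setD d) :
    earringMap d p.2 = earringMap d p'.2 ↔ p = p' ∨ (p ∈ setE d ∧ p' ∈ setE d) := by
  constructor
  · intro h
    by_cases hE : p ∈ setE d
    · by_cases hE' : p' ∈ setE d
      · exact Or.inr ⟨hE, hE'⟩
      · rw [earringMap_of_mem_setE hd hE] at h
        exact absurd h.symm (earringMap_ne_zero hd hp' hE')
    · by_cases hE' : p' ∈ setE d
      · rw [earringMap_of_mem_setE hd hE'] at h
        exact absurd h (earringMap_ne_zero hd hp hE)
      · have h0 := earringMap_ne_zero hd hp hE
        obtain ⟨k, u, hu, e1, e2⟩ := exists_of_notMem_setE hd hp hE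
        obtain ⟨k', u', hu', e1', e2'⟩ := exists_of_notMem_setE hd hp' hE'
        by_cases hk : k = k'
        · subst hk
          rw [e2, e2'] at h
          have := circleExp_injOn (Ioo_subset_Ico_self hu) (Ioo_subset_Ico_self hu')
            (earringCircle_injective k h)
          exact Or.inl (by rw [e1, e1', this])
        · exfalso
          have : earringMap d p.2 ∈ range (earringCircle k) ∩ range (earringCircle k') :=
            ⟨e2 ▸ mem_range_self _, h ▸ e2' ▸ mem_range_self _⟩
          rw [range_earringCircle_inter hk] at this
          exact h0 this
  · rintro (rfl | ⟨h, h'⟩)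
    · rfl
    · rw [earringMap_of_mem_setE hd h, earringMap_of_mem_setE hd h']

lemma earringMap_image (hd : IsDenseNonEndpoints d) :
    (fun p : ℝ × ℝ => earringMap d p.2) '' setD d = ⋃ k, range (earringCircle k) := by
  refine Subset.antisymm ?_ ?_
  · rintro _ ⟨p, hp, rfl⟩
    by_cases hE : p ∈ setE d
    · simp only [earringMap_of_mem_setE hd hE]
      exact mem_iUnion_of_mem 0 ⟨1, earringCircle_one 0⟩
    · obtain ⟨k, u, -, -, e⟩ := exists_of_notMem_setE hd hp hE
      simp only [e]
      exact mem_iUnion_of_mem k (mem_range_self _)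
  · refine iUnion_subset fun k => ?_
    rintro _ ⟨z, rfl⟩
    have hpi := Real.pi_pos
    obtain ⟨θ, hθ, rfl⟩ : ∃ θ ∈ Ico 0 (2 * Real.pi), Circle.exp θ = z := by
      have hper : Function.Periodic Circle.exp (2 * Real.pi) := Circle.periodic_exp
      obtain ⟨θ, hθ, e⟩ := hper.exists_mem_Ico₀ (by positivity) (Complex.arg z)
      exact ⟨θ, hθ, by rw [← e, Circle.exp_arg]⟩
    have hpos : (0 : ℝ) < (1 / 2) ^ (k + 1) := by positivity
    have hu : θ / (2 * Real.pi) ∈ Icc (0 : ℝ) 1 := by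
      refine ⟨div_nonneg hθ.1 (by positivity), ?_⟩
      rw [div_le_one (by positivity)]
      exact hθ.2.le
    have h1 : debskiFun d (d k) ≤ debskiFun d (d k) + θ / (2 * Real.pi) * (1 / 2) ^ (k + 1) := by
      have := mul_nonneg hu.1 hpos.le
      linarith
    have h2 : debskiFun d (d k) + θ / (2 * Real.pi) * (1 / 2) ^ (k + 1) ≤ debskiUpper d (d k) := by
      rw [debskiUpper_apply hd.injective]
      have := mul_le_mul_of_nonneg_right hu.2 hpos.le
      linarith
    refine ⟨(d k, debskiFun d (d k) + θ / (2 * Real.pi) * (1 / 2) ^ (k + 1)),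
      (mem_setD hd).2 ⟨hd.mem k, h1, h2⟩, ?_⟩
    simp only
    rw [earringMap_eq_loop hd h1 h2, loop, jumpParam_of_mem hu, mul_div_cancel₀]
    positivity

variable {𝓡 : Set Rect} {R : ℕ → Rect}

/-- The image of `D` in `𝓕` is a Hawaiian earring. -/
lemma IsTiling.nonempty_quotD_homeomorph (T : IsTiling d 𝓡) (hd : IsDenseNonEndpoints d)
    (hR : Function.Injective R) (hr : range R = 𝓡) (n : ℕ) :
    Nonempty (quotD d R n ≃ₜ (planeIso '' ⋃ k, range (earringCircle k) : Set Plane)) := by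
  have h := T.isShrinkable hd hR hr
  have hT2 := h.t2Space
  have hcomp : CompactSpace (setD d) := isCompact_iff_compactSpace.1 (isCompact_setD hd)
  have hlt : (R n).lo < (R n).hi := T.lo_lt_hi _ (hr ▸ mem_range_self n)
  have hfan : ∀ p : setD d, (R n).toFan p ∈ cantorFan := fun p =>
    copyD_subset_cantorFan hd n (mem_image_of_mem _ p.2)
  have hfanE : ∀ p : setD d, (⟨(R n).toFan p, hfan p⟩ : cantorFan) ∈ fanE d R n ↔
      (p : ℝ × ℝ) ∈ setE d := fun p => (toFan_injective hlt).mem_set_image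
  -- Both `f` and `g` map the compact set `D` continuously onto a Hausdorff space, so both are
  -- quotient maps, and both identify exactly the points of `E`. Their targets are therefore
  -- homeomorphic.
  let f : setD d → quotD d R n := fun p =>
    ⟨proj d R ⟨(R n).toFan p, hfan p⟩, ⟨_, mem_image_of_mem _ p.2, rfl⟩⟩
  have hf : Continuous f := by
    refine Continuous.subtype_mk (continuous_quot_mk.comp (Continuous.subtype_mk ?_ _)) _
    exact (continuous_toFan _).comp continuous_subtype_val
  have hfs : Function.Surjective f := by
    rintro ⟨_, x, ⟨p, hp, e⟩, rfl⟩
    exact ⟨⟨p, hp⟩, Subtype.ext (congrArg (proj d R) (Subtype.ext e))⟩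
  let g : setD d → (planeIso '' ⋃ k, range (earringCircle k) : Set Plane) := fun p =>
    ⟨planeIso (earringMap d (p : ℝ × ℝ).2),
      mem_image_of_mem _ (earringMap_image hd ▸ mem_image_of_mem _ p.2)⟩
  have hg : Continuous g := by
    refine Continuous.subtype_mk (planeIso.continuous.comp ?_) _
    exact (continuous_earringMap d).comp (continuous_snd.comp continuous_subtype_val)
  have hgs : Function.Surjective g := by
    rintro ⟨_, w, hw, rfl⟩
    rw [← earringMap_image hd] at hw
    obtain ⟨p, hp, e⟩ := hw
    exact ⟨⟨p, hp⟩, Subtype.ext (congrArg planeIso e)⟩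
  refine nonempty_homeomorph_of_isQuotientMap (hf.isClosedMap.isQuotientMap hf hfs)
    (hg.isClosedMap.isQuotientMap hg hgs) fun p p' => ?_
  rw [Subtype.ext_iff, Subtype.ext_iff, planeIso.injective.eq_iff, earringMap_eq_iff hd p.2 p'.2]
  refine h.mk_eq_mk.trans (or_congr ?_ ?_)
  · rw [Subtype.ext_iff, (toFan_injective hlt).eq_iff]
  · constructor
    · rintro ⟨m, hm, hm'⟩
      have e : m = n := by
        by_contra hne
        exact Set.disjoint_left.1 (T.disjoint_copyD hd hR hr hne)
          (copyE_subset_copyD hd m hm) (mem_image_of_mem _ p.2)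
      subst e
      exact ⟨(hfanE p).1 hm, (hfanE p').1 hm'⟩
    · exact fun hE => ⟨n, (hfanE p).2 hE.1, (hfanE p').2 hE.2⟩

end

end Debski

theorem mainTheorem3 :
    (∃ d : ℕ → ℝ, IsDenseNonEndpoints d) ∧
    ∀ d : ℕ → ℝ, IsDenseNonEndpoints d →
      -- `E` is the closure of the graph of the Dębski function and is compact
      closure (graphSet d) = setE d ∧ IsCompact (setE d) ∧
      -- the recursive construction can be carried out
      (∃ 𝓡 : Set Rect, IsTiling d 𝓡) ∧
      ∀ 𝓡 : Set Rect, IsTiling d 𝓡 →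
        𝓡.Countable ∧ 𝓡.Infinite ∧
        ∀ R : ℕ → Rect, Function.Injective R → range R = 𝓡 →
          -- the `D_n` are a null-sequence of disjoint copies of `D` in the open fan
          (∀ n, copyD d R n ⊆ nabla '' (cantorSet ×ˢ Ioo 0 1)) ∧
          (∀ n, IsEmbedding ((setD d).domRestrict (R n).toFan)) ∧
          Pairwise (fun m n => Disjoint (copyD d R m) (copyD d R n)) ∧
          IsNullSequence (copyD d R) ∧
          IsZeroDimensional
            ((nabla '' (cantorSet ×ˢ Ioo 0 1) \ ⋃ n, copyD d R n : Set Plane)) ∧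
          dotNabla (setX d 𝓡) ∩ (⋃ n, copyD d R n) = ⋃ n, (R n).toFan '' setM d ∧
          -- the `E_n` are a null-sequence of compact sets that miss the set `∇X`
          (∀ n, IsCompact (copyE d R n)) ∧ IsNullSequence (copyE d R) ∧
          (∀ n, Disjoint (copyE d R n) (dotNabla (setX d 𝓡))) ∧
          -- `𝓕` is an upper semi-continuous decomposition of the Cantor fan
          IsUSCDecomposition (decomposition d R) ∧
          range (fun p : FSpace d R => proj d R ⁻¹' {p}) = decomposition d R ∧
          -- `𝓕` is a Suslinian continuum
          IsSuslinianContinuum (FSpace d R) ∧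
          -- `𝓕` contains `∇X`
          dotNabla (setX d 𝓡) ⊆ cantorFan ∧
          IsEmbedding (Set.domRestrict
            (Subtype.val ⁻¹' dotNabla (setX d 𝓡) : Set cantorFan) (proj d R)) ∧
          -- every `𝓓_n` is a Hawaiian earring
          (∀ n, ∃ H : Set Plane, IsHawaiianEarring H ∧ Nonempty (quotD d R n ≃ₜ H)) ∧
          ∃ e : ℕ → FSpace d R, (∀ n, proj d R ⁻¹' {e n} = fanE d R n) ∧
            -- every subcontinuum that avoids all points `e_n` is an arc in some `𝓓_m`
            (∀ S : Set (FSpace d R), IsContinuum S → Disjoint S (range e) →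
              ∃ m, S ⊆ quotD d R m ∧ IsArc S) ∧
            -- `𝓕` is the union of a punctiform set and a countable set
            ∃ P Q : Set (FSpace d R), P ∪ Q = univ ∧ IsPunctiform P ∧ Q.Countable := by
  refine ⟨exists_isDenseNonEndpoints, fun d hd => ⟨closure_graphSet hd, isCompact_setE hd,
    exists_isTiling hd, fun 𝓡 T => ⟨T.countable, T.infinite hd, fun R hR hr => ?_⟩⟩⟩
  have h := T.isShrinkable hd hR hr
  have hdisj := T.disjoint_copyE_dotNabla hd hr
  have he : ∀ n, ∃ p, proj d R ⁻¹' {p} = fanE d R n := by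
    intro n
    obtain ⟨x, hx⟩ := h.nonempty n
    exact ⟨proj d R x, h.fiber_of_mem hx⟩
  choose e he using he
  refine ⟨copyD_subset hd, fun n => isEmbedding_toFan hd (T.lo_lt_hi _ (hr ▸ mem_range_self n)),
    T.disjoint_copyD hd hR hr, T.isNullSequence_of_subset hd hR hr Subset.rfl,
    T.isZeroDimensional_diff hd hr, T.dotNabla_inter hd hr, isCompact_copyE hd,
    T.isNullSequence_of_subset hd hR hr (setE_subset_setD hd), hdisj, h.isUSCDecomposition,
    h.range_fiber, T.isSuslinianContinuum_FSpace hd hR hr, IsTiling.dotNabla_subset_cantorFan,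
    h.isEmbedding_domRestrict ?_, fun n => ⟨_, isHawaiianEarring_earring,
      T.nonempty_quotD_homeomorph hd hR hr n⟩, e, he, fun S hS hSe => ?_,
    (countablePart d R)ᶜ, countablePart d R, compl_union_self _,
    T.isPunctiform_compl_countablePart hd hR hr, T.countable_countablePart hd hR hr⟩
  · rw [disjoint_iUnion_right]
    exact fun n => (hdisj n).symm.preimage _
  · refine T.exists_subset_quotD_and_isArc hd hR hr hS fun n => ?_
    rw [← he n]
    exact (hSe.mono_right (singleton_subset_iff.2 (mem_range_self n))).preimage _
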